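/- Let $m$ be a positive integer and let $dA$ be area measure on $\mathbb{C}$. For $0<p\le\infty$ let $F^{p}$ be the Fock space of entire functions $f$ with $f(z)e^{-|z|^2/2}\in L^p(\mathbb{C},dA)$, and let $F^{p,m}$ be the Fock–Sobolev space of entire functions $f$ such that $f^{(m)}\in F^{p}$, with the norm $$\|f\|_{p,m}=\left[c(p,m)\int_{\mathbb{C}}\left|z^m f(z)e^{-|z|^2/2}\right|^p dA(z)\right]^{1/p}\ (0<p<\infty),\qquad \|f\|_{\infty,m}=\sup_{z\in\mathbb{C}}\left|z^m f(z)e^{-|z|^2/2}\right|,$$ where $c(p,m)=\dfrac{(p/2)^{(mp/2)+1}}{\pi\,\Gamma((mp/2)+1)}$. For Banach spaces $X_0,X_1$ contained in a common vector space, let $\mathcal{F}(X_0,X_1)$ be the class of functions $F$ from the strip $\{0\le\operatorname{Re}\zeta\le1\}$ to $X_0+X_1$ (normed by $\inf\{\|a\|_{X_0}+\|b\|_{X_1}: v=a+b\}$) that are bounded and continuous on the closed strip and holomorphic in its interior, and for which $t\mapsto F(it)$ and $t\mapsto F(1+it)$ are bounded continuous functions from $\mathbb{R}$ to $X_0$ and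 to $X_1$, respectively. The complex interpolation space is $[X_0,X_1]_\theta=\{F(\theta):F\in\mathcal{F}(X_0,X_1)\}$ with the norm $$\|v\|_\theta=\inf\Big\{\max\big(\sup_{t}\|F(it)\|_{X_0},\ \sup_{t}\|F(1+it)\|_{X_1}\big): F\in\mathcal{F}(X_0,X_1),\ F(\theta)=v\Big\}.$$ Theorem. Suppose $1\le p_0<p_1\le\infty$, $\theta\in(0,1)$, and $\dfrac1p=\dfrac{1-\theta}{p_0}+\dfrac{\theta}{p_1}$. Then $[F^{p_0,m},F^{p_1,m}]_\theta=F^{p,m}$ as sets of entire functions, with equivalent norms: there is a constant $C$ such that $\|f\|_\theta\le C\|f\|_{p,m}$ and $\|f\|_{p,m}\le C\|f\|_\theta$ for all $f\in F^{p,m}$. -/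

import Mathlib

open MeasureTheory Filter Topology Complex
open scoped ENNReal NNReal

/-! ### Complex interpolation (Calderón's method)

A normed space `X` that is a linear subspace of a complex vector space `V` is represented by its
extended norm `N : V → ℝ≥0∞`, that is `N v = ‖v‖_X` for `v ∈ X` and `N v = ∞` for `v ∉ X`. -/

section ComplexInterpolation

open Complex.HadamardThreeLines

variable {V : Type*} [AddCommGroup V] [Module ℂ V]

/-- The (extended) norm of the sum space `X₀ + X₁`: the infimum of `‖a‖₀ + ‖b‖₁` over all
decompositions `v = a + b`. -/
noncomputable def sumENorm (N₀ N₁ : V → ℝ≥0∞) (v : V) : ℝ≥0∞ :=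
  ⨅ (a : V) (b : V) (_ : a + b = v), N₀ a + N₁ b

/-- The class of functions `F` on the closed strip `0 ≤ Re ζ ≤ 1` used in the complex method:
`F` takes values in `X₀ + X₁`, is bounded and continuous on the closed strip and holomorphic in
the open strip for the norm of `X₀ + X₁`, and its restrictions to the lines `Re ζ = 0` and
`Re ζ = 1` are bounded continuous functions with values in `X₀` and in `X₁`. The values of `F`
outside the closed strip are irrelevant. -/
structure IsCalderonFunction (N₀ N₁ : V → ℝ≥0∞) (F : ℂ → V) : Prop where
  bounded : ∃ C : ℝ≥0, ∀ ζ ∈ verticalClosedStrip 0 1, sumENorm N₀ N₁ (F ζ) ≤ C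
  continuous : ∀ ζ ∈ verticalClosedStrip 0 1,
    Tendsto (fun ω => sumENorm N₀ N₁ (F ω - F ζ)) (𝓝[verticalClosedStrip 0 1] ζ) (𝓝 0)
  holomorphic : ∀ ζ ∈ verticalStrip 0 1, ∃ D : V, sumENorm N₀ N₁ D < ∞ ∧
    Tendsto (fun ω => sumENorm N₀ N₁ ((ω - ζ)⁻¹ • (F ω - F ζ) - D)) (𝓝[≠] ζ) (𝓝 0)
  bounded_left : ∃ C : ℝ≥0, ∀ t : ℝ, N₀ (F (t * I)) ≤ C
  continuous_left : ∀ t : ℝ, Tendsto (fun s : ℝ => N₀ (F (s * I) - F (t * I))) (𝓝 t) (𝓝 0)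
  bounded_right : ∃ C : ℝ≥0, ∀ t : ℝ, N₁ (F (1 + t * I)) ≤ C
  continuous_right :
    ∀ t : ℝ, Tendsto (fun s : ℝ => N₁ (F (1 + s * I) - F (1 + t * I))) (𝓝 t) (𝓝 0)

/-- The norm of a function on the strip:
`max (sup_t ‖F(it)‖₀) (sup_t ‖F(1 + it)‖₁)`. -/
noncomputable def calderonENorm (N₀ N₁ : V → ℝ≥0∞) (F : ℂ → V) : ℝ≥0∞ :=
  max (⨆ t : ℝ, N₀ (F (t * I))) (⨆ t : ℝ, N₁ (F (1 + t * I)))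

/-- The complex interpolation space `[X₀, X₁]_θ`. -/
def complexInterpolationSpace (N₀ N₁ : V → ℝ≥0∞) (θ : ℝ) : Set V :=
  {v | ∃ F : ℂ → V, IsCalderonFunction N₀ N₁ F ∧ F θ = v}

/-- The norm of the complex interpolation space `[X₀, X₁]_θ`. -/
noncomputable def complexInterpolationENorm (N₀ N₁ : V → ℝ≥0∞) (θ : ℝ) (v : V) : ℝ≥0∞ :=
  ⨅ (F : ℂ → V) (_ : IsCalderonFunction N₀ N₁ F ∧ F θ = v), calderonENorm N₀ N₁ F

end ComplexInterpolation

/-! ### Fock spaces and Fock-Sobolev spaces -/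

/-- The Fock space `F^p`: entire functions `f` such that `f(z) e^{-|z|²/2}` is in `L^p(ℂ, dA)`. -/
def FockSpace (p : ℝ≥0∞) : Set (ℂ → ℂ) :=
  {f | Differentiable ℂ f ∧
    MemLp (fun z : ℂ => f z * (Real.exp (-‖z‖ ^ 2 / 2) : ℂ)) p volume}

/-- The Fock-Sobolev space `F^{p,m}`: entire functions `f` whose `m`-th derivative is in `F^p`. -/
def FockSobolevSpace (p : ℝ≥0∞) (m : ℕ) : Set (ℂ → ℂ) :=
  {f | Differentiable ℂ f ∧ iteratedDeriv m f ∈ FockSpace p}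

/-- The constant `c(p,m) = (p/2)^{mp/2+1} / (π Γ(mp/2+1))` which gives the constant function `1`
norm one. -/
noncomputable def fockSobolevConst (p : ℝ) (m : ℕ) : ℝ :=
  (p / 2) ^ (m * p / 2 + 1) / (Real.pi * Real.Gamma (m * p / 2 + 1))

/-- The quantity `‖f‖_{p,m}`: the weighted `L^p`-norm
`(c(p,m) ∫ |z^m f(z) e^{-|z|²/2}|^p dA(z))^{1/p}` if `p < ∞`, and
`sup_z |z^m f(z) e^{-|z|²/2}|` if `p = ∞`. -/
noncomputable def weightedENorm (p : ℝ≥0∞) (m : ℕ) (f : ℂ → ℂ) : ℝ≥0∞ :=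
  if p = ∞ then ⨆ z : ℂ, ‖z ^ m * f z * (Real.exp (-‖z‖ ^ 2 / 2) : ℂ)‖ₑ
  else (ENNReal.ofReal (fockSobolevConst p.toReal m) *
    ∫⁻ z : ℂ, ‖z ^ m * f z * (Real.exp (-‖z‖ ^ 2 / 2) : ℂ)‖ₑ ^ p.toReal) ^ (1 / p.toReal)

open Classical in
/-- The extended norm of the space `F^{p,m}`: it is `‖f‖_{p,m}` for `f ∈ F^{p,m}`, and `∞` for
functions that are not in `F^{p,m}`. -/
noncomputable def fockSobolevENorm (p : ℝ≥0∞) (m : ℕ) (f : ℂ → ℂ) : ℝ≥0∞ :=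
  if f ∈ FockSobolevSpace p m then weightedENorm p m f else ∞

open scoped ComplexConjugate
open Complex.HadamardThreeLines

/-! Fock–Sobolev spaces are retracts of Lebesgue spaces, by maps that do not depend on the exponent,
so they interpolate as Lebesgue spaces do. Sending `f` to `(1 + |z|)^m f(z) exp(-|z|²/2)` embeds the
space of exponent `q` in `L^q`. The reproducing integral (`fockTransform`, in weighted form
`fockProj`) goes back, fixes entire functions in the space, and is bounded for every `1 ≤ q ≤ ∞`:
between Gaussian weights its kernel has modulus `exp(-|z - w|²/2) / π`, so Young's inequality
applies, and `(1 + |z|)^m` is submultiplicative up to a shift.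

For this the condition `f^(m) ∈ F^q` must be replaced by `z^m f exp(-|z|²/2) ∈ L^q`
(`mem_fockSobolevSpace_iff`). From weight to derivative, the reproducing formula is differentiated
under the integral. From derivative to weight, `f(z) - f(z/2)` is an integral of `f'` along a
segment, a Schur test gains one power of `1 + |z|`, and `f(z/2)` is negligible against the Gaussian;
induction gives all `m`.

The interpolation space lies in `F^{p,m}` by duality and the three lines theorem. Point evaluations
are bounded on the sum space, so a Calderón function `F` gives scalar holomorphic functions `ζ ↦ F ζ
w`. Pairing with an analytic family of powers of `|F θ|` bounds the `L^p` norm on sets where the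
weighted function is bounded above and below (`eLpNorm_le_of_three_lines`), and these sets exhaust
the non-zero set.

Conversely, `F^{p,m}` lies in the interpolation space through the projection of an analytic family
with value `φ` at `θ`. Taking powers of `|φ|` itself would fail: `log |φ|` is unbounded near zeros,
and for `p₁ = ∞` norm continuity is lost. The powers are taken of a majorant `exp ℓ` of `|φ|`
instead, with comparable `L^p` norm, locally bounded `ℓ`, and `|φ| = o(exp ℓ)` at infinity
(`exists_majorant`). The tails are then small even in `L^∞`, and the family is a Calderón function
(`IsExpFamilyData.isCalderonFunction`). -/

/-! ### Gaussian bounds and the inequalities of Hölder and Young -/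

theorem one_add_pow_mul_exp_le (n : ℕ) (R x : ℝ) (hx : 0 ≤ x) :
    (1 + x) ^ n * Real.exp (R * x - x ^ 2 / 2) ≤
      Real.exp ((n + R) ^ 2) * Real.exp (-x ^ 2 / 4) := by
  have h1 : (1 + x) ^ n ≤ Real.exp (n * x) := by
    rw [Real.exp_nat_mul]
    exact pow_le_pow_left₀ (by positivity) (by linarith [Real.add_one_le_exp x]) n
  calc (1 + x) ^ n * Real.exp (R * x - x ^ 2 / 2)
      ≤ Real.exp (n * x) * Real.exp (R * x - x ^ 2 / 2) := by gcongr
    _ = Real.exp (n * x + (R * x - x ^ 2 / 2)) := (Real.exp_add _ _).symm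
    _ ≤ Real.exp ((n + R) ^ 2 + -x ^ 2 / 4) := by
        apply Real.exp_le_exp.2
        -- Completing the square: `(n + R) x ≤ (n + R)² + x²/4`, which leaves `-x²/4` of the
        -- Gaussian.
        nlinarith [sq_nonneg ((n + R) - x / 2)]
    _ = _ := Real.exp_add _ _

theorem memLp_exp_neg_mul_sq {b : ℝ} (hb : 0 < b) (q : ℝ≥0∞) :
    MemLp (fun z : ℂ => Real.exp (-b * ‖z‖ ^ 2)) q volume := by
  have hm : AEStronglyMeasurable (fun z : ℂ => Real.exp (-b * ‖z‖ ^ 2)) volume := by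
    apply Continuous.aestronglyMeasurable; fun_prop
  rcases eq_or_ne q 0 with rfl | h0
  · exact memLp_zero_iff_aestronglyMeasurable.2 hm
  rcases eq_or_ne q ∞ with rfl | ht
  · refine memLp_top_of_bound hm 1 (Eventually.of_forall fun z => ?_)
    rw [Real.norm_eq_abs, Real.abs_exp]
    apply Real.exp_le_one_iff.2
    have : 0 ≤ b * ‖z‖ ^ 2 := by positivity
    linarith
  · rw [← integrable_norm_rpow_iff hm h0 ht]
    have hq : 0 < q.toReal := ENNReal.toReal_pos h0 ht
    have h := GaussianFourier.integral_rexp_neg_mul_sq_norm (V := ℂ) (b := b * q.toReal)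
      (by positivity)
    have h2 : Integrable (fun v : ℂ => Real.exp (-(b * q.toReal) * ‖v‖ ^ 2)) := by
      apply Integrable.of_integral_ne_zero
      rw [h]; positivity
    refine h2.congr (Eventually.of_forall fun z => ?_)
    simp only [Real.norm_eq_abs, Real.abs_exp]
    rw [← Real.exp_mul]; congr 1; ring

theorem memLp_of_norm_le_exp {E : Type*} [NormedAddCommGroup E] {h : ℂ → E}
    (hm : AEStronglyMeasurable h volume) (C : ℝ)
    (hb : ∀ z, ‖h z‖ ≤ C * Real.exp (-‖z‖ ^ 2 / 4)) (q : ℝ≥0∞) : MemLp h q volume := by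
  refine (memLp_exp_neg_mul_sq (b := 1 / 4) (by norm_num) q).of_le_mul (c := C) hm
    (Eventually.of_forall fun z => ?_)
  rw [Real.norm_eq_abs, Real.abs_exp]
  convert hb z using 3; ring

/-- Hölder's inequality for the splitting `a k = (a k^{1/q}) · k^{1/r}` with `r` conjugate to `q`.
This is the pointwise half of both Young's inequality and the Schur test below. -/
theorem lintegral_mul_rpow_le {α : Type*} [MeasurableSpace α] {μ : Measure α} {q : ℝ}
    (hq : 1 ≤ q) {a k : α → ℝ≥0∞} (ha : AEMeasurable a μ) (hk : AEMeasurable k μ) :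
    (∫⁻ x, a x * k x ∂μ) ^ q ≤ (∫⁻ x, k x ∂μ) ^ (q - 1) * ∫⁻ x, a x ^ q * k x ∂μ := by
  rcases hq.eq_or_lt with rfl | hq1
  · simp
  have hc := Real.HolderConjugate.conjExponent hq1
  set r := Real.conjExponent q
  have hq0 : 0 < q := by linarith
  have hr0 : 0 < r := hc.symm.pos
  have key := ENNReal.lintegral_mul_le_Lp_mul_Lq μ hc
    (f := fun x => a x * k x ^ (1 / q)) (g := fun x => k x ^ (1 / r))
    (ha.mul (hk.pow_const _)) (hk.pow_const _)
  have e1 : ∀ x, ((fun x => a x * k x ^ (1 / q)) * fun x => k x ^ (1 / r)) x = a x * k x := by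
    intro x
    simp only [Pi.mul_apply]
    rw [mul_assoc, ← ENNReal.rpow_add_of_nonneg _ _ (by positivity) (by positivity)]
    have : 1 / q + 1 / r = 1 := by
      have := hc.inv_add_inv_eq_one
      simpa using this
    rw [this, ENNReal.rpow_one]
  simp only [e1] at key
  have e2 : ∀ x, (a x * k x ^ (1 / q)) ^ q = a x ^ q * k x := by
    intro x
    rw [ENNReal.mul_rpow_of_nonneg _ _ hq0.le, ← ENNReal.rpow_mul, one_div,
      inv_mul_cancel₀ hq0.ne', ENNReal.rpow_one]
  have e3 : ∀ x, (k x ^ (1 / r)) ^ r = k x := by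
    intro x
    rw [← ENNReal.rpow_mul, one_div, inv_mul_cancel₀ hr0.ne', ENNReal.rpow_one]
  simp only [e2, e3] at key
  calc (∫⁻ x, a x * k x ∂μ) ^ q
      ≤ ((∫⁻ x, a x ^ q * k x ∂μ) ^ (1 / q) * (∫⁻ x, k x ∂μ) ^ (1 / r)) ^ q := by gcongr
    _ = (∫⁻ x, k x ∂μ) ^ (q - 1) * ∫⁻ x, a x ^ q * k x ∂μ := by
        rw [ENNReal.mul_rpow_of_nonneg _ _ hq0.le, ← ENNReal.rpow_mul, ← ENNReal.rpow_mul,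
          one_div, inv_mul_cancel₀ hq0.ne', ENNReal.rpow_one, mul_comm]
        congr 2
        have := hc.inv_add_inv_eq_one
        field_simp at this ⊢
        linarith

/-- Young's inequality `L^q * L^1 ⊆ L^q`: apply Hölder against the mass of `k`, then exchange
integrals by Tonelli and use translation invariance. -/
theorem eLpNorm_lintegral_mul_sub_le {f k : ℂ → ℝ≥0∞} (hf : AEMeasurable f volume)
    (hk : Measurable k) {q : ℝ≥0∞} (hq : 1 ≤ q) :
    eLpNorm (fun z => ∫⁻ w, f w * k (z - w)) q volume ≤
      (∫⁻ w, k w) * eLpNorm f q volume := by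
  have hkz : ∀ z : ℂ, ∫⁻ w, k (z - w) = ∫⁻ w, k w := fun z =>
    lintegral_sub_left_eq_self k z
  have hkw : ∀ w : ℂ, ∫⁻ z, k (z - w) = ∫⁻ w, k w := fun w =>
    lintegral_sub_right_eq_self k w
  rcases eq_or_ne q ∞ with rfl | ht
  · rw [eLpNorm_exponent_top, eLpNorm_exponent_top]
    refine eLpNormEssSup_le_of_ae_enorm_bound (Eventually.of_forall fun z => ?_)
    rw [enorm_eq_self, ← hkz z, mul_comm, ← lintegral_const_mul _ (by fun_prop)]
    refine lintegral_mono_ae ?_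
    filter_upwards [ae_le_eLpNormEssSup (f := f) (μ := volume)] with w hw
    rw [enorm_eq_self] at hw
    gcongr
  · have h0 : q ≠ 0 := (zero_lt_one.trans_le hq).ne'
    have hq1 : 1 ≤ q.toReal := by
      rw [← ENNReal.toReal_one]; exact (ENNReal.toReal_le_toReal (by simp) ht).2 hq
    have hq0 : 0 < q.toReal := by linarith
    rw [eLpNorm_eq_lintegral_rpow_enorm_toReal h0 ht, eLpNorm_eq_lintegral_rpow_enorm_toReal h0 ht]
    simp only [enorm_eq_self]
    have hm : AEMeasurable (Function.uncurry fun z w : ℂ => f w ^ q.toReal * k (z - w))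
        (volume.prod volume) := by
      apply AEMeasurable.mul
      · exact (hf.pow_const _).comp_snd
      · exact (hk.comp (measurable_fst.sub measurable_snd)).aemeasurable
    rw [← ENNReal.rpow_le_rpow_iff hq0, ENNReal.mul_rpow_of_nonneg _ _ hq0.le,
      ← ENNReal.rpow_mul, ← ENNReal.rpow_mul, one_div, inv_mul_cancel₀ hq0.ne',
      ENNReal.rpow_one, ENNReal.rpow_one]
    calc ∫⁻ z, (∫⁻ w, f w * k (z - w)) ^ q.toReal
        ≤ ∫⁻ z, (∫⁻ w, k w) ^ (q.toReal - 1) * ∫⁻ w, f w ^ q.toReal * k (z - w) := by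
          refine lintegral_mono fun z => ?_
          refine (lintegral_mul_rpow_le hq1 hf (by fun_prop)).trans_eq ?_
          rw [hkz]
      _ = (∫⁻ w, k w) ^ (q.toReal - 1) * ∫⁻ z, ∫⁻ w, f w ^ q.toReal * k (z - w) := by
          have hz : AEMeasurable (fun z => ∫⁻ w, f w ^ q.toReal * k (z - w)) volume :=
            hm.lintegral_prod_right'
          rw [lintegral_const_mul'' _ hz]
      _ = (∫⁻ w, k w) ^ (q.toReal - 1) * ∫⁻ w, ∫⁻ z, f w ^ q.toReal * k (z - w) := by
          rw [lintegral_lintegral_swap hm]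
      _ = (∫⁻ w, k w) ^ (q.toReal - 1) * ((∫⁻ w, f w ^ q.toReal) * ∫⁻ w, k w) := by
          congr 1
          rw [← lintegral_mul_const'' _ (hf.pow_const _)]
          refine lintegral_congr fun w => ?_
          rw [lintegral_const_mul _ (by fun_prop), hkw]
      _ = (∫⁻ w, k w) ^ q.toReal * ∫⁻ w, f w ^ q.toReal := by
          rw [mul_comm (∫⁻ w, f w ^ q.toReal), ← mul_assoc]
          congr 1
          conv_rhs => rw [show q.toReal = (q.toReal - 1) + 1 by ring,
            ENNReal.rpow_add_of_nonneg _ _ (by linarith) zero_le_one, ENNReal.rpow_one]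

/-! ### The mean value property and pointwise bounds -/

/-- The set where the essential supremum is exceeded is open and null, hence empty. -/
theorem enorm_le_eLpNorm_top_of_continuous {E : Type*} [NormedAddCommGroup E] {h : ℂ → E}
    (hh : Continuous h) (z : ℂ) : ‖h z‖ₑ ≤ eLpNorm h ∞ volume := by
  by_contra! hz
  have ho : IsOpen {w | eLpNorm h ∞ volume < ‖h w‖ₑ} :=
    isOpen_lt continuous_const hh.enorm
  have h0 : volume {w | eLpNorm h ∞ volume < ‖h w‖ₑ} = 0 := by
    have := ae_le_eLpNormEssSup (f := h) (μ := volume)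
    rw [ae_iff] at this
    simpa using this
  rw [ho.measure_eq_zero_iff volume] at h0
  exact (h0 ▸ hz : z ∈ (∅ : Set ℂ))

/-- Rotations preserve area and the radial factor, so `H` may be replaced by its average over each
circle about the origin, which equals `H 0` as `H` is entire. Fubini exchanges the angular and area
integrals. -/
theorem integral_mul_radial {H : ℂ → ℂ} (hH : Differentiable ℂ H) {ρ : ℝ → ℝ}
    (hρ : Measurable ρ) (hint : Integrable (fun u : ℂ => H u * (ρ ‖u‖ : ℂ))) :
    ∫ u : ℂ, H u * (ρ ‖u‖ : ℂ) = H 0 * ∫ u : ℂ, (ρ ‖u‖ : ℂ) := by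
  have hnorm : ∀ t : ℝ, ‖circleMap 0 1 t‖ = 1 := fun t => by simp
  let rot : ℝ → ℂ ≃ₗᵢ[ℝ] ℂ := fun t => rotation (Circle.exp t)
  have hrot : ∀ t u, rot t u = circleMap 0 1 t * u := by
    intro t u; simp [rot, circleMap]
  have hmp : ∀ t, MeasurePreserving (rot t) (volume : Measure ℂ) volume :=
    fun t => (rot t).measurePreserving
  have hrotn : ∀ t u, ‖circleMap 0 1 t * u‖ = ‖u‖ := fun t u => by rw [norm_mul, hnorm, one_mul]
  have hI : ∀ t : ℝ, ∫ u : ℂ, H (circleMap 0 1 t * u) * (ρ ‖u‖ : ℂ)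
      = ∫ u : ℂ, H u * (ρ ‖u‖ : ℂ) := by
    intro t
    rw [← (hmp t).integral_comp (rot t).toHomeomorph.measurableEmbedding
      (fun u : ℂ => H u * (ρ ‖u‖ : ℂ))]
    refine integral_congr_ae (Eventually.of_forall fun u => ?_)
    simp only [hrot, hrotn]
  set ν : Measure ℝ := volume.restrict (Set.Ioc 0 (2 * Real.pi))
  have hjoint : Integrable (fun x : ℂ × ℝ => H (circleMap 0 1 x.2 * x.1) * (ρ ‖x.1‖ : ℂ))
      (volume.prod ν) := by
    have hm : AEStronglyMeasurable
        (fun x : ℂ × ℝ => H (circleMap 0 1 x.2 * x.1) * (ρ ‖x.1‖ : ℂ)) (volume.prod ν) := by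
      have := hH.continuous
      apply AEStronglyMeasurable.mul
      · apply Continuous.aestronglyMeasurable
        fun_prop
      · apply Measurable.aestronglyMeasurable
        fun_prop
    rw [integrable_prod_iff' hm]
    have hn : ∀ t : ℝ, ∫ u : ℂ, ‖H (circleMap 0 1 t * u) * (ρ ‖u‖ : ℂ)‖
        = ∫ u : ℂ, ‖H u * (ρ ‖u‖ : ℂ)‖ := by
      intro t
      rw [← (hmp t).integral_comp (rot t).toHomeomorph.measurableEmbedding
        (fun u : ℂ => ‖H u * (ρ ‖u‖ : ℂ)‖)]
      refine integral_congr_ae (Eventually.of_forall fun u => ?_)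
      simp only [hrot, hrotn]
    constructor
    · refine Eventually.of_forall fun t => ?_
      have := (hmp t).integrable_comp_of_integrable hint
      refine this.congr (Eventually.of_forall fun u => ?_)
      simp only [Function.comp, hrot, hrotn]
    · simp only [hn]
      exact integrable_const _
  have hswap := integral_integral_swap
    (f := fun (u : ℂ) (t : ℝ) => H (circleMap 0 1 t * u) * (ρ ‖u‖ : ℂ)) hjoint
  have hpi : (0 : ℝ) < 2 * Real.pi := by positivity
  have hav : ∀ u : ℂ, ∫ t, H (circleMap 0 1 t * u) ∂ν = (2 * Real.pi : ℝ) * H 0 := by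
    intro u
    have hd : Differentiable ℂ fun v : ℂ => H (v * u) := by fun_prop
    have := DiffContOnCl.circleAverage (f := fun v : ℂ => H (v * u)) (R := 1) (c := 0)
      hd.diffContOnCl
    rw [Real.circleAverage, intervalIntegral.integral_of_le hpi.le] at this
    simp only [zero_mul] at this
    rw [← this, Complex.real_smul, ← mul_assoc, ← Complex.ofReal_mul, mul_inv_cancel₀ hpi.ne']
    simp [ν]
  have hpi' : ((2 * Real.pi : ℝ) : ℂ) ≠ 0 := by exact_mod_cast hpi.ne'
  have hL : ∀ u : ℂ, ∫ t, H (circleMap 0 1 t * u) * (ρ ‖u‖ : ℂ) ∂ν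
      = (2 * Real.pi : ℝ) * (H 0 * (ρ ‖u‖ : ℂ)) := by
    intro u; rw [integral_mul_const, hav]; ring
  simp only [hL, hI] at hswap
  rw [integral_const_mul, integral_const_mul] at hswap
  have hν : ν.real Set.univ = 2 * Real.pi := by
    simp [ν, Measure.real]
    positivity
  rw [integral_const, hν, Complex.real_smul] at hswap
  exact (mul_left_cancel₀ hpi' hswap).symm

/-- The twist `exp(-u conj z)` of a Weyl translation moves the Gaussian weight from `z` to `z + u`
at the cost of `exp(|u|²/2)`. -/
theorem exp_neg_sq_mul_norm_exp (z u : ℂ) :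
    Real.exp (-‖z‖ ^ 2 / 2) * ‖cexp (-(u * (starRingEnd ℂ) z))‖ =
      Real.exp (-‖z + u‖ ^ 2 / 2) * Real.exp (‖u‖ ^ 2 / 2) := by
  rw [Complex.norm_exp, ← Real.exp_add, ← Real.exp_add]
  congr 1
  simp only [← Complex.normSq_eq_norm_sq, Complex.normSq_apply, neg_re, mul_re, conj_re, conj_im,
    add_re, add_im]
  ring

theorem setLIntegral_closedBall_enorm_le {q : ℝ≥0∞} (hq : 1 ≤ q) {h : ℂ → ℂ}
    (hc : Continuous h) (z : ℂ) :
    ∫⁻ u in Metric.closedBall (0 : ℂ) 1, ‖h (z + u)‖ₑ ≤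
      (NNReal.pi : ℝ≥0∞) ^ (1 / (1 : ℝ≥0∞).toReal - 1 / q.toReal) * eLpNorm h q volume := by
  have hcs : AEStronglyMeasurable (fun u => h (z + u))
      (volume.restrict (Metric.closedBall (0 : ℂ) 1)) := by
    apply Continuous.aestronglyMeasurable; fun_prop
  have hsh : eLpNorm (h ∘ fun u => z + u) q volume = eLpNorm h q volume :=
    eLpNorm_comp_measurePreserving hc.aestronglyMeasurable (measurePreserving_add_left volume z)
  have hvol : volume (Metric.closedBall (0 : ℂ) 1) = NNReal.pi := by
    rw [Complex.volume_closedBall]; simp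
  rw [← eLpNorm_one_eq_lintegral_enorm]
  refine (eLpNorm_le_eLpNorm_mul_rpow_measure_univ hq hcs).trans ?_
  rw [Measure.restrict_apply_univ, hvol, mul_comm, ← hsh]
  gcongr
  exact eLpNorm_mono_measure _ Measure.restrict_le_self

/-- The mean value property over the unit disk is applied to `u ↦ f(z + u) exp(-u conj z)`, whose
value at `0` is `f z`. By the twist the integrand is controlled by the weighted function near `z`,
uniformly in `z`. -/
theorem exists_enorm_le_eLpNorm {q : ℝ≥0∞} (hq : 1 ≤ q) :
    ∃ C : ℝ≥0, ∀ f : ℂ → ℂ, Differentiable ℂ f → ∀ z : ℂ,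
      ‖f z * (Real.exp (-‖z‖ ^ 2 / 2) : ℂ)‖ₑ ≤
        C * eLpNorm (fun z : ℂ => f z * (Real.exp (-‖z‖ ^ 2 / 2) : ℂ)) q volume := by
  have hvol : ∀ z : ℂ, volume (Metric.closedBall z 1) = NNReal.pi := fun z => by
    rw [Complex.volume_closedBall]; simp
  set a : ℝ := 1 / (1 : ℝ≥0∞).toReal - 1 / q.toReal
  refine ⟨Real.toNNReal (Real.pi⁻¹ * Real.exp (1 / 2)) *
    ((NNReal.pi : ℝ≥0∞) ^ a).toNNReal, fun f hf z => ?_⟩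
  have hpia : (NNReal.pi : ℝ≥0∞) ^ a ≠ ∞ := by
    apply ENNReal.rpow_ne_top_of_ne_zero
    · simpa using NNReal.pi_pos.ne'
    · simp
  set h : ℂ → ℂ := fun z : ℂ => f z * (Real.exp (-‖z‖ ^ 2 / 2) : ℂ) with hh
  have hc : Continuous h := by
    have := hf.continuous
    fun_prop
  let H : ℂ → ℂ := fun u => f (z + u) * cexp (-(u * (starRingEnd ℂ) z))
  have hH : Differentiable ℂ H := by
    intro u; fun_prop
  -- As a radial factor, this is the indicator of the closed unit disk.
  let ρ : ℝ → ℝ := Set.indicator (Set.Iic 1) 1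
  have hρ : Measurable ρ := measurable_one.indicator measurableSet_Iic
  have hind : ∀ (G : ℂ → ℂ) u, G u * (ρ ‖u‖ : ℂ) = (Metric.closedBall (0 : ℂ) 1).indicator G u := by
    intro G u
    by_cases hu : ‖u‖ ≤ 1 <;> simp [ρ, Set.indicator, hu]
  have hint : Integrable (fun u : ℂ => H u * (ρ ‖u‖ : ℂ)) := by
    simp only [hind]
    rw [integrable_indicator_iff Metric.isClosed_closedBall.measurableSet]
    exact hH.continuous.continuousOn.integrableOn_compact (isCompact_closedBall _ _)
  have hmv := integral_mul_radial hH hρ hint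
  have h1 : ∫ u : ℂ, (ρ ‖u‖ : ℂ) = Real.pi := by
    have := hind (fun _ => 1)
    simp only [one_mul] at this
    simp only [this]
    rw [integral_indicator Metric.isClosed_closedBall.measurableSet]
    simp [Measure.real, hvol]
  simp only [hind] at hmv
  rw [h1, integral_indicator Metric.isClosed_closedBall.measurableSet] at hmv
  have hf0 : f z = (Real.pi⁻¹ : ℝ) * ∫ u in Metric.closedBall 0 1, H u := by
    have hp : (Real.pi : ℂ) ≠ 0 := by exact_mod_cast Real.pi_ne_zero
    rw [hmv]; simp [H]; field_simp
  have hbd : ‖h z‖ₑ ≤ ENNReal.ofReal (Real.pi⁻¹ * Real.exp (1 / 2)) *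
      ∫⁻ u in Metric.closedBall 0 1, ‖h (z + u)‖ₑ := by
    have e : h z = (Real.pi⁻¹ : ℝ) *
        ∫ u in Metric.closedBall 0 1, H u * (Real.exp (-‖z‖ ^ 2 / 2) : ℂ) := by
      rw [integral_mul_const, ← mul_assoc, ← hf0]
    rw [e, enorm_mul, ENNReal.ofReal_mul (by positivity), mul_assoc]
    gcongr
    · rw [← ofReal_norm]
      simp [abs_of_pos Real.pi_pos]
    · refine (enorm_integral_le_lintegral_enorm _).trans ?_
      rw [← lintegral_const_mul' _ _ (by simp)]
      refine setLIntegral_mono' Metric.isClosed_closedBall.measurableSet fun u hu => ?_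
      rw [mem_closedBall_zero_iff] at hu
      rw [← ofReal_norm, ← ofReal_norm, ← ENNReal.ofReal_mul (by positivity)]
      apply ENNReal.ofReal_le_ofReal
      simp only [H, hh, norm_mul, Complex.norm_real, Real.norm_eq_abs, Real.abs_exp]
      rw [mul_assoc, mul_comm ‖cexp _‖, exp_neg_sq_mul_norm_exp, mul_comm (Real.exp (1 / 2)),
        mul_assoc]
      gcongr
      -- The loss `exp(‖u‖²/2)` of the twist is at most `exp(1/2)` on the unit disk.
      nlinarith [norm_nonneg u]
  have hshift := setLIntegral_closedBall_enorm_le hq hc z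
  calc ‖h z‖ₑ ≤ _ := hbd
    _ ≤ ENNReal.ofReal (Real.pi⁻¹ * Real.exp (1 / 2)) *
      ((NNReal.pi : ℝ≥0∞) ^ a * eLpNorm h q volume) := by gcongr
    _ = _ := by
      rw [ENNReal.coe_mul, ENNReal.coe_toNNReal hpia, mul_assoc, ENNReal.ofReal]

/-- The weight `z^m` degenerates at the origin, so the pointwise bound is used only on a circle of
radius `S ≥ 1`, where `|z^m| ≥ 1`; the maximum principle carries it inside. -/
theorem exists_enorm_le_eLpNorm_pow_mul {q : ℝ≥0∞} (hq : 1 ≤ q) (m : ℕ) (R : ℝ) :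
    ∃ C : ℝ≥0, ∀ f : ℂ → ℂ, Differentiable ℂ f → ∀ z : ℂ, ‖z‖ ≤ R →
      ‖f z‖ₑ ≤ C * eLpNorm (fun z : ℂ => z ^ m * f z * (Real.exp (-‖z‖ ^ 2 / 2) : ℂ)) q volume := by
  obtain ⟨C, hC⟩ := exists_enorm_le_eLpNorm hq
  set S := max R 1
  have hS1 : 1 ≤ S := le_max_right _ _
  -- The summand `1` makes the constant non-zero, so that the bound also holds when the norm is
  -- infinite.
  refine ⟨Real.toNNReal (Real.exp (S ^ 2 / 2)) * C + 1, fun f hf z hz => ?_⟩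
  set N := eLpNorm (fun z : ℂ => z ^ m * f z * (Real.exp (-‖z‖ ^ 2 / 2) : ℂ)) q volume with hN
  rcases eq_or_ne N ∞ with ht | ht
  · rw [ht, ENNReal.mul_top (by simp)]; exact le_top
  have hb : ∀ w ∈ Metric.sphere (0 : ℂ) S,
      ‖f w‖ ≤ Real.exp (S ^ 2 / 2) * (C * N).toReal := by
    intro w hw
    rw [mem_sphere_zero_iff_norm] at hw
    have h1 := hC (fun z => z ^ m * f z) (by fun_prop) w
    rw [← hN] at h1
    have h2 := ENNReal.toReal_mono (ENNReal.mul_ne_top (by simp) ht) h1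
    rw [toReal_enorm] at h2
    simp only [norm_mul, Complex.norm_real, Real.norm_eq_abs, Real.abs_exp, norm_pow, hw] at h2
    have h3 : (1 : ℝ) ≤ S ^ m := one_le_pow₀ hS1
    have h4 : Real.exp (S ^ 2 / 2) * Real.exp (-S ^ 2 / 2) = 1 := by
      rw [← Real.exp_add, ← Real.exp_zero]; congr 1; ring
    calc ‖f w‖ ≤ S ^ m * ‖f w‖ := le_mul_of_one_le_left (norm_nonneg _) h3
      _ = Real.exp (S ^ 2 / 2) * (S ^ m * ‖f w‖ * Real.exp (-S ^ 2 / 2)) := by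
        rw [mul_left_comm, h4, mul_one]
      _ ≤ _ := by gcongr
  have hmax : ‖f z‖ ≤ Real.exp (S ^ 2 / 2) * (C * N).toReal := by
    have hS0 : S ≠ 0 := by positivity
    refine Complex.norm_le_of_forall_mem_frontier_norm_le (U := Metric.ball 0 S)
      Metric.isBounded_ball hf.diffContOnCl ?_ ?_
    · rw [frontier_ball _ hS0]; exact hb
    · rw [closure_ball _ hS0, mem_closedBall_zero_iff]; exact hz.trans (le_max_left _ _)
  calc ‖f z‖ₑ = ENNReal.ofReal ‖f z‖ := (ofReal_norm _).symm
    _ ≤ ENNReal.ofReal (Real.exp (S ^ 2 / 2) * (C * N).toReal) := ENNReal.ofReal_le_ofReal hmax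
    _ = (Real.toNNReal (Real.exp (S ^ 2 / 2)) * C : ℝ≥0) * N := by
        rw [ENNReal.ofReal_mul (by positivity), ENNReal.ofReal_toReal
          (ENNReal.mul_ne_top (by simp) ht), ENNReal.coe_mul, mul_assoc]; rfl
    _ ≤ _ := by gcongr; simp

/-! ### The reproducing integral operator -/

/-- The integral operator with kernel `exp (z * conj w - |w|² / 2) / π`, which maps
`f * exp (-|·|² / 2)` to `f` for `f` in a Fock space. -/
noncomputable def fockTransform (Ψ : ℂ → ℂ) (z : ℂ) : ℂ :=
  (Real.pi⁻¹ : ℝ) * ∫ w : ℂ, Ψ w * cexp (z * conj w - (‖w‖ ^ 2 / 2 : ℝ))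

theorem norm_cexp_mul_conj_sub_le {R : ℝ} {z w : ℂ} (hz : ‖z‖ ≤ R) :
    ‖cexp (z * conj w - (‖w‖ ^ 2 / 2 : ℝ))‖ ≤ Real.exp (R * ‖w‖ - ‖w‖ ^ 2 / 2) := by
  rw [Complex.norm_exp]
  apply Real.exp_le_exp.2
  rw [sub_re, ofReal_re]
  gcongr
  calc (z * conj w).re ≤ ‖z * conj w‖ := re_le_norm _
    _ = ‖z‖ * ‖w‖ := by rw [norm_mul, RCLike.norm_conj]
    _ ≤ _ := by gcongr

/-- From `2 Re(z conj w) - |z|² - |w|² = -|z - w|²`: between Gaussian weights the kernel is, in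
modulus, a convolution kernel. -/
theorem norm_cexp_mul_conj_sub_mul_exp (z w : ℂ) :
    ‖cexp (z * conj w - (‖w‖ ^ 2 / 2 : ℝ))‖ * Real.exp (-‖z‖ ^ 2 / 2) =
      Real.exp (-‖z - w‖ ^ 2 / 2) := by
  rw [Complex.norm_exp, ← Real.exp_add]
  congr 1
  simp only [← Complex.normSq_eq_norm_sq, Complex.normSq_apply, mul_re, conj_re, conj_im,
    sub_re, sub_im, ofReal_re]
  ring

/-- The factor multiplying `‖Ψ‖` has Gaussian decay, hence lies in every Lebesgue space, in
particular in that of the conjugate exponent. It serves as dominating function for all derivatives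
of the transform. -/
theorem MeasureTheory.MemLp.integrable_norm_mul_gaussian {Ψ : ℂ → ℂ} {q : ℝ≥0∞} (hq : 1 ≤ q)
    (hΨ : MemLp Ψ q volume) (n : ℕ) (R : ℝ) :
    Integrable (fun w : ℂ => ‖Ψ w‖ * ((1 + ‖w‖) ^ n * Real.exp (R * ‖w‖ - ‖w‖ ^ 2 / 2))) := by
  have := ENNReal.HolderConjugate.conjExponent hq
  refine MemLp.integrable_mul (p := q) (q := ENNReal.conjExponent q) hΨ.norm ?_
  refine memLp_of_norm_le_exp (Continuous.aestronglyMeasurable (by fun_prop))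
    (Real.exp ((n + R) ^ 2)) (fun z => ?_) _
  rw [Real.norm_of_nonneg (by positivity)]
  exact one_add_pow_mul_exp_le n R ‖z‖ (norm_nonneg _)

theorem MeasureTheory.MemLp.integrable_mul_fockKernel {Ψ : ℂ → ℂ} {q : ℝ≥0∞} (hq : 1 ≤ q)
    (hΨ : MemLp Ψ q volume) (n : ℕ) (z : ℂ) :
    Integrable (fun w : ℂ => conj w ^ n * Ψ w * cexp (z * conj w - (‖w‖ ^ 2 / 2 : ℝ))) := by
  refine (hΨ.integrable_norm_mul_gaussian hq n ‖z‖).mono' ?_ (Eventually.of_forall fun w => ?_)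
  · refine AEStronglyMeasurable.mul (AEStronglyMeasurable.mul ?_ hΨ.1) ?_
    · exact Continuous.aestronglyMeasurable (by fun_prop)
    · exact Continuous.aestronglyMeasurable (by fun_prop)
  · rw [norm_mul, norm_mul, norm_pow, RCLike.norm_conj, mul_comm (‖w‖ ^ n), mul_assoc]
    gcongr
    · linarith [norm_nonneg w]
    · exact norm_cexp_mul_conj_sub_le le_rfl

/-- Differentiation of the kernel in `z` produces a factor `conj w`. On the unit ball about `z` the
parameter has modulus at most `‖z‖ + 1`, which gives a single dominating function. -/
theorem hasDerivAt_fockTransform {Ψ : ℂ → ℂ} {q : ℝ≥0∞} (hq : 1 ≤ q)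
    (hΨ : MemLp Ψ q volume) (n : ℕ) (z : ℂ) :
    HasDerivAt (fockTransform fun w => conj w ^ n * Ψ w)
      (fockTransform (fun w => conj w ^ (n + 1) * Ψ w) z) z := by
  have key := hasDerivAt_integral_of_dominated_loc_of_deriv_le (μ := volume)
    (F := fun z w : ℂ => conj w ^ n * Ψ w * cexp (z * conj w - (‖w‖ ^ 2 / 2 : ℝ)))
    (F' := fun z w : ℂ => conj w ^ (n + 1) * Ψ w * cexp (z * conj w - (‖w‖ ^ 2 / 2 : ℝ)))
    (bound := fun w : ℂ => ‖Ψ w‖ * ((1 + ‖w‖) ^ (n + 1) *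
      Real.exp ((‖z‖ + 1) * ‖w‖ - ‖w‖ ^ 2 / 2)))
    (x₀ := z) (Metric.ball_mem_nhds z one_pos)
    (Eventually.of_forall fun x => (hΨ.integrable_mul_fockKernel hq n x).1)
    (hΨ.integrable_mul_fockKernel hq n z) (hΨ.integrable_mul_fockKernel hq (n + 1) z).1
    (Eventually.of_forall fun w x hx => ?_) (hΨ.integrable_norm_mul_gaussian hq _ _)
    (Eventually.of_forall fun w x hx => ?_)
  · exact key.2.const_mul _
  · rw [norm_mul, norm_mul, norm_pow, RCLike.norm_conj, mul_comm (‖w‖ ^ (n + 1)), mul_assoc]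
    have hx' : ‖x‖ ≤ ‖z‖ + 1 := by
      have h1 : ‖x - z‖ < 1 := by simpa [dist_eq_norm] using hx
      have h2 : ‖x‖ ≤ ‖z‖ + ‖x - z‖ := by
        simpa using norm_add_le z (x - z)
      linarith
    gcongr
    · linarith [norm_nonneg w]
    · exact norm_cexp_mul_conj_sub_le hx'
  · have h1 : HasDerivAt (fun x : ℂ => x * conj w - (‖w‖ ^ 2 / 2 : ℝ)) (conj w) x := by
      simpa using ((hasDerivAt_id x).mul_const (conj w)).sub_const ((‖w‖ ^ 2 / 2 : ℝ) : ℂ)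
    refine (h1.cexp.const_mul (conj w ^ n * Ψ w)).congr_deriv ?_
    ring

theorem iteratedDeriv_fockTransform {Ψ : ℂ → ℂ} {q : ℝ≥0∞} (hq : 1 ≤ q)
    (hΨ : MemLp Ψ q volume) (n : ℕ) :
    iteratedDeriv n (fockTransform Ψ) = fockTransform (fun w => conj w ^ n * Ψ w) := by
  induction n with
  | zero => simp
  | succ n ih =>
    rw [iteratedDeriv_succ, ih]
    exact funext fun z => (hasDerivAt_fockTransform hq hΨ n z).deriv

theorem differentiable_fockTransform {Ψ : ℂ → ℂ} {q : ℝ≥0∞} (hq : 1 ≤ q)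
    (hΨ : MemLp Ψ q volume) : Differentiable ℂ (fockTransform Ψ) := by
  intro z
  simpa using (hasDerivAt_fockTransform hq hΨ 0 z).differentiableAt

/-- Absolute convergence of the integrals that define `fockTransform Ψ`. -/
def FockIntegrable (Ψ : ℂ → ℂ) : Prop :=
  ∀ z : ℂ, Integrable fun w : ℂ => Ψ w * cexp (z * conj w - (‖w‖ ^ 2 / 2 : ℝ))

theorem MeasureTheory.MemLp.fockIntegrable {Ψ : ℂ → ℂ} {q : ℝ≥0∞} (hq : 1 ≤ q)
    (hΨ : MemLp Ψ q volume) : FockIntegrable Ψ := fun z => by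
  simpa using hΨ.integrable_mul_fockKernel hq 0 z

theorem FockIntegrable.add {Φ Ψ : ℂ → ℂ} (hΦ : FockIntegrable Φ) (hΨ : FockIntegrable Ψ) :
    FockIntegrable (Φ + Ψ) := fun z => by
  refine ((hΦ z).add (hΨ z)).congr (Eventually.of_forall fun w => ?_)
  simp only [Pi.add_apply, add_mul]

theorem FockIntegrable.sub {Φ Ψ : ℂ → ℂ} (hΦ : FockIntegrable Φ) (hΨ : FockIntegrable Ψ) :
    FockIntegrable (Φ - Ψ) := fun z => by
  refine ((hΦ z).sub (hΨ z)).congr (Eventually.of_forall fun w => ?_)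
  simp only [Pi.sub_apply, sub_mul]

theorem FockIntegrable.const_smul {Φ : ℂ → ℂ} (hΦ : FockIntegrable Φ) (c : ℂ) :
    FockIntegrable (c • Φ) := fun z => by
  simpa only [Pi.smul_apply, smul_eq_mul, mul_assoc] using (hΦ z).const_mul c

theorem fockTransform_add {Φ Ψ : ℂ → ℂ} (hΦ : FockIntegrable Φ) (hΨ : FockIntegrable Ψ) :
    fockTransform (Φ + Ψ) = fockTransform Φ + fockTransform Ψ := by
  ext z
  simp only [fockTransform, Pi.add_apply, add_mul]
  rw [integral_add (hΦ z) (hΨ z), mul_add]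

theorem fockTransform_sub {Φ Ψ : ℂ → ℂ} (hΦ : FockIntegrable Φ) (hΨ : FockIntegrable Ψ) :
    fockTransform (Φ - Ψ) = fockTransform Φ - fockTransform Ψ := by
  ext z
  simp only [fockTransform, Pi.sub_apply, sub_mul]
  rw [integral_sub (hΦ z) (hΨ z), mul_sub]

theorem fockTransform_const_smul (c : ℂ) (Φ : ℂ → ℂ) :
    fockTransform (c • Φ) = c • fockTransform Φ := by
  ext z
  simp only [fockTransform, Pi.smul_apply, smul_eq_mul, mul_assoc]
  rw [integral_const_mul]; ring

/-- After the shift `w = z + u` the exponents add up to `-u conj z - |u|²`. The mean value property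
with radial factor `exp(-|u|²)`, of total mass `π`, then returns `f z`. -/
theorem fockTransform_eq_self {f : ℂ → ℂ} (hf : Differentiable ℂ f) {q : ℝ≥0∞} (hq : 1 ≤ q)
    (hfq : MemLp (fun z : ℂ => f z * (Real.exp (-‖z‖ ^ 2 / 2) : ℂ)) q volume) :
    fockTransform (fun z : ℂ => f z * (Real.exp (-‖z‖ ^ 2 / 2) : ℂ)) = f := by
  ext z
  let H : ℂ → ℂ := fun u => f (z + u) * cexp (-(u * conj z))
  have hH : Differentiable ℂ H := by intro u; fun_prop
  have hint := hfq.integrable_mul_fockKernel hq 0 z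
  simp only [pow_zero, one_mul] at hint
  have e : ∀ u : ℂ, f (z + u) * (Real.exp (-‖z + u‖ ^ 2 / 2) : ℂ) *
      cexp (z * conj (z + u) - (‖z + u‖ ^ 2 / 2 : ℝ)) = H u * (Real.exp (-‖u‖ ^ 2) : ℝ) := by
    intro u
    have hs : ∀ x : ℂ, ((‖x‖ : ℂ)) ^ 2 = x * conj x := fun x => by
      rw [Complex.mul_conj, Complex.normSq_eq_norm_sq]; push_cast; rfl
    simp only [H]
    rw [mul_assoc, mul_assoc]
    congr 1
    push_cast
    rw [← Complex.exp_add, ← Complex.exp_add, hs, hs, map_add]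
    congr 1; ring
  have hint2 : Integrable fun u : ℂ => H u * (Real.exp (-‖u‖ ^ 2) : ℝ) := by
    refine (hint.comp_add_left z).congr (Eventually.of_forall fun u => e u)
  have hmv := integral_mul_radial hH (ρ := fun r => Real.exp (-r ^ 2)) (by fun_prop) hint2
  have hpi : ∫ u : ℂ, ((Real.exp (-‖u‖ ^ 2) : ℝ) : ℂ) = Real.pi := by
    rw [integral_complex_ofReal]
    have := GaussianFourier.integral_rexp_neg_mul_sq_norm (V := ℂ) one_pos
    simp only [Complex.finrank_real_complex, div_one, neg_mul, one_mul] at this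
    rw [this]; norm_num
  have hp : (Real.pi : ℂ) ≠ 0 := by exact_mod_cast Real.pi_ne_zero
  rw [fockTransform, ← integral_add_left_eq_self _ z]
  simp only [e]
  rw [hmv, hpi]
  simp [H]; field_simp

/-- The polynomial weight passes through the kernel because `1 + |z| ≤ (1 + |w|)(1 + |z - w|)`; the
second factor is absorbed by the Gaussian. -/
theorem enorm_fockTransform_mul_le (Ψ : ℂ → ℂ) (n : ℕ) (z : ℂ) :
    ‖(((1 + ‖z‖) ^ n : ℝ) : ℂ) * fockTransform Ψ z * (Real.exp (-‖z‖ ^ 2 / 2) : ℂ)‖ₑ ≤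
      ∫⁻ w : ℂ, ‖(((1 + ‖w‖) ^ n : ℝ) : ℂ) * Ψ w‖ₑ *
        ENNReal.ofReal (Real.pi⁻¹ * ((1 + ‖z - w‖) ^ n * Real.exp (-‖z - w‖ ^ 2 / 2))) := by
  have e : (((1 + ‖z‖) ^ n : ℝ) : ℂ) * fockTransform Ψ z * (Real.exp (-‖z‖ ^ 2 / 2) : ℂ) =
      ∫ w : ℂ, (((1 + ‖z‖) ^ n * Real.exp (-‖z‖ ^ 2 / 2) * Real.pi⁻¹ : ℝ) : ℂ) *
        (Ψ w * cexp (z * conj w - (‖w‖ ^ 2 / 2 : ℝ))) := by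
    rw [integral_const_mul, fockTransform]; push_cast; ring
  rw [e]
  refine (enorm_integral_le_lintegral_enorm _).trans (lintegral_mono fun w => ?_)
  rw [← ofReal_norm, ← ofReal_norm, ← ENNReal.ofReal_mul (norm_nonneg _)]
  apply ENNReal.ofReal_le_ofReal
  have h1 : (1 + ‖z‖) ^ n ≤ (1 + ‖w‖) ^ n * (1 + ‖z - w‖) ^ n := by
    rw [← mul_pow]
    gcongr
    have : ‖z‖ ≤ ‖w‖ + ‖z - w‖ := by simpa using norm_add_le w (z - w)
    nlinarith [norm_nonneg w, norm_nonneg (z - w)]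
  simp only [norm_mul, Complex.norm_real]
  rw [Real.norm_of_nonneg (show 0 ≤ (1 + ‖z‖) ^ n by positivity),
    Real.norm_of_nonneg (show 0 ≤ (1 + ‖w‖) ^ n by positivity),
    Real.norm_of_nonneg (Real.exp_nonneg _),
    Real.norm_of_nonneg (show 0 ≤ Real.pi⁻¹ by positivity),
    ← norm_cexp_mul_conj_sub_mul_exp]
  calc _ = (1 + ‖z‖) ^ n * (‖Ψ w‖ * (Real.pi⁻¹ * (‖cexp (z * conj w - (‖w‖ ^ 2 / 2 : ℝ))‖ *
        Real.exp (-‖z‖ ^ 2 / 2)))) := by ring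
    _ ≤ ((1 + ‖w‖) ^ n * (1 + ‖z - w‖) ^ n) * (‖Ψ w‖ * (Real.pi⁻¹ *
        (‖cexp (z * conj w - (‖w‖ ^ 2 / 2 : ℝ))‖ * Real.exp (-‖z‖ ^ 2 / 2)))) := by gcongr
    _ = _ := by ring

/-- Young's inequality for the dominating convolution. The constant is the `L^1` norm of its kernel,
hence independent of `q`. -/
theorem exists_eLpNorm_fockTransform_le (n : ℕ) :
    ∃ C : ℝ≥0, ∀ q : ℝ≥0∞, 1 ≤ q → ∀ Ψ : ℂ → ℂ, AEStronglyMeasurable Ψ volume →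
      eLpNorm (fun z : ℂ => (((1 + ‖z‖) ^ n : ℝ) : ℂ) * fockTransform Ψ z *
          (Real.exp (-‖z‖ ^ 2 / 2) : ℂ)) q volume ≤
        C * eLpNorm (fun w : ℂ => (((1 + ‖w‖) ^ n : ℝ) : ℂ) * Ψ w) q volume := by
  let k : ℂ → ℝ := fun u => Real.pi⁻¹ * ((1 + ‖u‖) ^ n * Real.exp (-‖u‖ ^ 2 / 2))
  have hki : Integrable k := by
    rw [← memLp_one_iff_integrable]
    refine MemLp.const_mul ?_ _
    refine memLp_of_norm_le_exp (Continuous.aestronglyMeasurable (by fun_prop))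
      (Real.exp ((n + 0) ^ 2)) (fun z => ?_) _
    rw [Real.norm_of_nonneg (by positivity)]
    convert one_add_pow_mul_exp_le n 0 ‖z‖ (norm_nonneg _) using 3
    ring
  have hkm : Measurable fun u => ENNReal.ofReal (k u) :=
    (Continuous.measurable (by fun_prop)).ennreal_ofReal
  have hkt : ∫⁻ u, ENNReal.ofReal (k u) ≠ ∞ := hki.lintegral_lt_top.ne
  refine ⟨(∫⁻ u, ENNReal.ofReal (k u)).toNNReal, fun q hq Ψ hΨ => ?_⟩
  rw [ENNReal.coe_toNNReal hkt]
  have hΨm : AEStronglyMeasurable (fun w : ℂ => (((1 + ‖w‖) ^ n : ℝ) : ℂ) * Ψ w) volume :=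
    AEStronglyMeasurable.mul (Continuous.aestronglyMeasurable (by fun_prop)) hΨ
  have h := eLpNorm_lintegral_mul_sub_le hΨm.enorm hkm hq
  rw [eLpNorm_enorm] at h
  refine le_trans (eLpNorm_mono_enorm fun z => ?_) h
  rw [enorm_eq_self]
  exact enorm_fockTransform_mul_le Ψ n z

/-! ### Polynomial weights and membership in Fock–Sobolev spaces -/

theorem norm_one_add_pow_mul_mul_exp (n : ℕ) (z a : ℂ) :
    ‖(((1 + ‖z‖) ^ n : ℝ) : ℂ) * a * (Real.exp (-‖z‖ ^ 2 / 2) : ℂ)‖ =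
      (1 + ‖z‖) ^ n * ‖a‖ * Real.exp (-‖z‖ ^ 2 / 2) := by
  rw [norm_mul, norm_mul, Complex.norm_real, Complex.norm_real,
    Real.norm_of_nonneg (Real.exp_nonneg _), Real.norm_of_nonneg (by positivity)]

theorem continuous_one_add_pow_mul {f : ℂ → ℂ} (hf : Differentiable ℂ f) (n : ℕ) :
    Continuous fun z : ℂ => (((1 + ‖z‖) ^ n : ℝ) : ℂ) * f z * (Real.exp (-‖z‖ ^ 2 / 2) : ℂ) := by
  have := hf.continuous
  fun_prop

theorem continuous_pow_mul {f : ℂ → ℂ} (hf : Differentiable ℂ f) (n : ℕ) :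
    Continuous fun z : ℂ => z ^ n * f z * (Real.exp (-‖z‖ ^ 2 / 2) : ℂ) := by
  have := hf.continuous
  fun_prop

/-- Outside the unit disk `1 + |z| ≤ 2|z|`. Inside, `f` is bounded pointwise by the right-hand norm,
and the disk has finite area. -/
theorem exists_eLpNorm_one_add_pow_le {q : ℝ≥0∞} (hq : 1 ≤ q) (m : ℕ) :
    ∃ C : ℝ≥0, ∀ f : ℂ → ℂ, Differentiable ℂ f →
      eLpNorm (fun z : ℂ => (((1 + ‖z‖) ^ m : ℝ) : ℂ) * f z * (Real.exp (-‖z‖ ^ 2 / 2) : ℂ)) q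
        volume ≤
      C * eLpNorm (fun z : ℂ => z ^ m * f z * (Real.exp (-‖z‖ ^ 2 / 2) : ℂ)) q volume := by
  obtain ⟨C, hC⟩ := exists_enorm_le_eLpNorm_pow_mul hq m 1
  have hV : volume (Metric.closedBall (0 : ℂ) 1) = NNReal.pi := by
    rw [Complex.volume_closedBall]; simp
  have hVt : (NNReal.pi : ℝ≥0∞) ^ (1 / q.toReal) ≠ ∞ :=
    ENNReal.rpow_ne_top_of_nonneg (by positivity) (by simp)
  refine ⟨2 ^ m + 2 ^ m * C * ((NNReal.pi : ℝ≥0∞) ^ (1 / q.toReal)).toNNReal, fun f hf => ?_⟩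
  set h : ℂ → ℂ := fun z : ℂ => z ^ m * f z * (Real.exp (-‖z‖ ^ 2 / 2) : ℂ) with hh
  rcases eq_or_ne (eLpNorm h q volume) ∞ with ht | ht
  · rw [ht, ENNReal.mul_top]
    · exact le_top
    · rw [ENNReal.coe_ne_zero]; positivity
  set N := (eLpNorm h q volume).toReal with hN
  have hNe : eLpNorm h q volume = ENNReal.ofReal N := (ENNReal.ofReal_toReal ht).symm
  let F₁ : ℂ → ℝ := fun z => 2 ^ m * ‖h z‖
  let F₂ : ℂ → ℝ := (Metric.closedBall (0 : ℂ) 1).indicator fun _ => 2 ^ m * C * N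
  have hpt : ∀ z : ℂ, ‖(((1 + ‖z‖) ^ m : ℝ) : ℂ) * f z * (Real.exp (-‖z‖ ^ 2 / 2) : ℂ)‖ ≤
      (F₁ + F₂) z := by
    intro z
    rw [norm_one_add_pow_mul_mul_exp, Pi.add_apply]
    have hF₁ : 0 ≤ F₁ z := by positivity
    by_cases hz : ‖z‖ ≤ 1
    · have h1 : F₂ z = 2 ^ m * C * N := Set.indicator_of_mem (by simpa using hz) _
      have h2 : ‖f z‖ ≤ C * N := by
        have := hC f hf z hz
        rw [← hh] at this
        have := ENNReal.toReal_mono (ENNReal.mul_ne_top (by simp) ht) this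
        simpa [hN] using this
      have h3 : Real.exp (-‖z‖ ^ 2 / 2) ≤ 1 := Real.exp_le_one_iff.2 (by nlinarith [norm_nonneg z])
      have h4 : (1 + ‖z‖) ^ m ≤ 2 ^ m := by gcongr; linarith
      calc (1 + ‖z‖) ^ m * ‖f z‖ * Real.exp (-‖z‖ ^ 2 / 2)
          ≤ 2 ^ m * (C * N) * 1 := by gcongr
        _ ≤ F₁ z + F₂ z := by rw [h1]; linarith
    · have h1 : F₂ z = 0 := Set.indicator_of_notMem (by simpa using hz) _
      have h4 : (1 + ‖z‖) ^ m ≤ 2 ^ m * ‖z‖ ^ m := by rw [← mul_pow]; gcongr; linarith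
      have h5 : ‖h z‖ = ‖z‖ ^ m * ‖f z‖ * Real.exp (-‖z‖ ^ 2 / 2) := by
        simp only [hh, norm_mul, norm_pow, Complex.norm_real, Real.norm_of_nonneg (Real.exp_nonneg _)]
      rw [h1, add_zero]
      simp only [F₁]
      rw [h5, ← mul_assoc, ← mul_assoc]
      gcongr
  have hhm : AEStronglyMeasurable h volume := (continuous_pow_mul hf m).aestronglyMeasurable
  have hm1 : AEStronglyMeasurable F₁ volume := by
    have := (continuous_pow_mul hf m)
    exact Continuous.aestronglyMeasurable (by fun_prop)
  have hm2 : AEStronglyMeasurable F₂ volume :=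
    aestronglyMeasurable_const.indicator Metric.isClosed_closedBall.measurableSet
  calc _ ≤ eLpNorm (F₁ + F₂) q volume := eLpNorm_mono_real hpt
    _ ≤ eLpNorm F₁ q volume + eLpNorm F₂ q volume := eLpNorm_add_le hm1 hm2 hq
    _ ≤ 2 ^ m * ENNReal.ofReal N + (2 ^ m * C * ENNReal.ofReal N) *
        (NNReal.pi : ℝ≥0∞) ^ (1 / q.toReal) := by
        gcongr
        · have : F₁ = (2 ^ m : ℝ) • fun z => ‖h z‖ := rfl
          rw [this, eLpNorm_const_smul, eLpNorm_norm, hNe]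
          gcongr
          rw [← ofReal_norm, Real.norm_of_nonneg (by positivity)]
          rw [ENNReal.ofReal_pow (by norm_num)]; simp
        · refine (eLpNorm_indicator_const_le _ _).trans ?_
          rw [hV]
          gcongr
          rw [← ofReal_norm, Real.norm_of_nonneg (by positivity), ENNReal.ofReal_mul (by positivity),
            ENNReal.ofReal_mul (by positivity), ENNReal.ofReal_pow (by norm_num)]; simp
    _ = _ := by
        rw [hNe]; push_cast
        rw [ENNReal.coe_toNNReal hVt]; ring

theorem memLp_one_add_pow_mul_mono {f : ℂ → ℂ} (hf : Differentiable ℂ f) {q : ℝ≥0∞} {j n : ℕ}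
    (hjn : j ≤ n)
    (h : MemLp (fun z : ℂ => (((1 + ‖z‖) ^ n : ℝ) : ℂ) * f z * (Real.exp (-‖z‖ ^ 2 / 2) : ℂ)) q
      volume) :
    MemLp (fun z : ℂ => (((1 + ‖z‖) ^ j : ℝ) : ℂ) * f z * (Real.exp (-‖z‖ ^ 2 / 2) : ℂ)) q
      volume := by
  refine h.mono (continuous_one_add_pow_mul hf j).aestronglyMeasurable
    (Eventually.of_forall fun z => ?_)
  rw [norm_one_add_pow_mul_mul_exp, norm_one_add_pow_mul_mul_exp]
  gcongr
  linarith [norm_nonneg z]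

/-- The `m`-th derivative of the transform is the transform of `conj w ^ m * Ψ`, which is in `L^q`
by the weighted hypothesis; the unweighted bound then applies. -/
theorem fockTransform_mem_fockSobolevSpace {Ψ : ℂ → ℂ} {q : ℝ≥0∞} (hq : 1 ≤ q) {m : ℕ}
    (hΨ : AEStronglyMeasurable Ψ volume)
    (hm : MemLp (fun w : ℂ => (((1 + ‖w‖) ^ m : ℝ) : ℂ) * Ψ w) q volume) :
    fockTransform Ψ ∈ FockSobolevSpace q m := by
  have h0 : MemLp Ψ q volume := by
    refine hm.mono hΨ (Eventually.of_forall fun w => ?_)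
    rw [norm_mul, Complex.norm_real, Real.norm_of_nonneg (by positivity)]
    exact le_mul_of_one_le_left (norm_nonneg _) (one_le_pow₀ (by linarith [norm_nonneg w]))
  have h1 : MemLp (fun w : ℂ => conj w ^ m * Ψ w) q volume := by
    refine hm.mono ?_ (Eventually.of_forall fun w => ?_)
    · exact AEStronglyMeasurable.mul (Continuous.aestronglyMeasurable (by fun_prop)) hΨ
    · rw [norm_mul, norm_mul, Complex.norm_real, Real.norm_of_nonneg (by positivity), norm_pow,
        RCLike.norm_conj]
      gcongr
      linarith
  refine ⟨differentiable_fockTransform hq h0, ?_⟩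
  rw [iteratedDeriv_fockTransform hq h0]
  have hd := differentiable_fockTransform hq h1
  refine ⟨hd, ?_⟩
  obtain ⟨C, hC⟩ := exists_eLpNorm_fockTransform_le 0
  have := hC q hq _ h1.1
  simp only [pow_zero, ofReal_one, one_mul] at this
  refine ⟨?_, this.trans_lt (ENNReal.mul_lt_top (by simp) h1.2)⟩
  have := hd.continuous
  exact Continuous.aestronglyMeasurable (by fun_prop)

theorem mem_fockSobolevSpace_of_memLp {f : ℂ → ℂ} (hf : Differentiable ℂ f) {q : ℝ≥0∞}
    (hq : 1 ≤ q) {m : ℕ}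
    (h : MemLp (fun z : ℂ => z ^ m * f z * (Real.exp (-‖z‖ ^ 2 / 2) : ℂ)) q volume) :
    f ∈ FockSobolevSpace q m := by
  obtain ⟨C, hC⟩ := exists_eLpNorm_one_add_pow_le hq m
  have h1 : MemLp (fun z : ℂ => (((1 + ‖z‖) ^ m : ℝ) : ℂ) * f z * (Real.exp (-‖z‖ ^ 2 / 2) : ℂ)) q
      volume := ⟨(continuous_one_add_pow_mul hf m).aestronglyMeasurable,
        (hC f hf).trans_lt (ENNReal.mul_lt_top (by simp) h.2)⟩
  have h0 := memLp_one_add_pow_mul_mono hf (Nat.zero_le m) h1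
  simp only [pow_zero, ofReal_one, one_mul] at h0
  rw [← fockTransform_eq_self hf hq h0]
  refine fockTransform_mem_fockSobolevSpace hq h0.1 ?_
  simpa only [mul_assoc] using h1

/-! ### Recovering the weight from derivatives -/

/-- In `t` the integrand has antiderivative `2 exp(-(1 - t) x²/2)`, so the bound is uniform in `x`.
-/
theorem lintegral_sq_mul_exp_le (x : ℝ) :
    ∫⁻ t in Set.Ioc (1 / 2 : ℝ) 1, ENNReal.ofReal (x ^ 2 * Real.exp (-(1 - t) * x ^ 2 / 2)) ≤ 2 := by
  have hc : Continuous fun t : ℝ => x ^ 2 * Real.exp (-(1 - t) * x ^ 2 / 2) := by fun_prop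
  rw [← ofReal_integral_eq_lintegral_ofReal
    (hc.integrableOn_Ioc) (Eventually.of_forall fun t => by positivity),
    ← intervalIntegral.integral_of_le (by norm_num)]
  have hd : ∀ t ∈ Set.uIcc (1 / 2 : ℝ) 1, HasDerivAt
      (fun t : ℝ => 2 * Real.exp (-(1 - t) * x ^ 2 / 2))
      (x ^ 2 * Real.exp (-(1 - t) * x ^ 2 / 2)) t := by
    intro t _
    have h1 : HasDerivAt (fun t : ℝ => -(1 - t) * x ^ 2 / 2) (x ^ 2 / 2) t := by
      have := ((((hasDerivAt_id t).const_sub 1).neg).mul_const (x ^ 2)).div_const 2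
      refine this.congr_deriv ?_
      ring
    refine (h1.exp.const_mul 2).congr_deriv ?_
    ring
  rw [intervalIntegral.integral_eq_sub_of_hasDerivAt hd (hc.intervalIntegrable _ _)]
  calc _ ≤ ENNReal.ofReal 2 := by
        apply ENNReal.ofReal_le_ofReal
        have := Real.exp_nonneg (-(1 - 1 / 2) * x ^ 2 / 2)
        simp only [sub_self, neg_zero, zero_mul, zero_div, Real.exp_zero]
        linarith
    _ = 2 := by simp

/-- For `x ≤ 1` the factor `x (1 + x)` is at most `2`, and for `x ≥ 1` at most `2x²`, which reduces
to the exact integral. This is the mass condition of the Schur test. -/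
theorem lintegral_mul_one_add_mul_exp_le {c x : ℝ} (hc : 0 ≤ c) (hx : 0 ≤ x) :
    ∫⁻ t in Set.Ioc (1 / 2 : ℝ) 1,
        ENNReal.ofReal (c * (x * (1 + x) * Real.exp (-(1 - t) * x ^ 2 / 2))) ≤
      ENNReal.ofReal c * 6 := by
  have hm : Measurable fun t : ℝ => ENNReal.ofReal (x ^ 2 * Real.exp (-(1 - t) * x ^ 2 / 2)) :=
    (Continuous.measurable (by fun_prop)).ennreal_ofReal
  calc _ ≤ ∫⁻ t in Set.Ioc (1 / 2 : ℝ) 1, ENNReal.ofReal c *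
        (2 * ENNReal.ofReal (x ^ 2 * Real.exp (-(1 - t) * x ^ 2 / 2)) + 2) := by
        refine setLIntegral_mono' measurableSet_Ioc fun t ht => ?_
        rw [ENNReal.ofReal_mul hc]
        gcongr
        rw [show (2 : ℝ≥0∞) = ENNReal.ofReal 2 by simp, ← ENNReal.ofReal_mul (by norm_num),
          ← ENNReal.ofReal_add (by positivity) (by norm_num)]
        apply ENNReal.ofReal_le_ofReal
        have h1 : Real.exp (-(1 - t) * x ^ 2 / 2) ≤ 1 := Real.exp_le_one_iff.2 (by
          have : 0 ≤ (1 - t) * x ^ 2 := mul_nonneg (by linarith [ht.2]) (sq_nonneg _)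
          linarith)
        have h0 := Real.exp_nonneg (-(1 - t) * x ^ 2 / 2)
        rcases le_total x 1 with h | h
        · have : x * (1 + x) * Real.exp (-(1 - t) * x ^ 2 / 2) ≤ 2 * 1 := by
            gcongr; nlinarith
          have h3 : 0 ≤ 2 * (x ^ 2 * Real.exp (-(1 - t) * x ^ 2 / 2)) := by positivity
          linarith
        · have : x * (1 + x) * Real.exp (-(1 - t) * x ^ 2 / 2) ≤
            (2 * x ^ 2) * Real.exp (-(1 - t) * x ^ 2 / 2) :=
            mul_le_mul_of_nonneg_right (by nlinarith) h0
          linarith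
    _ = ENNReal.ofReal c * (2 * (∫⁻ t in Set.Ioc (1 / 2 : ℝ) 1,
        ENNReal.ofReal (x ^ 2 * Real.exp (-(1 - t) * x ^ 2 / 2))) + 2 * ENNReal.ofReal (1 / 2)) := by
        rw [lintegral_const_mul _ (by fun_prop), lintegral_add_right _ measurable_const,
          lintegral_const_mul _ hm, lintegral_const]
        simp only [Measure.restrict_apply_univ, Real.volume_Ioc]
        norm_num
    _ ≤ ENNReal.ofReal c * (2 * 2 + 2 * 1) := by
        gcongr
        · exact lintegral_sq_mul_exp_le x
        · rw [← ENNReal.ofReal_one]; apply ENNReal.ofReal_le_ofReal; norm_num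
    _ = _ := by norm_num

theorem lintegral_comp_smul_le {t : ℝ} (ht : 1 / 2 < t) {φ : ℂ → ℝ≥0∞} (hφ : Measurable φ) :
    ∫⁻ z : ℂ, φ (t • z) ≤ 4 * ∫⁻ z, φ z := by
  have ht0 : 0 < t := by linarith
  have hm : Measurable fun z : ℂ => t • z := by fun_prop
  have h1 : ∫⁻ z : ℂ, φ (t • z) = ∫⁻ z, φ z ∂(Measure.map (fun z : ℂ => t • z) volume) :=
    (lintegral_map hφ hm).symm
  rw [h1, Measure.map_addHaar_smul _ ht0.ne', lintegral_smul_measure, smul_eq_mul]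
  gcongr
  rw [show (4 : ℝ≥0∞) = ENNReal.ofReal 4 by simp]
  apply ENNReal.ofReal_le_ofReal
  rw [Complex.finrank_real_complex, abs_of_pos (by positivity)]
  rw [inv_le_comm₀ (by positivity) (by norm_num)]
  nlinarith

theorem sub_half_eq_integral {f : ℂ → ℂ} (hf : Differentiable ℂ f) (z : ℂ) :
    f z - f ((1 / 2 : ℝ) • z) = ∫ t in Set.Ioc (1 / 2 : ℝ) 1, z * deriv f (t • z) := by
  have hd : ∀ t ∈ Set.uIcc (1 / 2 : ℝ) 1,
      HasDerivAt (fun t : ℝ => f (t • z)) (z * deriv f (t • z)) t := by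
    intro t _
    have h1 : HasDerivAt (fun t : ℝ => t • z) z t := by
      simpa using (hasDerivAt_id t).smul_const z
    have h2 := (hf (t • z)).hasDerivAt.scomp t h1
    simpa [Function.comp_def] using h2
  have hc : Continuous fun t : ℝ => z * deriv f (t • z) := by
    have : Continuous (deriv f) := (hf.contDiff (n := 1)).continuous_deriv le_rfl
    fun_prop
  rw [← intervalIntegral.integral_of_le (by norm_num),
    intervalIntegral.integral_eq_sub_of_hasDerivAt hd (hc.intervalIntegrable _ _), one_smul]

/-- Since `t² ≤ t`, the weight at `z` is at most the weight at `t z` times `exp(-(1 - t)|z|²/2)`.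
That spare factor offsets both the `|z|` from the segment and the additional power of `1 + |z|`. -/
theorem enorm_sub_half_le {f : ℂ → ℂ} (hf : Differentiable ℂ f) (k : ℕ) (z : ℂ) :
    ‖(((1 + ‖z‖) ^ (k + 1) : ℝ) : ℂ) * (f z - f ((1 / 2 : ℝ) • z)) *
        (Real.exp (-‖z‖ ^ 2 / 2) : ℂ)‖ₑ ≤
      ∫⁻ t in Set.Ioc (1 / 2 : ℝ) 1,
        ‖(((1 + ‖t • z‖) ^ k : ℝ) : ℂ) * deriv f (t • z) * (Real.exp (-‖t • z‖ ^ 2 / 2) : ℂ)‖ₑ *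
        ENNReal.ofReal (2 ^ k * (‖z‖ * (1 + ‖z‖) * Real.exp (-(1 - t) * ‖z‖ ^ 2 / 2))) := by
  have e : (((1 + ‖z‖) ^ (k + 1) : ℝ) : ℂ) * (f z - f ((1 / 2 : ℝ) • z)) *
        (Real.exp (-‖z‖ ^ 2 / 2) : ℂ) = ∫ t in Set.Ioc (1 / 2 : ℝ) 1,
        (((1 + ‖z‖) ^ (k + 1) * Real.exp (-‖z‖ ^ 2 / 2) : ℝ) : ℂ) *
          (z * deriv f (t • z)) := by
    rw [integral_const_mul, ← sub_half_eq_integral hf]; push_cast; ring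
  rw [e]
  refine (enorm_integral_le_lintegral_enorm _).trans
    (setLIntegral_mono' measurableSet_Ioc fun t ht => ?_)
  have ht0 : 0 < t := by linarith [ht.1]
  rw [← ofReal_norm, ← ofReal_norm, ← ENNReal.ofReal_mul (norm_nonneg _)]
  apply ENNReal.ofReal_le_ofReal
  rw [norm_one_add_pow_mul_mul_exp, norm_mul, norm_mul, Complex.norm_real,
    Real.norm_of_nonneg (by positivity), norm_smul, Real.norm_of_nonneg ht0.le]
  set x := ‖z‖
  have hx : 0 ≤ x := norm_nonneg _
  have h1 : (1 + x) ^ k ≤ 2 ^ k * (1 + t * x) ^ k := by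
    rw [← mul_pow]; gcongr; nlinarith [ht.1]
  have h2 : Real.exp (-x ^ 2 / 2) ≤
      Real.exp (-(t * x) ^ 2 / 2) * Real.exp (-(1 - t) * x ^ 2 / 2) := by
    rw [← Real.exp_add]
    apply Real.exp_le_exp.2
    have : 0 ≤ (t * (1 - t)) * x ^ 2 := mul_nonneg (mul_nonneg ht0.le (by linarith [ht.2]))
      (sq_nonneg _)
    nlinarith
  calc (1 + x) ^ (k + 1) * Real.exp (-x ^ 2 / 2) * (x * ‖deriv f (t • z)‖)
      = (1 + x) ^ k * Real.exp (-x ^ 2 / 2) * ((x * (1 + x)) * ‖deriv f (t • z)‖) := by ring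
    _ ≤ (2 ^ k * (1 + t * x) ^ k) *
        (Real.exp (-(t * x) ^ 2 / 2) * Real.exp (-(1 - t) * x ^ 2 / 2)) *
        ((x * (1 + x)) * ‖deriv f (t • z)‖) := by gcongr
    _ = _ := by ring

/-- A Schur test for the kernel `K z t` on the segment parameter: its mass in `t` is bounded
uniformly in `z`, and the substitution `w = t z` gives the same kind of bound after exchanging
integrals. -/
theorem eLpNorm_sub_half_lt_top {f : ℂ → ℂ} (hf : Differentiable ℂ f) (k : ℕ) {q : ℝ≥0∞}
    (hq : 1 ≤ q)
    (h : MemLp (fun z : ℂ => (((1 + ‖z‖) ^ k : ℝ) : ℂ) * deriv f z *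
      (Real.exp (-‖z‖ ^ 2 / 2) : ℂ)) q volume) :
    eLpNorm (fun z : ℂ => (((1 + ‖z‖) ^ (k + 1) : ℝ) : ℂ) * (f z - f ((1 / 2 : ℝ) • z)) *
        (Real.exp (-‖z‖ ^ 2 / 2) : ℂ)) q volume < ∞ := by
  have hdf : Differentiable ℂ (deriv f) := (hf.contDiff (n := 2)).differentiable_deriv_two
  set D : ℂ → ℂ := fun z : ℂ => (((1 + ‖z‖) ^ k : ℝ) : ℂ) * deriv f z *
      (Real.exp (-‖z‖ ^ 2 / 2) : ℂ) with hD
  have hDc : Continuous D := continuous_one_add_pow_mul hdf k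
  set K : ℂ → ℝ → ℝ≥0∞ := fun z t =>
    ENNReal.ofReal (2 ^ k * (‖z‖ * (1 + ‖z‖) * Real.exp (-(1 - t) * ‖z‖ ^ 2 / 2))) with hK
  have hKm : Measurable (Function.uncurry K) :=
    (Continuous.measurable (by fun_prop)).ennreal_ofReal
  have hmass : ∀ (c : ℝ), 0 ≤ c → ∀ z : ℂ, ∫⁻ t in Set.Ioc (1 / 2 : ℝ) 1,
      ENNReal.ofReal (c * (‖z‖ * (1 + ‖z‖) * Real.exp (-(1 - t) * ‖z‖ ^ 2 / 2))) ≤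
        ENNReal.ofReal c * 6 := fun c hc z => lintegral_mul_one_add_mul_exp_le hc (norm_nonneg z)
  have hpt : ∀ z : ℂ, ‖(((1 + ‖z‖) ^ (k + 1) : ℝ) : ℂ) * (f z - f ((1 / 2 : ℝ) • z)) *
        (Real.exp (-‖z‖ ^ 2 / 2) : ℂ)‖ₑ ≤
      ∫⁻ t in Set.Ioc (1 / 2 : ℝ) 1, ‖D (t • z)‖ₑ * K z t := fun z => enorm_sub_half_le hf k z
  rcases eq_or_ne q ∞ with rfl | ht
  · rw [eLpNorm_exponent_top]
    refine (eLpNormEssSup_le_of_ae_enorm_bound (C := eLpNorm D ∞ volume * (ENNReal.ofReal (2 ^ k) * 6))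
      (Eventually.of_forall fun z => ?_)).trans_lt
      (ENNReal.mul_lt_top h.2 (ENNReal.mul_lt_top (by simp) (by simp)))
    refine (hpt z).trans ?_
    refine le_trans ?_ (mul_le_mul_right (hmass (2 ^ k) (by positivity) z) _)
    rw [← lintegral_const_mul' _ _ h.2.ne]
    exact lintegral_mono fun t => mul_le_mul_left (enorm_le_eLpNorm_top_of_continuous hDc _) _
  · have h0 : q ≠ 0 := (zero_lt_one.trans_le hq).ne'
    have hq1 : 1 ≤ q.toReal := by
      rw [← ENNReal.toReal_one]; exact (ENNReal.toReal_le_toReal (by simp) ht).2 hq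
    have hq0 : 0 < q.toReal := by linarith
    refine (eLpNorm_lt_top_iff_lintegral_rpow_enorm_lt_top h0 ht).2 ?_
    have hfin := (eLpNorm_lt_top_iff_lintegral_rpow_enorm_lt_top h0 ht).1 h.2
    have hjm : Measurable (Function.uncurry fun (z : ℂ) (t : ℝ) =>
        ‖D (t • z)‖ₑ ^ q.toReal * K z t) := by
      refine Measurable.mul (Measurable.pow_const ?_ _) hKm
      exact (Continuous.measurable (by fun_prop))
    -- Two factors `4` occur: the Jacobian `t⁻² ≤ 4`, and `x (1 + x) ≤ 4 (t x)(1 + t x)`, both from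
    -- `t > 1/2`.
    have hscale : ∀ t ∈ Set.Ioc (1 / 2 : ℝ) 1, ∫⁻ z : ℂ, ‖D (t • z)‖ₑ ^ q.toReal * K z t ≤
        4 * ∫⁻ w : ℂ, ‖D w‖ₑ ^ q.toReal * ENNReal.ofReal (4 * 2 ^ k *
          (‖w‖ * (1 + ‖w‖) * Real.exp (-(1 - t) * ‖w‖ ^ 2 / 2))) := by
      intro t ht'
      have ht0 : 0 < t := by linarith [ht'.1]
      have hφ : Measurable fun w : ℂ => ‖D w‖ₑ ^ q.toReal * ENNReal.ofReal (4 * 2 ^ k *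
          (‖w‖ * (1 + ‖w‖) * Real.exp (-(1 - t) * ‖w‖ ^ 2 / 2))) := by
        refine Measurable.mul (Measurable.pow_const hDc.enorm.measurable _) ?_
        exact (Continuous.measurable (by fun_prop)).ennreal_ofReal
      refine le_trans (lintegral_mono fun z => ?_) (lintegral_comp_smul_le ht'.1 hφ)
      dsimp only [hK]
      refine mul_le_mul_right ?_ _
      apply ENNReal.ofReal_le_ofReal
      rw [norm_smul, Real.norm_of_nonneg ht0.le]
      set x := ‖z‖
      have hx : 0 ≤ x := norm_nonneg _
      have h2 : Real.exp (-(1 - t) * x ^ 2 / 2) ≤ Real.exp (-(1 - t) * (t * x) ^ 2 / 2) := by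
        apply Real.exp_le_exp.2
        have h3 : (t * x) ^ 2 ≤ x ^ 2 := by
          apply pow_le_pow_left₀ (by positivity); nlinarith [ht'.2]
        have h4 : 0 ≤ (1 - t) * (x ^ 2 - (t * x) ^ 2) :=
          mul_nonneg (by linarith [ht'.2]) (by linarith)
        linarith
      have h5 : x * (1 + x) ≤ 4 * (t * x * (1 + t * x)) := by
        have h6 : x ≤ 2 * (t * x) := by nlinarith [ht'.1]
        calc x * (1 + x) ≤ (2 * (t * x)) * (1 + 2 * (t * x)) := by gcongr
          _ ≤ _ := by nlinarith [mul_nonneg ht0.le hx]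
      calc 2 ^ k * (x * (1 + x) * Real.exp (-(1 - t) * x ^ 2 / 2))
          ≤ 2 ^ k * (4 * (t * x * (1 + t * x)) * Real.exp (-(1 - t) * (t * x) ^ 2 / 2)) := by
            gcongr
        _ = _ := by ring
    calc _ ≤ ∫⁻ z : ℂ, (ENNReal.ofReal (2 ^ k) * 6) ^ (q.toReal - 1) *
          ∫⁻ t in Set.Ioc (1 / 2 : ℝ) 1, ‖D (t • z)‖ₑ ^ q.toReal * K z t := by
          refine lintegral_mono fun z => ?_
          refine (ENNReal.rpow_le_rpow (hpt z) hq0.le).trans ?_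
          refine (lintegral_mul_rpow_le hq1 ?_ ?_).trans ?_
          · have : Continuous fun t : ℝ => ‖D (t • z)‖ₑ := by fun_prop
            exact this.measurable.aemeasurable
          · exact (hKm.comp measurable_prodMk_left).aemeasurable
          · refine mul_le_mul_left (ENNReal.rpow_le_rpow ?_ (by linarith)) _
            exact hmass _ (by positivity) z
      _ = (ENNReal.ofReal (2 ^ k) * 6) ^ (q.toReal - 1) *
          ∫⁻ t in Set.Ioc (1 / 2 : ℝ) 1, ∫⁻ z : ℂ, ‖D (t • z)‖ₑ ^ q.toReal * K z t := by
          have hz : Measurable fun z : ℂ =>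
            ∫⁻ t in Set.Ioc (1 / 2 : ℝ) 1, ‖D (t • z)‖ₑ ^ q.toReal * K z t :=
            hjm.lintegral_prod_right'
          rw [lintegral_const_mul _ hz, lintegral_lintegral_swap hjm.aemeasurable]
      _ ≤ (ENNReal.ofReal (2 ^ k) * 6) ^ (q.toReal - 1) *
          ∫⁻ t in Set.Ioc (1 / 2 : ℝ) 1, 4 * ∫⁻ w : ℂ, ‖D w‖ₑ ^ q.toReal *
            ENNReal.ofReal (4 * 2 ^ k *
              (‖w‖ * (1 + ‖w‖) * Real.exp (-(1 - t) * ‖w‖ ^ 2 / 2))) :=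
          mul_le_mul_right (setLIntegral_mono' measurableSet_Ioc hscale) _
      _ = (ENNReal.ofReal (2 ^ k) * 6) ^ (q.toReal - 1) * (4 *
          ∫⁻ w : ℂ, ∫⁻ t in Set.Ioc (1 / 2 : ℝ) 1, ‖D w‖ₑ ^ q.toReal *
            ENNReal.ofReal (4 * 2 ^ k *
              (‖w‖ * (1 + ‖w‖) * Real.exp (-(1 - t) * ‖w‖ ^ 2 / 2)))) := by
          rw [lintegral_const_mul' _ _ (by simp), lintegral_lintegral_swap]
          refine Measurable.aemeasurable ?_
          refine Measurable.mul (Measurable.pow_const ?_ _) ?_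
          · exact (hDc.enorm.measurable.comp measurable_snd)
          · exact (Continuous.measurable (by fun_prop)).ennreal_ofReal
      _ ≤ (ENNReal.ofReal (2 ^ k) * 6) ^ (q.toReal - 1) * (4 *
          ∫⁻ w : ℂ, ‖D w‖ₑ ^ q.toReal * (ENNReal.ofReal (4 * 2 ^ k) * 6)) := by
          gcongr with w
          rw [lintegral_const_mul' _ _ (ENNReal.rpow_ne_top_of_nonneg hq0.le (by simp))]
          gcongr
          exact hmass _ (by positivity) w
      _ < ∞ := by
          rw [lintegral_mul_const _ (hDc.enorm.measurable.pow_const _)]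
          refine ENNReal.mul_lt_top (ENNReal.rpow_lt_top_of_nonneg (by linarith)
            (ENNReal.mul_ne_top (by simp) (by simp))) (ENNReal.mul_lt_top (by simp)
            (ENNReal.mul_lt_top hfin (ENNReal.mul_lt_top ENNReal.ofReal_lt_top (by simp))))

/-- The derivative grows at most like `exp(|w|²/2)`, so `f(z/2)` grows at most like `(1 + |z|)
exp(|z|²/8)`. The Gaussian weight leaves `exp(-3|z|²/8)`, enough for any polynomial weight and any
exponent `r`. -/
theorem memLp_comp_half {f : ℂ → ℂ} (hf : Differentiable ℂ f) {q : ℝ≥0∞} (hq : 1 ≤ q)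
    (h : MemLp (fun z : ℂ => deriv f z * (Real.exp (-‖z‖ ^ 2 / 2) : ℂ)) q volume)
    (n : ℕ) (r : ℝ≥0∞) :
    MemLp (fun z : ℂ => (((1 + ‖z‖) ^ n : ℝ) : ℂ) * f ((1 / 2 : ℝ) • z) *
      (Real.exp (-‖z‖ ^ 2 / 2) : ℂ)) r volume := by
  have hdf : Differentiable ℂ (deriv f) := (hf.contDiff (n := 2)).differentiable_deriv_two
  obtain ⟨C, hC⟩ := exists_enorm_le_eLpNorm hq
  set A := (C * eLpNorm (fun z : ℂ => deriv f z * (Real.exp (-‖z‖ ^ 2 / 2) : ℂ)) q volume).toReal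
  have hA : 0 ≤ A := ENNReal.toReal_nonneg
  have hderiv : ∀ w : ℂ, ‖deriv f w‖ ≤ A * Real.exp (‖w‖ ^ 2 / 2) := by
    intro w
    have h1 := ENNReal.toReal_mono (ENNReal.mul_ne_top (by simp) h.2.ne) (hC _ hdf w)
    rw [toReal_enorm, norm_mul, Complex.norm_real, Real.norm_of_nonneg (Real.exp_nonneg _)] at h1
    have h4 : Real.exp (-‖w‖ ^ 2 / 2) * Real.exp (‖w‖ ^ 2 / 2) = 1 := by
      rw [← Real.exp_add, ← Real.exp_zero]; congr 1; ring
    calc ‖deriv f w‖ = ‖deriv f w‖ * Real.exp (-‖w‖ ^ 2 / 2) * Real.exp (‖w‖ ^ 2 / 2) := by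
          rw [mul_assoc, h4, mul_one]
      _ ≤ _ := by gcongr
  have hfw : ∀ w : ℂ, ‖f w‖ ≤ ‖f 0‖ + A * Real.exp (‖w‖ ^ 2 / 2) * ‖w‖ := by
    intro w
    have h1 := (convex_closedBall (0 : ℂ) ‖w‖).norm_image_sub_le_of_norm_deriv_le
      (f := f) (C := A * Real.exp (‖w‖ ^ 2 / 2)) (x := 0) (y := w) (fun x _ => hf x)
      (fun x hx => (hderiv x).trans (by
        rw [mem_closedBall_zero_iff] at hx
        gcongr)) (by simp) (by simp)
    have h2 : ‖f w‖ ≤ ‖f 0‖ + ‖f w - f 0‖ := by simpa using norm_add_le (f 0) (f w - f 0)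
    rw [sub_zero] at h1
    linarith
  have hfc := hf.continuous
  refine memLp_of_norm_le_exp (Continuous.aestronglyMeasurable (by fun_prop))
    ((‖f 0‖ + A) * (2 ^ (n + 1) * Real.exp (((n + 1 : ℕ) + 0 : ℝ) ^ 2))) (fun z => ?_) r
  rw [norm_one_add_pow_mul_mul_exp]
  have h3 := hfw ((1 / 2 : ℝ) • z)
  rw [norm_smul, Real.norm_of_nonneg (by norm_num)] at h3
  set x := ‖z‖
  have hx : 0 ≤ x := norm_nonneg _
  have h6 := one_add_pow_mul_exp_le (n + 1) 0 (x / 2) (by positivity)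
  have h7 : (1 + x) ^ (n + 1) ≤ 2 ^ (n + 1) * (1 + x / 2) ^ (n + 1) := by
    rw [← mul_pow]; gcongr; linarith
  have h8 : ‖f ((1 / 2 : ℝ) • z)‖ ≤ (‖f 0‖ + A) * (Real.exp (x ^ 2 / 8) * (1 + x)) := by
    have e1 : (1 : ℝ) ≤ Real.exp (x ^ 2 / 8) := Real.one_le_exp (by positivity)
    have e2 : Real.exp ((1 / 2 * x) ^ 2 / 2) = Real.exp (x ^ 2 / 8) := by congr 1; ring
    rw [e2] at h3
    have e3 : 1 ≤ Real.exp (x ^ 2 / 8) * (1 + x) := by nlinarith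
    have e4 : Real.exp (x ^ 2 / 8) * (1 / 2 * x) ≤ Real.exp (x ^ 2 / 8) * (1 + x) := by
      gcongr; linarith
    nlinarith [norm_nonneg (f 0)]
  have h9 : (1 + x / 2) ^ (n + 1) * Real.exp (-x ^ 2 / 8) ≤
      Real.exp (((n + 1 : ℕ) + 0 : ℝ) ^ 2) := by
    have e1 : Real.exp (-(x / 2) ^ 2 / 4) ≤ 1 := Real.exp_le_one_iff.2 (by nlinarith)
    have e2 : Real.exp (0 * (x / 2) - (x / 2) ^ 2 / 2) = Real.exp (-x ^ 2 / 8) := by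
      congr 1; ring
    rw [e2] at h6
    exact h6.trans (mul_le_of_le_one_right (Real.exp_nonneg _) e1)
  -- The remaining decay `exp(-3x²/8)` is split: `exp(-x²/8)` absorbs the polynomial and
  -- `exp(-x²/4)` gives integrability.
  have h10 : Real.exp (x ^ 2 / 8) * Real.exp (-x ^ 2 / 2) =
      Real.exp (-x ^ 2 / 8) * Real.exp (-x ^ 2 / 4) := by
    rw [← Real.exp_add, ← Real.exp_add]; congr 1; ring
  calc (1 + x) ^ n * ‖f ((1 / 2 : ℝ) • z)‖ * Real.exp (-x ^ 2 / 2)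
      ≤ (1 + x) ^ n * ((‖f 0‖ + A) * (Real.exp (x ^ 2 / 8) * (1 + x))) *
        Real.exp (-x ^ 2 / 2) := by gcongr
    _ = (‖f 0‖ + A) * ((1 + x) ^ (n + 1) * (Real.exp (x ^ 2 / 8) * Real.exp (-x ^ 2 / 2))) := by
        ring
    _ = (‖f 0‖ + A) * ((1 + x) ^ (n + 1) * Real.exp (-x ^ 2 / 8) * Real.exp (-x ^ 2 / 4)) := by
        rw [h10]; ring
    _ ≤ (‖f 0‖ + A) * ((2 ^ (n + 1) * (1 + x / 2) ^ (n + 1)) * Real.exp (-x ^ 2 / 8) *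
        Real.exp (-x ^ 2 / 4)) := by gcongr
    _ = (‖f 0‖ + A) * (2 ^ (n + 1) * ((1 + x / 2) ^ (n + 1) * Real.exp (-x ^ 2 / 8)) *
        Real.exp (-x ^ 2 / 4)) := by ring
    _ ≤ (‖f 0‖ + A) * (2 ^ (n + 1) * Real.exp (((n + 1 : ℕ) + 0 : ℝ) ^ 2) *
        Real.exp (-x ^ 2 / 4)) := by gcongr
    _ = _ := by ring

theorem memLp_one_add_pow_succ_of_deriv {f : ℂ → ℂ} (hf : Differentiable ℂ f) {k : ℕ} {q : ℝ≥0∞}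
    (hq : 1 ≤ q)
    (h : MemLp (fun z : ℂ => (((1 + ‖z‖) ^ k : ℝ) : ℂ) * deriv f z *
      (Real.exp (-‖z‖ ^ 2 / 2) : ℂ)) q volume) :
    MemLp (fun z : ℂ => (((1 + ‖z‖) ^ (k + 1) : ℝ) : ℂ) * f z *
      (Real.exp (-‖z‖ ^ 2 / 2) : ℂ)) q volume := by
  have hdf : Differentiable ℂ (deriv f) := (hf.contDiff (n := 2)).differentiable_deriv_two
  have h0 := memLp_one_add_pow_mul_mono hdf (Nat.zero_le k) h
  simp only [pow_zero, ofReal_one, one_mul] at h0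
  have h1 := memLp_comp_half hf hq h0 (k + 1) q
  have hfc := hf.continuous
  have h2 : MemLp (fun z : ℂ => (((1 + ‖z‖) ^ (k + 1) : ℝ) : ℂ) *
      (f z - f ((1 / 2 : ℝ) • z)) * (Real.exp (-‖z‖ ^ 2 / 2) : ℂ)) q volume :=
    ⟨Continuous.aestronglyMeasurable (by fun_prop), eLpNorm_sub_half_lt_top hf k hq h⟩
  refine (h2.add h1).congr_norm ?_ ?_
  · exact (continuous_one_add_pow_mul hf _).aestronglyMeasurable
  · refine Eventually.of_forall fun z => congrArg norm ?_
    simp only [Pi.add_apply]; ring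

theorem memLp_of_iteratedDeriv {q : ℝ≥0∞} (hq : 1 ≤ q) (m : ℕ) :
    ∀ {f : ℂ → ℂ} (_ : Differentiable ℂ f) (k : ℕ)
      (_ : MemLp (fun z : ℂ => (((1 + ‖z‖) ^ k : ℝ) : ℂ) * iteratedDeriv m f z *
        (Real.exp (-‖z‖ ^ 2 / 2) : ℂ)) q volume),
    MemLp (fun z : ℂ => (((1 + ‖z‖) ^ (k + m) : ℝ) : ℂ) * f z *
      (Real.exp (-‖z‖ ^ 2 / 2) : ℂ)) q volume := by
  induction m with
  | zero => intro f _ k h; simpa using h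
  | succ m ih =>
    intro f hf k h
    rw [iteratedDeriv_succ] at h
    have hd : Differentiable ℂ (iteratedDeriv m f) :=
      (hf.contDiff (n := m + 1)).differentiable_iteratedDeriv m (by norm_cast; simp)
    have := ih hf (k + 1) (memLp_one_add_pow_succ_of_deriv hd hq h)
    rwa [show k + 1 + m = k + (m + 1) by ring] at this

/-- This turns the definition by derivatives into a weighted `L^q` condition, on which all
interpolation arguments rely. -/
theorem mem_fockSobolevSpace_iff {q : ℝ≥0∞} (hq : 1 ≤ q) {m : ℕ} {f : ℂ → ℂ} :
    f ∈ FockSobolevSpace q m ↔ Differentiable ℂ f ∧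
      MemLp (fun z : ℂ => z ^ m * f z * (Real.exp (-‖z‖ ^ 2 / 2) : ℂ)) q volume := by
  constructor
  · rintro ⟨hf, -, h⟩
    refine ⟨hf, ?_⟩
    have h0 : MemLp (fun z : ℂ => (((1 + ‖z‖) ^ 0 : ℝ) : ℂ) * iteratedDeriv m f z *
        (Real.exp (-‖z‖ ^ 2 / 2) : ℂ)) q volume := by simpa using h
    have h1 := memLp_of_iteratedDeriv hq m hf 0 h0
    refine h1.mono (continuous_pow_mul hf m).aestronglyMeasurable (Eventually.of_forall fun z => ?_)
    rw [norm_one_add_pow_mul_mul_exp, norm_mul, norm_mul, Complex.norm_real,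
      Real.norm_of_nonneg (Real.exp_nonneg _), norm_pow, zero_add]
    gcongr
    linarith
  · rintro ⟨hf, h⟩
    exact mem_fockSobolevSpace_of_memLp hf hq h

/-! ### The three lines theorem in Lebesgue spaces -/

/-- Hölder's inequality with conjugate exponent written through `1 - 1/q`, so that the endpoints `q
= 1` and `q = ∞` need no separate formula. -/
theorem lintegral_mul_rpow_le_eLpNorm {α : Type*} [MeasurableSpace α] {μ : Measure α} {q : ℝ≥0∞}
    (hq : 1 ≤ q) {a : α → ℂ} {b : α → ℝ≥0∞} (ha : AEStronglyMeasurable a μ)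
    (hb : AEMeasurable b μ) :
    ∫⁻ x, ‖a x‖ₑ * b x ^ (1 - (1 / q).toReal) ∂μ ≤
      eLpNorm a q μ * (∫⁻ x, b x ∂μ) ^ (1 - (1 / q).toReal) := by
  rcases eq_or_ne q ∞ with rfl | ht
  · simp only [one_div, ENNReal.inv_top, ENNReal.toReal_zero, sub_zero, ENNReal.rpow_one]
    rw [← lintegral_const_mul'' _ hb, eLpNorm_exponent_top]
    refine lintegral_mono_ae ?_
    filter_upwards [ae_le_eLpNormEssSup (f := a) (μ := μ)] with w hw
    gcongr
  rcases hq.eq_or_lt with rfl | hq1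
  · simp [eLpNorm_one_eq_lintegral_enorm]
  · have h0 : q ≠ 0 := (zero_lt_one.trans hq1).ne'
    have hq1' : 1 < q.toReal := by
      rw [← ENNReal.toReal_one]; exact (ENNReal.toReal_lt_toReal (by simp) ht).2 hq1
    have hc := Real.HolderConjugate.conjExponent hq1'
    set r := Real.conjExponent q.toReal
    have hr : 1 - (1 / q).toReal = 1 / r := by
      have := hc.inv_add_inv_eq_one
      rw [one_div, ENNReal.toReal_inv, one_div]; linarith
    have hr0 : r ≠ 0 := hc.symm.pos.ne'
    rw [hr, eLpNorm_eq_lintegral_rpow_enorm_toReal h0 ht]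
    have key := ENNReal.lintegral_mul_le_Lp_mul_Lq μ hc ha.enorm (hb.pow_const (1 / r))
    simpa only [Pi.mul_apply, ← ENNReal.rpow_mul, one_div, inv_mul_cancel₀ hr0,
      ENNReal.rpow_one] using key

theorem isOpen_verticalStrip (a b : ℝ) : IsOpen (verticalStrip a b) :=
  isOpen_Ioo.preimage continuous_re

theorem verticalStrip_subset_verticalClosedStrip (a b : ℝ) :
    verticalStrip a b ⊆ verticalClosedStrip a b :=
  Set.preimage_mono Set.Ioo_subset_Icc_self

theorem closure_verticalStrip : closure (verticalStrip 0 1) = verticalClosedStrip 0 1 := by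
  rw [verticalStrip, verticalClosedStrip, closure_preimage_re, closure_Ioo zero_ne_one]

section

variable {α : Type*} [MeasurableSpace α] {μ : Measure α}

/-- The derivative is an almost everywhere limit of difference quotients along a sequence that stays
in the ball. -/
theorem aestronglyMeasurable_deriv_param {κ : ℂ → α → ℂ} {ζ : ℂ} {ε : ℝ} (hε : 0 < ε)
    (hmeas : ∀ ω ∈ Metric.ball ζ ε, AEStronglyMeasurable (κ ω) μ)
    (hdiff : ∀ᵐ w ∂μ, DifferentiableAt ℂ (fun ω => κ ω w) ζ) :
    AEStronglyMeasurable (fun w => deriv (fun ω => κ ω w) ζ) μ := by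
  let d : ℕ → ℂ := fun n => ((ε / (n + 2) : ℝ) : ℂ)
  have hd0 : ∀ n, d n ≠ 0 := fun n => by
    simp only [d, ne_eq, ofReal_eq_zero]; positivity
  have hdb : ∀ n, ζ + d n ∈ Metric.ball ζ ε := by
    intro n
    simp only [Metric.mem_ball, dist_self_add_left, d, Complex.norm_real]
    rw [Real.norm_of_nonneg (by positivity), div_lt_iff₀ (by positivity)]
    nlinarith [(Nat.cast_nonneg n : (0 : ℝ) ≤ n)]
  have hlim : Tendsto (fun n => ζ + d n) atTop (𝓝[≠] ζ) := by
    refine tendsto_nhdsWithin_iff.2 ⟨?_, Eventually.of_forall fun n => by simp [hd0 n]⟩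
    have h1 : Tendsto (fun n : ℕ => ε / ((n : ℝ) + 2)) atTop (𝓝 0) :=
      Tendsto.div_atTop tendsto_const_nhds
        (tendsto_atTop_add_const_right _ _ tendsto_natCast_atTop_atTop)
    have h2 : Tendsto d atTop (𝓝 ((0 : ℝ) : ℂ)) := (continuous_ofReal.tendsto 0).comp h1
    simpa using h2.const_add ζ
  refine aestronglyMeasurable_of_tendsto_ae atTop
    (f := fun n w => slope (fun ω => κ ω w) ζ (ζ + d n)) (fun n => ?_) ?_
  · simp only [slope, vsub_eq_sub, smul_eq_mul]
    exact ((hmeas _ (hdb n)).sub (hmeas ζ (Metric.mem_ball_self hε))).const_mul _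
  · filter_upwards [hdiff] with w hw
    exact (hasDerivAt_iff_tendsto_slope.1 hw.hasDerivAt).comp hlim

/-- Cauchy's estimate on disks of radius `ε / 2` turns the uniform bound `B` into a uniform bound on
derivatives, which permits differentiation under the integral. Continuity up to the boundary is
dominated convergence. -/
theorem diffContOnCl_integral [IsFiniteMeasure μ] {κ : ℂ → α → ℂ} {B : ℝ}
    (hmeas : ∀ ζ ∈ verticalClosedStrip 0 1, AEStronglyMeasurable (κ ζ) μ)
    (hbd : ∀ᵐ w ∂μ, ∀ ζ ∈ verticalClosedStrip 0 1, ‖κ ζ w‖ ≤ B)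
    (hcont : ∀ᵐ w ∂μ, ContinuousOn (fun ζ => κ ζ w) (verticalClosedStrip 0 1))
    (hdiff : ∀ᵐ w ∂μ, DifferentiableOn ℂ (fun ζ => κ ζ w) (verticalStrip 0 1)) :
    DiffContOnCl ℂ (fun ζ => ∫ w, κ ζ w ∂μ) (verticalStrip 0 1) := by
  have hsub := verticalStrip_subset_verticalClosedStrip 0 1
  constructor
  · intro ζ hζ
    obtain ⟨ε, hε, hball⟩ := Metric.isOpen_iff.1 (isOpen_verticalStrip 0 1) ζ hζ
    have hb2 : Metric.ball ζ (ε / 2) ⊆ Metric.ball ζ ε := Metric.ball_subset_ball (by linarith)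
    have hdiffAt : ∀ᵐ w ∂μ, ∀ ω ∈ Metric.ball ζ (ε / 2),
        DifferentiableAt ℂ (fun ω => κ ω w) ω := by
      filter_upwards [hdiff] with w hw ω hω
      exact hw.differentiableAt ((isOpen_verticalStrip 0 1).mem_nhds (hball (hb2 hω)))
    have key := hasDerivAt_integral_of_dominated_loc_of_deriv_le (μ := μ) (F := κ)
      (F' := fun ω w => deriv (fun ω => κ ω w) ω) (x₀ := ζ) (s := Metric.ball ζ (ε / 2))
      (bound := fun _ => B / (ε / 2))
      (Metric.ball_mem_nhds _ (by positivity))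
      (by
        filter_upwards [Metric.ball_mem_nhds ζ hε] with ω hω
        exact hmeas ω (hsub (hball hω)))
      (by
        refine Integrable.of_bound (hmeas ζ (hsub hζ)) B ?_
        filter_upwards [hbd] with w hw using hw ζ (hsub hζ))
      (aestronglyMeasurable_deriv_param hε (fun ω hω => hmeas ω (hsub (hball hω)))
        (by filter_upwards [hdiffAt] with w hw using hw ζ (Metric.mem_ball_self (by positivity))))
      (by
        filter_upwards [hbd, hdiff] with w hw hwd ω hω
        have hin : Metric.closedBall ω (ε / 2) ⊆ verticalStrip 0 1 := by
          intro x hx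
          refine hball ?_
          rw [Metric.mem_closedBall] at hx
          rw [Metric.mem_ball] at hω ⊢
          linarith [dist_triangle x ω ζ]
        refine Complex.norm_deriv_le_of_forall_mem_sphere_norm_le (by positivity) ?_ ?_
        · exact (hwd.mono hin).diffContOnCl_ball subset_rfl
        · exact fun x hx => hw x (hsub (hin (Metric.sphere_subset_closedBall hx))))
      (integrable_const _)
      (by filter_upwards [hdiffAt] with w hw ω hω using (hw ω hω).hasDerivAt)
    exact key.2.differentiableAt.differentiableWithinAt
  · rw [closure_verticalStrip]
    refine continuousOn_of_dominated (bound := fun _ => B) hmeas (fun ζ hζ => ?_)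
      (integrable_const _) hcont
    filter_upwards [hbd] with w hw using hw ζ hζ

/-- The three lines theorem for functions with values in `L^p` spaces, tested on a set where the
function is bounded above and below. -/
theorem eLpNorm_le_of_three_lines [IsFiniteMeasure μ] {p₀ p₁ p : ℝ≥0∞} (hp₀ : 1 ≤ p₀)
    (hp₁ : 1 ≤ p₁) (hpt : p ≠ ∞) (hp0 : p ≠ 0) {θ : ℝ} (hθ₀ : 0 < θ) (hθ₁ : θ < 1)
    (hp : (1 / p).toReal = (1 - θ) * (1 / p₀).toReal + θ * (1 / p₁).toReal)
    {k : ℂ → α → ℂ} {B L N : ℝ} (hL : 0 ≤ L) (hN : 1 ≤ N)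
    (hmeas : ∀ ζ ∈ verticalClosedStrip 0 1, AEStronglyMeasurable (k ζ) μ)
    (hbd : ∀ᵐ w ∂μ, ∀ ζ ∈ verticalClosedStrip 0 1, ‖k ζ w‖ ≤ B)
    (hcont : ∀ᵐ w ∂μ, ContinuousOn (fun ζ => k ζ w) (verticalClosedStrip 0 1))
    (hdiff : ∀ᵐ w ∂μ, DifferentiableOn ℂ (fun ζ => k ζ w) (verticalStrip 0 1))
    (hleft : ∀ t : ℝ, eLpNorm (k (t * I)) p₀ μ ≤ ENNReal.ofReal L)
    (hright : ∀ t : ℝ, eLpNorm (k (1 + t * I)) p₁ μ ≤ ENNReal.ofReal L)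
    (hlow : ∀ᵐ w ∂μ, N⁻¹ ≤ ‖k θ w‖ ∧ ‖k θ w‖ ≤ N) :
    eLpNorm (k θ) p μ ≤ ENNReal.ofReal L := by
  set r₀ := (1 / p₀).toReal with hr₀
  set r₁ := (1 / p₁).toReal with hr₁
  set P := p.toReal with hP
  have hP0 : 0 < P := ENNReal.toReal_pos hp0 hpt
  have hr : (1 / p).toReal = 1 / P := by rw [one_div, ENNReal.toReal_inv, one_div]
  rw [hr] at hp
  have hinv : ∀ q : ℝ≥0∞, 1 ≤ q → 0 ≤ (1 / q).toReal ∧ (1 / q).toReal ≤ 1 := by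
    intro q hq
    refine ⟨ENNReal.toReal_nonneg, ?_⟩
    rw [← ENNReal.toReal_one]
    refine ENNReal.toReal_mono (by simp) ?_
    rw [one_div]
    exact ENNReal.inv_le_one.2 hq
  obtain ⟨hr₀0, hr₀1⟩ := hinv p₀ hp₀
  obtain ⟨hr₁0, hr₁1⟩ := hinv p₁ hp₁
  have hθmem : (θ : ℂ) ∈ verticalClosedStrip 0 1 := by
    simp [verticalClosedStrip, hθ₀.le, hθ₁.le]
  set h : α → ℂ := k θ with hh
  have hhm : AEStronglyMeasurable h μ := hmeas θ hθmem
  have hN0 : 0 < N := by linarith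
  set A := (∫⁻ w, ‖h w‖ₑ ^ P ∂μ).toReal with hA
  have hAt : ∫⁻ w, ‖h w‖ₑ ^ P ∂μ ≠ ∞ := by
    have : MemLp h p μ := MemLp.of_bound hhm N (by filter_upwards [hlow] with w hw using hw.2)
    exact ((eLpNorm_lt_top_iff_lintegral_rpow_enorm_lt_top hp0 hpt).1 this.2).ne
  have hAe : ∫⁻ w, ‖h w‖ₑ ^ P ∂μ = ENNReal.ofReal A := (ENNReal.ofReal_toReal hAt).symm
  have hA0 : 0 ≤ A := ENNReal.toReal_nonneg
  rw [eLpNorm_eq_lintegral_rpow_enorm_toReal hp0 hpt, hAe, ENNReal.ofReal_rpow_of_nonneg hA0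
    (by positivity)]
  apply ENNReal.ofReal_le_ofReal
  rcases hA0.eq_or_lt with hA00 | hApos
  · rw [← hA00, Real.zero_rpow (by positivity)]; exact hL
  -- An affine exponent with real part `P (1 - 1/p₀)` and `P (1 - 1/p₁)` on the two edges and value
  -- `P - 1` at `θ`.
  let e : ℂ → ℂ := fun ζ => P * (1 - (1 - ζ) * r₀ - ζ * r₁)
  have he_re : ∀ ζ, (e ζ).re = P * (1 - (1 - ζ.re) * r₀ - ζ.re * r₁) := by
    intro ζ; simp [e]
  -- The dual family: the conjugate phase of `h` times `|h|` to the power `e ζ`. At `θ` the pairing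
  -- with `h` is `∫ |h|^P`.
  let ψ : ℂ → α → ℂ := fun ζ w => conj (h w) / (‖h w‖ : ℂ) * cexp (e ζ * (Real.log ‖h w‖ : ℂ))
  have hψm : ∀ ζ, AEStronglyMeasurable (ψ ζ) μ := by
    intro ζ
    have h1 : AEMeasurable h μ := hhm.aemeasurable
    have h2 : Measurable fun x : ℂ => conj x / (‖x‖ : ℂ) * cexp (e ζ * (Real.log ‖x‖ : ℂ)) := by
      refine Measurable.mul (Measurable.div (Continuous.measurable (by fun_prop))
        (Continuous.measurable (by fun_prop))) ?_
      fun_prop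
    exact (h2.comp_aemeasurable h1).aestronglyMeasurable
  have hψn : ∀ ζ w, h w ≠ 0 → ‖ψ ζ w‖ = ‖h w‖ ^ (e ζ).re := by
    intro ζ w hw
    have hn : ‖h w‖ ≠ 0 := norm_ne_zero_iff.2 hw
    simp only [ψ]
    rw [norm_mul, norm_div, RCLike.norm_conj, Complex.norm_real, Real.norm_of_nonneg (norm_nonneg _),
      div_self hn, one_mul, Complex.norm_exp, re_mul_ofReal,
      Real.rpow_def_of_pos (norm_pos_iff.2 hw), mul_comm]
  have hne : ∀ᵐ w ∂μ, h w ≠ 0 := by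
    filter_upwards [hlow] with w hw
    rw [← norm_pos_iff]
    exact lt_of_lt_of_le (by positivity) hw.1
  have he_mem : ∀ ζ ∈ verticalClosedStrip 0 1, 0 ≤ (e ζ).re ∧ (e ζ).re ≤ P := by
    intro ζ hζ
    rw [verticalClosedStrip, Set.mem_preimage, Set.mem_Icc] at hζ
    rw [he_re]
    have h1 : 0 ≤ (1 - ζ.re) * r₀ := mul_nonneg (by linarith [hζ.2]) hr₀0
    have h2 : 0 ≤ ζ.re * r₁ := mul_nonneg hζ.1 hr₁0
    have h3 : (1 - ζ.re) * r₀ ≤ (1 - ζ.re) * 1 := mul_le_mul_of_nonneg_left hr₀1 (by linarith [hζ.2])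
    have h4 : ζ.re * r₁ ≤ ζ.re * 1 := mul_le_mul_of_nonneg_left hr₁1 hζ.1
    constructor
    · apply mul_nonneg hP0.le; linarith
    · exact mul_le_of_le_one_right hP0.le (by linarith)
  have hψb : ∀ᵐ w ∂μ, ∀ ζ ∈ verticalClosedStrip 0 1, ‖ψ ζ w‖ ≤ N ^ P := by
    filter_upwards [hlow, hne] with w hw hw0 ζ hζ
    rw [hψn ζ w hw0]
    calc ‖h w‖ ^ (e ζ).re ≤ N ^ (e ζ).re :=
          Real.rpow_le_rpow (norm_nonneg _) hw.2 (he_mem ζ hζ).1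
      _ ≤ N ^ P := Real.rpow_le_rpow_of_exponent_le hN (he_mem ζ hζ).2
  have hψd : ∀ w, Differentiable ℂ fun ζ => ψ ζ w := by
    intro w ζ; simp only [ψ, e]; fun_prop
  let G : ℂ → ℂ := fun ζ => ∫ w, k ζ w * ψ ζ w ∂μ
  have hκb : ∀ᵐ w ∂μ, ∀ ζ ∈ verticalClosedStrip 0 1, ‖k ζ w * ψ ζ w‖ ≤ B * N ^ P := by
    filter_upwards [hbd, hψb] with w h1 h2 ζ hζ
    rw [norm_mul]
    have := (norm_nonneg _).trans (h1 ζ hζ)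
    gcongr
    · exact h1 ζ hζ
    · exact h2 ζ hζ
  have hG : DiffContOnCl ℂ G (verticalStrip 0 1) := by
    refine diffContOnCl_integral (B := B * N ^ P) (fun ζ hζ => (hmeas ζ hζ).mul (hψm ζ)) hκb ?_ ?_
    · filter_upwards [hcont] with w hw
      exact hw.mul (hψd w).continuous.continuousOn
    · filter_upwards [hdiff] with w hw
      exact hw.mul (hψd w).differentiableOn
  have hGb : BddAbove ((norm ∘ G) '' verticalClosedStrip 0 1) := by
    refine ⟨B * N ^ P * μ.real Set.univ, ?_⟩
    rintro _ ⟨ζ, hζ, rfl⟩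
    refine norm_integral_le_of_norm_le_const ?_
    filter_upwards [hκb] with w hw using hw ζ hζ
  have hedge : ∀ (q : ℝ≥0∞) (_ : 1 ≤ q) (ζ : ℂ) (_ : AEStronglyMeasurable (k ζ) μ)
      (_ : eLpNorm (k ζ) q μ ≤ ENNReal.ofReal L) (_ : (e ζ).re = P * (1 - (1 / q).toReal)),
      ‖G ζ‖ ≤ L * A ^ (1 - (1 / q).toReal) := by
    intro q hq ζ hm hk he
    have hq1 := hinv q hq
    rw [← ENNReal.ofReal_le_ofReal_iff (by positivity), ofReal_norm]
    refine (enorm_integral_le_lintegral_enorm _).trans ?_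
    rw [ENNReal.ofReal_mul hL, ← ENNReal.ofReal_rpow_of_nonneg hA0 (by linarith), ← hAe]
    refine le_trans (le_of_eq ?_) ((lintegral_mul_rpow_le_eLpNorm hq hm
      (hhm.enorm.pow_const P)).trans (mul_le_mul_left hk _))
    refine lintegral_congr_ae ?_
    filter_upwards [hne] with w hw
    rw [enorm_mul, ← ofReal_norm (ψ ζ w), hψn ζ w hw, he, ← ENNReal.rpow_mul, ← ofReal_norm (h w),
      ENNReal.ofReal_rpow_of_pos (norm_pos_iff.2 hw)]
  have hGθ : G θ = (A : ℂ) := by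
    have h1 : ∀ᵐ w ∂μ, k θ w * ψ θ w = ((‖h w‖ ^ P : ℝ) : ℂ) := by
      filter_upwards [hne] with w hw
      have hn : ‖h w‖ ≠ 0 := norm_ne_zero_iff.2 hw
      have hn' : (‖h w‖ : ℂ) ≠ 0 := by exact_mod_cast hn
      have heθ : e θ = ((P - 1 : ℝ) : ℂ) := by
        simp only [e]
        have h3 : P * (1 - (1 - θ) * r₀ - θ * r₁) = P - 1 := by
          have : P * (1 / P) = 1 := by field_simp
          rw [hp] at this; linarith
        exact_mod_cast h3
      simp only [ψ, heθ]
      have h4 : cexp (((P - 1 : ℝ) : ℂ) * (Real.log ‖h w‖ : ℂ)) = ((‖h w‖ ^ (P - 1) : ℝ) : ℂ) := by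
        rw [Real.rpow_def_of_pos (norm_pos_iff.2 hw)]; push_cast; rw [mul_comm]
      have h5 : h w * conj (h w) = (‖h w‖ : ℂ) * (‖h w‖ : ℂ) := by
        rw [Complex.mul_conj, Complex.normSq_eq_norm_sq]; push_cast; ring
      rw [h4, ← hh, ← mul_assoc, ← mul_div_assoc, h5, mul_div_assoc, div_self hn', mul_one,
        ← Complex.ofReal_mul]
      congr 1
      rw [Real.rpow_sub_one hn]; field_simp
    simp only [G]
    rw [integral_congr_ae h1, integral_complex_ofReal]
    congr 1
    rw [integral_eq_lintegral_of_nonneg_ae (Eventually.of_forall fun w => by positivity)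
      (by
        have := hhm.norm.aemeasurable
        exact (this.pow_const P).aestronglyMeasurable), hA]
    congr 1
    refine lintegral_congr fun w => ?_
    rw [← ofReal_norm, ENNReal.ofReal_rpow_of_nonneg (norm_nonneg _) hP0.le]
  have h3 := norm_le_interp_of_mem_verticalClosedStrip₀₁' G hθmem hG hGb
    (a := L * A ^ (1 - r₀)) (b := L * A ^ (1 - r₁))
    (by
      intro ζ hζ
      have hζ' : ζ = (ζ.im : ℂ) * I := by
        apply Complex.ext <;> simp [show ζ.re = 0 from hζ]
      rw [hζ']
      refine hedge p₀ hp₀ _ (hmeas _ ?_) (hleft _) ?_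
      · simp [verticalClosedStrip]
      · rw [he_re]; simp [hr₀])
    (by
      intro ζ hζ
      have hζ' : ζ = 1 + (ζ.im : ℂ) * I := by
        apply Complex.ext <;> simp [show ζ.re = 1 from hζ]
      rw [hζ']
      refine hedge p₁ hp₁ _ (hmeas _ ?_) (hright _) ?_
      · simp [verticalClosedStrip]
      · rw [he_re]; simp [hr₁])
  rw [hGθ, Complex.norm_real, Real.norm_of_nonneg hA0, ofReal_re,
    Real.mul_rpow hL (by positivity), Real.mul_rpow hL (by positivity),
    ← Real.rpow_mul hA0, ← Real.rpow_mul hA0] at h3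
  have h4 : L ^ (1 - θ) * A ^ ((1 - r₀) * (1 - θ)) * (L ^ θ * A ^ ((1 - r₁) * θ)) =
      L * A ^ (1 - 1 / P) := by
    have hl : L ^ (1 - θ) * L ^ θ = L := by
      rw [← Real.rpow_add_of_nonneg hL (by linarith) hθ₀.le]; simp
    have ha : A ^ ((1 - r₀) * (1 - θ)) * A ^ ((1 - r₁) * θ) = A ^ (1 - 1 / P) := by
      rw [← Real.rpow_add hApos, hp]; congr 1; ring
    rw [← ha]; nth_rewrite 3 [← hl]; ring
  rw [h4] at h3
  -- The three lines bound reads `A ≤ L A^{1 - 1/P}`; since `A > 0`, dividing gives `A^{1/P} ≤ L`.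
  have h5 : A = A ^ (1 / P) * A ^ (1 - 1 / P) := by
    rw [← Real.rpow_add hApos]; simp
  have h6 : A ^ (1 / P) * A ^ (1 - 1 / P) ≤ L * A ^ (1 - 1 / P) := by rw [← h5]; exact h3
  exact le_of_mul_le_mul_right h6 (by positivity)

end

/-! ### Norm comparison and point evaluations -/

/-- The norm of `z ^ m * f z * exp (-|z|² / 2)` in `L^q`, without a normalizing constant. -/
noncomputable def powENorm (q : ℝ≥0∞) (m : ℕ) (f : ℂ → ℂ) : ℝ≥0∞ :=
  eLpNorm (fun z : ℂ => z ^ m * f z * (Real.exp (-‖z‖ ^ 2 / 2) : ℂ)) q volume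

theorem fockSobolevConst_pos {p : ℝ} (hp : 0 < p) (m : ℕ) : 0 < fockSobolevConst p m := by
  have : 0 < Real.Gamma (m * p / 2 + 1) := Real.Gamma_pos_of_pos (by positivity)
  unfold fockSobolevConst
  positivity

/-- For entire functions the two sides differ by the normalizing constant only. Outside the space
both are infinite, by the weighted characterization; this is where `c ≠ 0` matters. -/
theorem exists_fockSobolevENorm_eq {q : ℝ≥0∞} (hq : 1 ≤ q) (m : ℕ) :
    ∃ c : ℝ≥0, c ≠ 0 ∧ ∀ f : ℂ → ℂ, Differentiable ℂ f →
      fockSobolevENorm q m f = c * powENorm q m f := by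
  have hq0 : q ≠ 0 := (zero_lt_one.trans_le hq).ne'
  have key : ∃ c : ℝ≥0, c ≠ 0 ∧ ∀ f : ℂ → ℂ, Differentiable ℂ f →
      weightedENorm q m f = c * powENorm q m f := by
    rcases eq_or_ne q ∞ with rfl | ht
    · refine ⟨1, one_ne_zero, fun f hf => ?_⟩
      rw [weightedENorm, if_pos rfl, ENNReal.coe_one, one_mul, powENorm]
      apply le_antisymm
      · exact iSup_le fun z => enorm_le_eLpNorm_top_of_continuous (continuous_pow_mul hf m) z
      · rw [eLpNorm_exponent_top]
        refine eLpNormEssSup_le_of_ae_enorm_bound (Eventually.of_forall fun z => ?_)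
        exact le_iSup (fun z : ℂ => ‖z ^ m * f z * (Real.exp (-‖z‖ ^ 2 / 2) : ℂ)‖ₑ) z
    · have hP : 0 < q.toReal := ENNReal.toReal_pos hq0 ht
      have hc := fockSobolevConst_pos hP m
      refine ⟨(Real.toNNReal (fockSobolevConst q.toReal m)) ^ (1 / q.toReal), ?_, fun f _ => ?_⟩
      · have : 0 < Real.toNNReal (fockSobolevConst q.toReal m) := Real.toNNReal_pos.2 hc
        exact (NNReal.rpow_pos this).ne'
      · rw [weightedENorm, if_neg ht, powENorm, eLpNorm_eq_lintegral_rpow_enorm_toReal hq0 ht,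
          ENNReal.mul_rpow_of_nonneg _ _ (by positivity), ENNReal.ofReal,
          ENNReal.coe_rpow_of_nonneg _ (by positivity)]
  obtain ⟨c, hc, h⟩ := key
  refine ⟨c, hc, fun f hf => ?_⟩
  rw [fockSobolevENorm]
  split_ifs with hmem
  · exact h f hf
  · rw [mem_fockSobolevSpace_iff hq] at hmem
    have : powENorm q m f = ∞ := by
      by_contra hne
      exact hmem ⟨hf, (continuous_pow_mul hf m).aestronglyMeasurable, lt_top_iff_ne_top.2 hne⟩
    rw [this, ENNReal.mul_top (by exact_mod_cast hc)]

theorem mem_of_fockSobolevENorm_ne_top {q : ℝ≥0∞} {m : ℕ} {f : ℂ → ℂ}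
    (h : fockSobolevENorm q m f ≠ ∞) : f ∈ FockSobolevSpace q m := by
  by_contra hf
  exact h (if_neg hf)

theorem exists_enorm_le_fockSobolevENorm {q : ℝ≥0∞} (hq : 1 ≤ q) (m : ℕ) (R : ℝ) :
    ∃ C : ℝ≥0, C ≠ 0 ∧ ∀ f : ℂ → ℂ, ∀ z : ℂ, ‖z‖ ≤ R → ‖f z‖ₑ ≤ C * fockSobolevENorm q m f := by
  obtain ⟨c, hc0, hc⟩ := exists_fockSobolevENorm_eq hq m
  obtain ⟨C, hC⟩ := exists_enorm_le_eLpNorm_pow_mul hq m R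
  refine ⟨C * c⁻¹ + 1, by positivity, fun f z hz => ?_⟩
  by_cases hf : f ∈ FockSobolevSpace q m
  · refine (hC f hf.1 z hz).trans ?_
    rw [hc f hf.1, ← mul_assoc]
    have : (C : ℝ≥0∞) ≤ ((C * c⁻¹ + 1) * c : ℝ≥0) := by
      rw [add_mul, mul_assoc, inv_mul_cancel₀ hc0]
      exact_mod_cast (by simp)
    rw [← ENNReal.coe_mul]
    gcongr
    rfl
  · rw [fockSobolevENorm, if_neg hf, ENNReal.mul_top]
    · exact le_top
    · exact_mod_cast (by positivity : C * c⁻¹ + 1 ≠ 0)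

section

variable {p₀ p₁ : ℝ≥0∞} {m : ℕ}

theorem differentiable_of_sumENorm_lt_top {v : ℂ → ℂ}
    (h : sumENorm (fockSobolevENorm p₀ m) (fockSobolevENorm p₁ m) v < ∞) :
    Differentiable ℂ v := by
  simp only [sumENorm, iInf_lt_iff] at h
  obtain ⟨a, b, rfl, hab⟩ := h
  have ha := mem_of_fockSobolevENorm_ne_top (ENNReal.add_lt_top.1 hab).1.ne
  have hb := mem_of_fockSobolevENorm_ne_top (ENNReal.add_lt_top.1 hab).2.ne
  exact ha.1.add hb.1

/-- Bounded evaluations on the sum space make the norm continuity and holomorphy of a Calderón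
function imply those of each scalar function `ζ ↦ F ζ w`. -/
theorem exists_enorm_le_sumENorm (hp₀ : 1 ≤ p₀) (hp₁ : 1 ≤ p₁) (R : ℝ) :
    ∃ C : ℝ≥0, ∀ v : ℂ → ℂ, ∀ z : ℂ, ‖z‖ ≤ R →
      ‖v z‖ₑ ≤ C * sumENorm (fockSobolevENorm p₀ m) (fockSobolevENorm p₁ m) v := by
  obtain ⟨C₀, -, h₀⟩ := exists_enorm_le_fockSobolevENorm hp₀ m R
  obtain ⟨C₁, -, h₁⟩ := exists_enorm_le_fockSobolevENorm hp₁ m R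
  -- A non-zero finite constant can be moved inside the infima.
  refine ⟨max C₀ C₁ + 1, fun v z hz => ?_⟩
  have hpos : max C₀ C₁ + 1 ≠ 0 := by positivity
  simp only [sumENorm]
  rw [ENNReal.mul_iInf_of_ne (by exact_mod_cast hpos) (by simp)]
  refine le_iInf fun a => ?_
  rw [ENNReal.mul_iInf_of_ne (by exact_mod_cast hpos) (by simp)]
  refine le_iInf fun b => ?_
  rw [ENNReal.mul_iInf_of_ne (by exact_mod_cast hpos) (by simp)]
  refine le_iInf fun hab => ?_
  rw [← hab, Pi.add_apply, mul_add]
  refine (enorm_add_le _ _).trans (add_le_add ((h₀ a z hz).trans ?_) ((h₁ b z hz).trans ?_))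
  · gcongr; exact (le_max_left _ _).trans le_self_add
  · gcongr; exact (le_max_right _ _).trans le_self_add

theorem sumENorm_add_le {V : Type*} [AddCommGroup V] {N₀ N₁ : V → ℝ≥0∞} (a b : V) :
    sumENorm N₀ N₁ (a + b) ≤ N₀ a + N₁ b :=
  iInf_le_of_le a (iInf_le_of_le b (iInf_le _ rfl))

theorem IsCalderonFunction.continuousOn_apply (hp₀ : 1 ≤ p₀) (hp₁ : 1 ≤ p₁) {F : ℂ → ℂ → ℂ}
    (hF : IsCalderonFunction (fockSobolevENorm p₀ m) (fockSobolevENorm p₁ m) F) (w : ℂ) :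
    ContinuousOn (fun ζ => F ζ w) (verticalClosedStrip 0 1) := by
  obtain ⟨C, hC⟩ := exists_enorm_le_sumENorm (m := m) hp₀ hp₁ ‖w‖
  intro ζ hζ
  have h1 := ENNReal.Tendsto.const_mul (a := (C : ℝ≥0∞)) (hF.continuous ζ hζ) (by simp)
  rw [mul_zero] at h1
  have h2 : Tendsto (fun ω => ‖F ω w - F ζ w‖ₑ) (𝓝[verticalClosedStrip 0 1] ζ) (𝓝 0) :=
    tendsto_of_tendsto_of_tendsto_of_le_of_le tendsto_const_nhds h1 (fun _ => zero_le)
      (fun ω => hC (F ω - F ζ) w le_rfl)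
  rw [ContinuousWithinAt, tendsto_iff_edist_tendsto_0]
  simpa only [edist_eq_enorm_sub] using h2

theorem IsCalderonFunction.differentiableOn_apply (hp₀ : 1 ≤ p₀) (hp₁ : 1 ≤ p₁) {F : ℂ → ℂ → ℂ}
    (hF : IsCalderonFunction (fockSobolevENorm p₀ m) (fockSobolevENorm p₁ m) F) (w : ℂ) :
    DifferentiableOn ℂ (fun ζ => F ζ w) (verticalStrip 0 1) := by
  obtain ⟨C, hC⟩ := exists_enorm_le_sumENorm (m := m) hp₀ hp₁ ‖w‖
  intro ζ hζ
  obtain ⟨D, -, hD⟩ := hF.holomorphic ζ hζ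
  have h1 := ENNReal.Tendsto.const_mul (a := (C : ℝ≥0∞)) hD (by simp)
  rw [mul_zero] at h1
  have h2 : Tendsto (fun ω => ‖(ω - ζ)⁻¹ * (F ω w - F ζ w) - D w‖ₑ) (𝓝[≠] ζ) (𝓝 0) :=
    tendsto_of_tendsto_of_tendsto_of_le_of_le tendsto_const_nhds h1 (fun _ => zero_le)
      (fun ω => hC ((ω - ζ)⁻¹ • (F ω - F ζ) - D) w le_rfl)
  have h3 : HasDerivAt (fun ζ => F ζ w) (D w) ζ := by
    rw [hasDerivAt_iff_tendsto_slope, tendsto_iff_edist_tendsto_0]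
    simpa only [edist_eq_enorm_sub, slope, vsub_eq_sub, smul_eq_mul] using h2
  exact h3.differentiableAt.differentiableWithinAt

/-! ### From the interpolation space to the Fock–Sobolev space -/

/-- The sets increase and exhaust the points where `h ≠ 0`, so monotone convergence recovers the
full norm. -/
theorem eLpNorm_le_of_forall_setLIntegral {h : ℂ → ℂ} (hh : Continuous h) {p : ℝ≥0∞}
    (hp0 : p ≠ 0) (hpt : p ≠ ∞) {L : ℝ≥0∞}
    (hL : ∀ n : ℕ, eLpNorm h p (volume.restrict
      {w : ℂ | ‖w‖ ≤ n + 1 ∧ (n + 1 : ℝ)⁻¹ ≤ ‖h w‖ ∧ ‖h w‖ ≤ n + 1}) ≤ L) :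
    eLpNorm h p volume ≤ L := by
  set K : ℕ → Set ℂ := fun n => {w : ℂ | ‖w‖ ≤ n + 1 ∧ (n + 1 : ℝ)⁻¹ ≤ ‖h w‖ ∧ ‖h w‖ ≤ n + 1}
  have hP : 0 < p.toReal := ENNReal.toReal_pos hp0 hpt
  have hmono : Monotone K := by
    intro i j hij w hw
    have hij' : (i : ℝ) ≤ j := by exact_mod_cast hij
    refine ⟨hw.1.trans (by linarith), le_trans ?_ hw.2.1, hw.2.2.trans (by linarith)⟩
    gcongr
  have hun : ∀ w, w ∉ ⋃ n, K n → h w = 0 := by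
    intro w hw
    by_contra h0
    have hpos := norm_pos_iff.2 h0
    obtain ⟨n, hn⟩ := exists_nat_ge (max ‖w‖ (max ‖h w‖⁻¹ ‖h w‖))
    have h1 := (le_max_left _ _).trans hn
    have h2 := ((le_max_left _ _).trans (le_max_right _ _)).trans hn
    have h3 := ((le_max_right _ _).trans (le_max_right _ _)).trans hn
    apply hw
    refine Set.mem_iUnion.2 ⟨n, by linarith, ?_, by linarith⟩
    rw [inv_le_comm₀ (by positivity) hpos]; linarith
  have hKm : ∀ n, MeasurableSet (K n) := by
    intro n
    refine (isClosed_le continuous_norm continuous_const).measurableSet.inter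
      ((isClosed_le continuous_const hh.norm).measurableSet.inter
        (isClosed_le hh.norm continuous_const).measurableSet)
  have hint : ∫⁻ w, ‖h w‖ₑ ^ p.toReal = ⨆ n, ∫⁻ w in K n, ‖h w‖ₑ ^ p.toReal := by
    rw [← setLIntegral_iUnion_of_directed _ hmono.directed_le,
      ← lintegral_indicator (MeasurableSet.iUnion hKm)]
    refine lintegral_congr fun w => ?_
    by_cases hw : w ∈ ⋃ n, K n
    · rw [Set.indicator_of_mem hw]
    · rw [Set.indicator_of_notMem hw, hun w hw]; simp [hP]
  rw [eLpNorm_eq_lintegral_rpow_enorm_toReal hp0 hpt, ← ENNReal.rpow_le_rpow_iff hP,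
    ← ENNReal.rpow_mul, one_div, inv_mul_cancel₀ hP.ne', ENNReal.rpow_one, hint]
  refine iSup_le fun n => ?_
  have := hL n
  rw [eLpNorm_eq_lintegral_rpow_enorm_toReal hp0 hpt, ← ENNReal.rpow_le_rpow_iff hP,
    ← ENNReal.rpow_mul, one_div, inv_mul_cancel₀ hP.ne', ENNReal.rpow_one] at this
  exact this

/-- On each set of the exhaustion the measure is finite, the family is bounded through point
evaluations, and its value at `θ` is bounded away from zero, so the three lines bound applies. Its
constant does not depend on the set. -/
theorem exists_powENorm_le_calderonENorm (hp₀ : 1 ≤ p₀) (hp₁ : 1 ≤ p₁) {p : ℝ≥0∞} (hpt : p ≠ ∞)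
    (hp0 : p ≠ 0) {θ : ℝ} (hθ₀ : 0 < θ) (hθ₁ : θ < 1)
    (hp : (1 / p).toReal = (1 - θ) * (1 / p₀).toReal + θ * (1 / p₁).toReal) :
    ∃ C : ℝ≥0, ∀ F : ℂ → ℂ → ℂ,
      IsCalderonFunction (fockSobolevENorm p₀ m) (fockSobolevENorm p₁ m) F →
      Differentiable ℂ (F θ) ∧
      calderonENorm (fockSobolevENorm p₀ m) (fockSobolevENorm p₁ m) F < ∞ ∧
      powENorm p m (F θ) ≤
        C * calderonENorm (fockSobolevENorm p₀ m) (fockSobolevENorm p₁ m) F := by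
  obtain ⟨c₀, hc₀, h₀⟩ := exists_fockSobolevENorm_eq hp₀ m
  obtain ⟨c₁, hc₁, h₁⟩ := exists_fockSobolevENorm_eq hp₁ m
  refine ⟨max c₀⁻¹ c₁⁻¹, fun F hF => ?_⟩
  set Λ := calderonENorm (fockSobolevENorm p₀ m) (fockSobolevENorm p₁ m) F with hΛ
  have hΛt : Λ < ∞ := by
    obtain ⟨C₀, hC₀⟩ := hF.bounded_left
    obtain ⟨C₁, hC₁⟩ := hF.bounded_right
    exact max_lt ((iSup_le hC₀).trans_lt (by simp)) ((iSup_le hC₁).trans_lt (by simp))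
  obtain ⟨S, hS⟩ := hF.bounded
  have hd : ∀ ζ ∈ verticalClosedStrip 0 1, Differentiable ℂ (F ζ) := fun ζ hζ =>
    differentiable_of_sumENorm_lt_top ((hS ζ hζ).trans_lt (by simp))
  have hθmem : (θ : ℂ) ∈ verticalClosedStrip 0 1 := by
    simp [verticalClosedStrip, hθ₀.le, hθ₁.le]
  refine ⟨hd θ hθmem, hΛt, ?_⟩
  set L : ℝ := (((max c₀⁻¹ c₁⁻¹ : ℝ≥0) : ℝ≥0∞) * Λ).toReal
  have hLe : ((max c₀⁻¹ c₁⁻¹ : ℝ≥0) : ℝ≥0∞) * Λ = ENNReal.ofReal L :=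
    (ENNReal.ofReal_toReal (ENNReal.mul_ne_top (by simp) hΛt.ne)).symm
  rw [hLe]
  have hinv : ∀ c : ℝ≥0, c ≠ 0 → ∀ x : ℝ≥0∞, x = (c⁻¹ : ℝ≥0) * (c * x) := by
    intro c hc x
    rw [← mul_assoc, ← ENNReal.coe_mul, inv_mul_cancel₀ hc, ENNReal.coe_one, one_mul]
  have hl : ∀ t : ℝ, powENorm p₀ m (F (t * I)) ≤ ENNReal.ofReal L := by
    intro t
    have ht : (t : ℂ) * I ∈ verticalClosedStrip 0 1 := by simp [verticalClosedStrip]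
    rw [← hLe, hinv c₀ hc₀ (powENorm p₀ m _), ← h₀ _ (hd _ ht)]
    gcongr
    · exact le_max_left _ _
    · exact (le_iSup (fun t : ℝ => fockSobolevENorm p₀ m (F (t * I))) t).trans (le_max_left _ _)
  have hr : ∀ t : ℝ, powENorm p₁ m (F (1 + t * I)) ≤ ENNReal.ofReal L := by
    intro t
    have ht : 1 + (t : ℂ) * I ∈ verticalClosedStrip 0 1 := by simp [verticalClosedStrip]
    rw [← hLe, hinv c₁ hc₁ (powENorm p₁ m _), ← h₁ _ (hd _ ht)]
    gcongr
    · exact le_max_right _ _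
    · exact (le_iSup (fun t : ℝ => fockSobolevENorm p₁ m (F (1 + t * I))) t).trans
        (le_max_right _ _)
  refine eLpNorm_le_of_forall_setLIntegral (continuous_pow_mul (hd θ hθmem) m) hp0 hpt fun n => ?_
  set h : ℂ → ℂ := fun z : ℂ => z ^ m * F θ z * (Real.exp (-‖z‖ ^ 2 / 2) : ℂ)
  have hhc : Continuous h := continuous_pow_mul (hd θ hθmem) m
  set K := {w : ℂ | ‖w‖ ≤ n + 1 ∧ (n + 1 : ℝ)⁻¹ ≤ ‖h w‖ ∧ ‖h w‖ ≤ n + 1} with hK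
  have hKm : MeasurableSet K :=
    (isClosed_le continuous_norm continuous_const).measurableSet.inter
      ((isClosed_le continuous_const hhc.norm).measurableSet.inter
        (isClosed_le hhc.norm continuous_const).measurableSet)
  have hfin : IsFiniteMeasure (volume.restrict K) := by
    refine ⟨?_⟩
    rw [Measure.restrict_apply_univ]
    refine (measure_mono (t := Metric.closedBall 0 (n + 1)) fun w hw => ?_).trans_lt
      measure_closedBall_lt_top
    rw [mem_closedBall_zero_iff]; exact hw.1
  obtain ⟨C, hC⟩ := exists_enorm_le_sumENorm (m := m) hp₀ hp₁ (n + 1)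
  refine eLpNorm_le_of_three_lines (μ := volume.restrict K)
    (k := fun ζ z => z ^ m * F ζ z * (Real.exp (-‖z‖ ^ 2 / 2) : ℂ))
    (B := (n + 1) ^ m * (C * S)) (N := n + 1) hp₀ hp₁ hpt hp0 hθ₀ hθ₁ hp ENNReal.toReal_nonneg
    (by simp) (fun ζ hζ => (continuous_pow_mul (hd ζ hζ) m).aestronglyMeasurable) ?_ ?_ ?_ ?_ ?_ ?_
  · refine (ae_restrict_iff' hKm).2 (Eventually.of_forall fun w hw ζ hζ => ?_)
    have h1 : ‖F ζ w‖ ≤ C * S := by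
      have := (hC (F ζ) w hw.1).trans (mul_le_mul_right (hS ζ hζ) _)
      have := ENNReal.toReal_mono (by finiteness) this
      simpa using this
    have h2 : Real.exp (-‖w‖ ^ 2 / 2) ≤ 1 := Real.exp_le_one_iff.2 (by nlinarith [norm_nonneg w])
    rw [norm_mul, norm_mul, norm_pow, Complex.norm_real, Real.norm_of_nonneg (Real.exp_nonneg _)]
    calc ‖w‖ ^ m * ‖F ζ w‖ * Real.exp (-‖w‖ ^ 2 / 2)
        ≤ (n + 1) ^ m * (C * S) * 1 := by gcongr; exact hw.1
      _ = _ := mul_one _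
  · refine Eventually.of_forall fun w => ?_
    exact (continuousOn_const.mul (hF.continuousOn_apply hp₀ hp₁ w)).mul continuousOn_const
  · refine Eventually.of_forall fun w => ?_
    exact ((hF.differentiableOn_apply hp₀ hp₁ w).const_mul _).mul_const _
  · exact fun t => (eLpNorm_mono_measure _ Measure.restrict_le_self).trans (hl t)
  · exact fun t => (eLpNorm_mono_measure _ Measure.restrict_le_self).trans (hr t)
  · exact (ae_restrict_iff' hKm).2 (Eventually.of_forall fun w hw => hw.2)

end

/-! ### The projection onto the Fock–Sobolev space -/

/-- The projection of `L^q` onto the weighted Fock space, for functions `Ψ` of the form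
`(1 + |w|) ^ m * f w * exp (-|w|² / 2)`. -/
noncomputable def fockProj (m : ℕ) (Ψ : ℂ → ℂ) : ℂ → ℂ :=
  fockTransform fun w => (((1 + ‖w‖) ^ m : ℝ) : ℂ)⁻¹ * Ψ w

/-- Absolute convergence of the integrals that define `fockProj m Ψ`. -/
def FockProjIntegrable (m : ℕ) (Ψ : ℂ → ℂ) : Prop :=
  FockIntegrable fun w => (((1 + ‖w‖) ^ m : ℝ) : ℂ)⁻¹ * Ψ w

theorem MeasureTheory.MemLp.inv_one_add_pow_mul {Ψ : ℂ → ℂ} {q : ℝ≥0∞} (hΨ : MemLp Ψ q volume)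
    (m : ℕ) : MemLp (fun w => (((1 + ‖w‖) ^ m : ℝ) : ℂ)⁻¹ * Ψ w) q volume := by
  refine hΨ.mono (AEStronglyMeasurable.mul ?_ hΨ.1) (Eventually.of_forall fun w => ?_)
  · exact Measurable.aestronglyMeasurable (by fun_prop)
  · rw [norm_mul, norm_inv, Complex.norm_real, Real.norm_of_nonneg (by positivity)]
    refine mul_le_of_le_one_left (norm_nonneg _) (inv_le_one_of_one_le₀ ?_)
    exact one_le_pow₀ (by linarith [norm_nonneg w])

theorem MeasureTheory.MemLp.fockProjIntegrable {Ψ : ℂ → ℂ} {q : ℝ≥0∞} (hq : 1 ≤ q)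
    (hΨ : MemLp Ψ q volume) (m : ℕ) : FockProjIntegrable m Ψ :=
  (hΨ.inv_one_add_pow_mul m).fockIntegrable hq

section

variable {m : ℕ} {Φ Ψ : ℂ → ℂ}

theorem FockProjIntegrable.add (hΦ : FockProjIntegrable m Φ) (hΨ : FockProjIntegrable m Ψ) :
    FockProjIntegrable m (Φ + Ψ) := by
  have := FockIntegrable.add hΦ hΨ
  refine (congrArg FockIntegrable (funext fun w => ?_)).mp this
  simp only [Pi.add_apply, mul_add]

theorem FockProjIntegrable.sub (hΦ : FockProjIntegrable m Φ) (hΨ : FockProjIntegrable m Ψ) :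
    FockProjIntegrable m (Φ - Ψ) := by
  have := FockIntegrable.sub hΦ hΨ
  refine (congrArg FockIntegrable (funext fun w => ?_)).mp this
  simp only [Pi.sub_apply, mul_sub]

theorem FockProjIntegrable.const_smul (hΦ : FockProjIntegrable m Φ) (c : ℂ) :
    FockProjIntegrable m (c • Φ) := by
  have := FockIntegrable.const_smul hΦ c
  refine (congrArg FockIntegrable (funext fun w => ?_)).mp this
  simp only [Pi.smul_apply, smul_eq_mul]; ring

theorem fockProj_add (hΦ : FockProjIntegrable m Φ) (hΨ : FockProjIntegrable m Ψ) :
    fockProj m (Φ + Ψ) = fockProj m Φ + fockProj m Ψ := by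
  rw [fockProj, fockProj, fockProj, ← fockTransform_add hΦ hΨ]
  congr 1
  ext w; simp only [Pi.add_apply]; ring

theorem fockProj_sub (hΦ : FockProjIntegrable m Φ) (hΨ : FockProjIntegrable m Ψ) :
    fockProj m (Φ - Ψ) = fockProj m Φ - fockProj m Ψ := by
  rw [fockProj, fockProj, fockProj, ← fockTransform_sub hΦ hΨ]
  congr 1
  ext w; simp only [Pi.sub_apply]; ring

theorem fockProj_const_smul (c : ℂ) : fockProj m (c • Φ) = c • fockProj m Φ := by
  rw [fockProj, fockProj, ← fockTransform_const_smul]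
  congr 1
  ext w; simp only [Pi.smul_apply, smul_eq_mul]; ring

end

/-- Dividing by the weight and then applying the weighted transform bound restores the norm of `Ψ`;
the target weight obeys `|z|^m ≤ (1 + |z|)^m`. -/
theorem exists_fockSobolevENorm_fockProj_le {q : ℝ≥0∞} (hq : 1 ≤ q) (m : ℕ) :
    ∃ C : ℝ≥0, ∀ Ψ : ℂ → ℂ, MemLp Ψ q volume →
      fockSobolevENorm q m (fockProj m Ψ) ≤ C * eLpNorm Ψ q volume := by
  obtain ⟨c, -, hc⟩ := exists_fockSobolevENorm_eq hq m
  obtain ⟨C, hC⟩ := exists_eLpNorm_fockTransform_le m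
  refine ⟨c * C, fun Ψ hΨ => ?_⟩
  have h1 := hΨ.inv_one_add_pow_mul m
  have hd : Differentiable ℂ (fockProj m Ψ) := differentiable_fockTransform hq h1
  rw [hc _ hd, ENNReal.coe_mul, mul_assoc]
  gcongr
  have e : (fun w : ℂ => (((1 + ‖w‖) ^ m : ℝ) : ℂ) * ((((1 + ‖w‖) ^ m : ℝ) : ℂ)⁻¹ * Ψ w)) = Ψ := by
    ext w
    have : (((1 + ‖w‖) ^ m : ℝ) : ℂ) ≠ 0 := by
      rw [Complex.ofReal_ne_zero]; positivity
    rw [← mul_assoc, mul_inv_cancel₀ this, one_mul]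
  have h2 := hC q hq _ h1.1
  rw [e] at h2
  refine le_trans (eLpNorm_mono fun z => ?_) h2
  rw [norm_one_add_pow_mul_mul_exp, norm_mul, norm_mul, Complex.norm_real,
    Real.norm_of_nonneg (Real.exp_nonneg _), norm_pow]
  simp only [fockProj]
  gcongr
  linarith

theorem exists_sumENorm_fockProj_le {p₀ p₁ : ℝ≥0∞} (hp₀ : 1 ≤ p₀) (hp₁ : 1 ≤ p₁) (m : ℕ) :
    ∃ C : ℝ≥0, ∀ Φ Ψ : ℂ → ℂ, MemLp Φ p₀ volume → MemLp Ψ p₁ volume →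
      sumENorm (fockSobolevENorm p₀ m) (fockSobolevENorm p₁ m) (fockProj m (Φ + Ψ)) ≤
        C * (eLpNorm Φ p₀ volume + eLpNorm Ψ p₁ volume) := by
  obtain ⟨C₀, h₀⟩ := exists_fockSobolevENorm_fockProj_le hp₀ m
  obtain ⟨C₁, h₁⟩ := exists_fockSobolevENorm_fockProj_le hp₁ m
  refine ⟨max C₀ C₁, fun Φ Ψ hΦ hΨ => ?_⟩
  rw [fockProj_add (hΦ.fockProjIntegrable hp₀ m) (hΨ.fockProjIntegrable hp₁ m), mul_add]
  refine (sumENorm_add_le _ _).trans (add_le_add ((h₀ Φ hΦ).trans ?_) ((h₁ Ψ hΨ).trans ?_))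
  · gcongr; exact le_max_left _ _
  · gcongr; exact le_max_right _ _

theorem fockProj_eq_self {f : ℂ → ℂ} (hf : Differentiable ℂ f) {q : ℝ≥0∞} (hq : 1 ≤ q) {m : ℕ}
    (h : MemLp (fun z : ℂ => (((1 + ‖z‖) ^ m : ℝ) : ℂ) * f z * (Real.exp (-‖z‖ ^ 2 / 2) : ℂ)) q
      volume) :
    fockProj m (fun z : ℂ => (((1 + ‖z‖) ^ m : ℝ) : ℂ) * f z *
      (Real.exp (-‖z‖ ^ 2 / 2) : ℂ)) = f := by
  have h0 := memLp_one_add_pow_mul_mono hf (Nat.zero_le m) h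
  simp only [pow_zero, ofReal_one, one_mul] at h0
  conv_rhs => rw [← fockTransform_eq_self hf hq h0]
  rw [fockProj]
  congr 1
  ext w
  have : (((1 + ‖w‖) ^ m : ℝ) : ℂ) ≠ 0 := by
    rw [Complex.ofReal_ne_zero]; positivity
  rw [mul_assoc, ← mul_assoc, inv_mul_cancel₀ this, one_mul]

/-! ### A majorant with locally bounded logarithm -/

theorem exists_setLIntegral_norm_ge_le {ψ : ℂ → ℝ≥0∞} (hψ : Measurable ψ) (hfin : ∫⁻ w, ψ w ≠ ∞)
    {ε : ℝ≥0∞} (hε : ε ≠ 0) (R₀ : ℝ) :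
    ∃ R, R₀ ≤ R ∧ ∫⁻ w in {w : ℂ | R ≤ ‖w‖}, ψ w ≤ ε := by
  have hS : ∀ R : ℝ, MeasurableSet {w : ℂ | R ≤ ‖w‖} := fun R =>
    (isClosed_le continuous_const continuous_norm).measurableSet
  have h1 : Tendsto (fun n : ℕ => ∫⁻ w, {w : ℂ | (n : ℝ) ≤ ‖w‖}.indicator ψ w) atTop
      (𝓝 (∫⁻ _ : ℂ, 0)) := by
    refine tendsto_lintegral_of_dominated_convergence ψ (fun n => hψ.indicator (hS n))
      (fun n => Eventually.of_forall fun w => Set.indicator_le_self _ _ _) hfin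
      (Eventually.of_forall fun w => ?_)
    refine tendsto_const_nhds.congr' ?_
    obtain ⟨N, hN⟩ := exists_nat_gt ‖w‖
    filter_upwards [eventually_ge_atTop N] with n hn
    rw [Set.indicator_of_notMem]
    have : (N : ℝ) ≤ n := by exact_mod_cast hn
    simp only [Set.mem_ofPred_eq, not_le]; linarith
  rw [lintegral_zero] at h1
  have h2 := (ENNReal.tendsto_nhds_zero.1 h1) ε (pos_iff_ne_zero.2 hε)
  obtain ⟨N, hN⟩ := exists_nat_ge R₀
  obtain ⟨n, hn, hnN⟩ := (h2.and (eventually_ge_atTop N)).exists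
  refine ⟨n, hN.trans (by exact_mod_cast hnN), ?_⟩
  rwa [lintegral_indicator (hS n)] at hn

/-- An integrable function on the plane stays integrable after multiplication by a suitable locally
bounded weight that tends to infinity. -/
theorem exists_weight_tendsto_top {ψ : ℂ → ℝ≥0∞} (hψ : Measurable ψ) (hfin : ∫⁻ w, ψ w ≤ 1) :
    ∃ W : ℂ → ℝ, Measurable W ∧ (∀ w, 1 ≤ W w) ∧ ∫⁻ w, ψ w * ENNReal.ofReal (W w) ≤ 3 ∧
      (∀ R : ℝ, ∃ L : ℝ, ∀ w : ℂ, ‖w‖ ≤ R → W w ≤ L) ∧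
      ∀ A : ℝ, ∃ R : ℝ, ∀ w : ℂ, R ≤ ‖w‖ → A ≤ W w := by
  have hfin' : ∫⁻ w, ψ w ≠ ∞ := (hfin.trans_lt (by simp)).ne
  -- Tails of mass at most `4^{-n}` leave room for weights `2^n`, and `n ≤ R n` makes the weight
  -- locally a finite sum.
  choose R hRn hR using fun n : ℕ => exists_setLIntegral_norm_ge_le hψ hfin'
    (ε := (4⁻¹ : ℝ≥0∞) ^ n) (by simp) n
  have hS : ∀ n, MeasurableSet {w : ℂ | R n ≤ ‖w‖} := fun n =>
    (isClosed_le continuous_const continuous_norm).measurableSet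
  let U : ℂ → ℝ≥0∞ := fun w =>
    1 + ∑' n : ℕ, {w : ℂ | R n ≤ ‖w‖}.indicator (fun _ => (2 : ℝ≥0∞) ^ n) w
  have hUm : Measurable U := by
    have h : Measurable fun w : ℂ =>
        ∑' n : ℕ, {w : ℂ | R n ≤ ‖w‖}.indicator (fun _ => (2 : ℝ≥0∞) ^ n) w := by
      apply Measurable.tsum
      exact fun n => measurable_const.indicator (hS n)
    exact measurable_const.add h
  have hUb : ∀ (N : ℕ) (w : ℂ), ‖w‖ ≤ N → U w ≤ 1 + ∑ n ∈ Finset.range (N + 1), 2 ^ n := by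
    intro N w hw
    simp only [U]
    gcongr
    rw [tsum_eq_sum (s := Finset.range (N + 1))]
    · refine Finset.sum_le_sum fun n _ => ?_
      exact Set.indicator_le_self _ (fun _ => (2 : ℝ≥0∞) ^ n) w
    · intro n hn
      rw [Finset.mem_range, not_lt] at hn
      rw [Set.indicator_of_notMem]
      have h1 : ((N + 1 : ℕ) : ℝ) ≤ n := by exact_mod_cast hn
      push_cast at h1
      have := hRn n
      simp only [Set.mem_ofPred_eq, not_le]; linarith
  have hsumt : ∀ N : ℕ, 1 + ∑ n ∈ Finset.range (N + 1), (2 : ℝ≥0∞) ^ n ≠ ∞ := by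
    intro N
    refine ENNReal.add_ne_top.2 ⟨by simp, ?_⟩
    exact ENNReal.sum_ne_top.2 fun n _ => by simp
  have hUt : ∀ w, U w ≠ ∞ := by
    intro w
    obtain ⟨N, hN⟩ := exists_nat_ge ‖w‖
    exact ne_top_of_le_ne_top (hsumt N) (hUb N w hN)
  refine ⟨fun w => (U w).toReal, hUm.ennreal_toReal, fun w => ?_, ?_, fun R' => ?_, fun A => ?_⟩
  · rw [← ENNReal.toReal_one]
    exact ENNReal.toReal_mono (hUt w) le_self_add
  · simp only [ENNReal.ofReal_toReal (hUt _), U, mul_add, mul_one]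
    rw [lintegral_add_left hψ]
    have e : ∀ w, ψ w * ∑' n : ℕ, {w : ℂ | R n ≤ ‖w‖}.indicator (fun _ => (2 : ℝ≥0∞) ^ n) w =
        ∑' n : ℕ, 2 ^ n * {w : ℂ | R n ≤ ‖w‖}.indicator ψ w := by
      intro w
      rw [← ENNReal.tsum_mul_left]
      refine tsum_congr fun n => ?_
      by_cases hw : w ∈ {w : ℂ | R n ≤ ‖w‖}
      · rw [Set.indicator_of_mem hw, Set.indicator_of_mem hw, mul_comm]
      · rw [Set.indicator_of_notMem hw, Set.indicator_of_notMem hw]; simp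
    simp only [e]
    rw [lintegral_tsum fun n => ((hψ.indicator (hS n)).const_mul _).aemeasurable]
    calc (∫⁻ w, ψ w) + ∑' n : ℕ, ∫⁻ w, 2 ^ n * {w : ℂ | R n ≤ ‖w‖}.indicator ψ w
        ≤ 1 + ∑' n : ℕ, (2⁻¹ : ℝ≥0∞) ^ n := by
          gcongr with n
          rw [lintegral_const_mul _ (hψ.indicator (hS n)), lintegral_indicator (hS n)]
          calc (2 : ℝ≥0∞) ^ n * ∫⁻ w in {w : ℂ | R n ≤ ‖w‖}, ψ w
              ≤ 2 ^ n * (4⁻¹ : ℝ≥0∞) ^ n := by gcongr; exact hR n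
            _ = (2⁻¹ : ℝ≥0∞) ^ n := by
              rw [← mul_pow]
              congr 1
              rw [show (4 : ℝ≥0∞) = 2 * 2 by norm_num,
                ENNReal.mul_inv (by simp) (by simp), ← mul_assoc,
                ENNReal.mul_inv_cancel (by simp) (by simp), one_mul]
      -- The mass of `ψ` contributes `1` and the geometric series `2`.
      _ = 3 := by
          rw [ENNReal.tsum_geometric, ENNReal.one_sub_inv_two, inv_inv]; norm_num
  · obtain ⟨N, hN⟩ := exists_nat_ge R'
    exact ⟨_, fun w hw => ENNReal.toReal_mono (hsumt N) (hUb N w (hw.trans hN))⟩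
  · obtain ⟨n, hn⟩ := pow_unbounded_of_one_lt A (one_lt_two (α := ℝ))
    refine ⟨R n, fun w hw => ?_⟩
    have h1 : (2 : ℝ≥0∞) ^ n ≤ U w := by
      refine le_trans ?_ (le_add_left le_rfl)
      refine le_trans ?_ (ENNReal.le_tsum n)
      rw [Set.indicator_of_mem (show w ∈ {w : ℂ | R n ≤ ‖w‖} from hw)]
    have h2 := ENNReal.toReal_mono (hUt w) h1
    rw [ENNReal.toReal_pow, ENNReal.toReal_ofNat] at h2
    linarith

theorem lintegral_exp_neg_sq_le :
    ∫⁻ w : ℂ, ENNReal.ofReal (Real.exp (-‖w‖ ^ 2)) ≤ 4 := by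
  have h := GaussianFourier.integral_rexp_neg_mul_sq_norm (V := ℂ) one_pos
  simp only [Complex.finrank_real_complex, div_one, neg_mul, one_mul] at h
  have hi : Integrable fun w : ℂ => Real.exp (-‖w‖ ^ 2) := by
    apply Integrable.of_integral_ne_zero
    rw [h]; positivity
  rw [← ofReal_integral_eq_lintegral_ofReal hi (Eventually.of_forall fun w => Real.exp_nonneg _), h,
    show (4 : ℝ≥0∞) = ENNReal.ofReal 4 by simp]
  apply ENNReal.ofReal_le_ofReal
  norm_num
  exact Real.pi_le_four

/-- A majorant of `φ` in `L^P`, of comparable norm, which dominates `φ` at infinity and whose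
logarithm is locally bounded. -/
theorem exists_majorant {P : ℝ} (hP : 0 < P) {φ : ℂ → ℂ} (hφ : Continuous φ)
    (hfin : ∫⁻ w, ‖φ w‖ₑ ^ P ≤ 1) :
    ∃ ℓ : ℂ → ℝ, Measurable ℓ ∧ (∀ w, ‖φ w‖ ≤ Real.exp (ℓ w)) ∧
      ∫⁻ w, ENNReal.ofReal (Real.exp (P * ℓ w)) ≤ 7 ∧
      (∀ R : ℝ, ∃ L : ℝ, ∀ w : ℂ, ‖w‖ ≤ R → |ℓ w| ≤ L) ∧
      ∀ ε : ℝ, 0 < ε → ∃ R : ℝ, ∀ w : ℂ, R ≤ ‖w‖ → ‖φ w‖ ≤ ε * Real.exp (ℓ w) := by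
  obtain ⟨W, hWm, hW1, hWi, hWb, hWt⟩ :=
    exists_weight_tendsto_top (hφ.enorm.measurable.pow_const P) hfin
  -- The weight `W` makes `‖φ‖^P` small relative to `D` at infinity, while the Gaussian term keeps
  -- `D` positive and `log D` locally bounded below, even at zeros of `φ`.
  let D : ℂ → ℝ := fun w => ‖φ w‖ ^ P * W w + Real.exp (-‖w‖ ^ 2)
  have hW0 : ∀ w, 0 ≤ W w := fun w => zero_le_one.trans (hW1 w)
  have hD0 : ∀ w, 0 < D w := fun w => by
    have := hW0 w
    positivity
  have hDm : Measurable D := by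
    refine Measurable.add (Measurable.mul ?_ hWm) (Continuous.measurable (by fun_prop))
    exact hφ.norm.measurable.pow_const P
  have hexp : ∀ w, Real.exp (P * (P⁻¹ * Real.log (D w))) = D w := fun w => by
    rw [← mul_assoc, mul_inv_cancel₀ hP.ne', one_mul, Real.exp_log (hD0 w)]
  have hcomp : ∀ (w : ℂ) (c : ℝ), 0 ≤ c → ‖φ w‖ ^ P ≤ c ^ P * D w →
      ‖φ w‖ ≤ c * Real.exp (P⁻¹ * Real.log (D w)) := by
    intro w c hc h
    rw [← Real.rpow_le_rpow_iff (norm_nonneg _) (by positivity) hP,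
      Real.mul_rpow hc (Real.exp_nonneg _), ← Real.exp_mul, mul_comm _ P, hexp]
    exact h
  refine ⟨fun w => P⁻¹ * Real.log (D w), by fun_prop, fun w => ?_, ?_, fun R => ?_, fun ε hε => ?_⟩
  · have := hcomp w 1 zero_le_one (by
      rw [Real.one_rpow, one_mul]
      have h1 : ‖φ w‖ ^ P * 1 ≤ ‖φ w‖ ^ P * W w := by gcongr; exact hW1 w
      have h2 := Real.exp_nonneg (-‖w‖ ^ 2)
      simp only [D]; linarith)
    simpa using this
  · simp only [hexp]
    calc ∫⁻ w, ENNReal.ofReal (D w)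
        = ∫⁻ w, (‖φ w‖ₑ ^ P * ENNReal.ofReal (W w) + ENNReal.ofReal (Real.exp (-‖w‖ ^ 2))) := by
          refine lintegral_congr fun w => ?_
          have := hW0 w
          rw [ENNReal.ofReal_add (by positivity) (by positivity), ENNReal.ofReal_mul (by positivity),
            ← ENNReal.ofReal_rpow_of_nonneg (norm_nonneg _) hP.le, ofReal_norm]
      _ = (∫⁻ w, ‖φ w‖ₑ ^ P * ENNReal.ofReal (W w)) +
          ∫⁻ w : ℂ, ENNReal.ofReal (Real.exp (-‖w‖ ^ 2)) := by
          refine lintegral_add_right _ ?_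
          exact (Continuous.measurable (by fun_prop)).ennreal_ofReal
      _ ≤ 3 + 4 := add_le_add hWi lintegral_exp_neg_sq_le
      _ = 7 := by norm_num
  · obtain ⟨L, hL⟩ := hWb R
    obtain ⟨S, hS⟩ := (isCompact_closedBall (0 : ℂ) R).exists_bound_of_continuousOn
      hφ.continuousOn
    refine ⟨P⁻¹ * (R ^ 2 + |Real.log (|S| ^ P * |L| + 1)|), fun w hw => ?_⟩
    have hDlow : Real.exp (-R ^ 2) ≤ D w := by
      have h1 : Real.exp (-R ^ 2) ≤ Real.exp (-‖w‖ ^ 2) := by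
        apply Real.exp_le_exp.2
        have := pow_le_pow_left₀ (norm_nonneg w) hw 2
        linarith
      have h2 : 0 ≤ ‖φ w‖ ^ P * W w := mul_nonneg (by positivity) (hW0 w)
      simp only [D]; linarith
    have hDup : D w ≤ |S| ^ P * |L| + 1 := by
      have h1 : ‖φ w‖ ≤ |S| := (hS w (by simpa using hw)).trans (le_abs_self _)
      have h2 : W w ≤ |L| := (hL w hw).trans (le_abs_self _)
      have h3 : Real.exp (-‖w‖ ^ 2) ≤ 1 := Real.exp_le_one_iff.2 (by nlinarith [norm_nonneg w])
      have := hW0 w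
      simp only [D]
      gcongr
    rw [abs_mul, abs_of_pos (inv_pos.2 hP)]
    gcongr
    rw [abs_le]
    have h1 : -R ^ 2 ≤ Real.log (D w) := by
      rw [Real.le_log_iff_exp_le (hD0 w)]; exact hDlow
    have h2 : Real.log (D w) ≤ Real.log (|S| ^ P * |L| + 1) := Real.log_le_log (hD0 w) hDup
    constructor
    · linarith [abs_nonneg (Real.log (|S| ^ P * |L| + 1))]
    · linarith [le_abs_self (Real.log (|S| ^ P * |L| + 1)), sq_nonneg R]
  · obtain ⟨R, hR⟩ := hWt ((ε ^ P)⁻¹)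
    refine ⟨R, fun w hw => hcomp w ε hε.le ?_⟩
    have h1 : ‖φ w‖ ^ P * (ε ^ P)⁻¹ ≤ D w := by
      have h2 : ‖φ w‖ ^ P * (ε ^ P)⁻¹ ≤ ‖φ w‖ ^ P * W w := by gcongr; exact hR w hw
      have h3 := Real.exp_nonneg (-‖w‖ ^ 2)
      simp only [D]; linarith
    have hεP : 0 < ε ^ P := by positivity
    calc ‖φ w‖ ^ P = ε ^ P * (‖φ w‖ ^ P * (ε ^ P)⁻¹) := by field_simp
      _ ≤ ε ^ P * D w := by gcongr

/-! ### The analytic family and its projection -/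

/-- The analytic family `φ * exp (-a (ζ - θ) ℓ)`, which equals `φ` at `ζ = θ`. -/
noncomputable def expFamily (a θ : ℝ) (φ : ℂ → ℂ) (ℓ : ℂ → ℝ) (ζ w : ℂ) : ℂ :=
  φ w * cexp (-(a * (ζ - θ)) * ℓ w)

/-- The `L^q` norm of `h` outside large disks tends to zero. -/
def TailVanishes (h : ℂ → ℝ) (q : ℝ≥0∞) : Prop :=
  ∀ ε : ℝ≥0∞, ε ≠ 0 → ∃ R : ℝ, eLpNorm ({w : ℂ | R ≤ ‖w‖}.indicator h) q volume ≤ ε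

theorem measurableSet_le_norm (R : ℝ) : MeasurableSet {w : ℂ | R ≤ ‖w‖} :=
  (isClosed_le continuous_const continuous_norm).measurableSet

theorem tailVanishes_of_memLp {h : ℂ → ℝ} (hm : Measurable h) {q : ℝ≥0∞} (hq0 : q ≠ 0)
    (hqt : q ≠ ∞) (hh : MemLp h q volume) : TailVanishes h q := by
  intro ε hε
  have hQ : 0 < q.toReal := ENNReal.toReal_pos hq0 hqt
  have hfin := (eLpNorm_lt_top_iff_lintegral_rpow_enorm_lt_top hq0 hqt).1 hh.2
  obtain ⟨R, -, hR⟩ := exists_setLIntegral_norm_ge_le (hm.enorm.pow_const q.toReal) hfin.ne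
    (ε := ε ^ q.toReal) (by simp [hε, hQ.le]) 0
  refine ⟨R, ?_⟩
  rw [eLpNorm_indicator_eq_eLpNorm_restrict (measurableSet_le_norm R),
    eLpNorm_eq_lintegral_rpow_enorm_toReal hq0 hqt, ← ENNReal.rpow_le_rpow_iff hQ,
    ← ENNReal.rpow_mul, one_div, inv_mul_cancel₀ hQ.ne', ENNReal.rpow_one]
  exact hR

theorem norm_expFamily (a θ : ℝ) (φ : ℂ → ℂ) (ℓ : ℂ → ℝ) (ζ w : ℂ) :
    ‖expFamily a θ φ ℓ ζ w‖ = ‖φ w‖ * Real.exp (-(a * (ζ.re - θ)) * ℓ w) := by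
  rw [expFamily, norm_mul, Complex.norm_exp]
  congr 2
  simp

section

variable {a θ : ℝ} {φ : ℂ → ℂ} {ℓ : ℂ → ℝ}

theorem measurable_expFamily (hφ : Measurable φ) (hℓ : Measurable ℓ) (ζ : ℂ) :
    Measurable (expFamily a θ φ ℓ ζ) := by
  unfold expFamily
  fun_prop

/-- Outside a large disk both terms are dominated by the small tail of `h`. Inside, `ℓ` is bounded,
so `exp(-a(ω - ζ)ℓ) - 1` tends to `0` uniformly. Smallness of tails replaces dominated convergence,
so `q = ∞` is covered too. -/
theorem tendsto_eLpNorm_indicator_expFamily_sub (ha : 0 ≤ a)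
    (hloc : ∀ R : ℝ, ∃ L : ℝ, ∀ w : ℂ, ‖w‖ ≤ R → |ℓ w| ≤ L)
    {q : ℝ≥0∞} (hq : 1 ≤ q) {S T : Set ℂ} {h : ℂ → ℝ}
    (hh0 : ∀ w, 0 ≤ h w) (hh : MemLp h q volume) (htail : TailVanishes h q)
    (hb : ∀ ζ ∈ T, ∀ w ∈ S, ‖expFamily a θ φ ℓ ζ w‖ ≤ h w) {ζ : ℂ} (hζ : ζ ∈ T) :
    Tendsto (fun ω => eLpNorm (S.indicator (expFamily a θ φ ℓ ω - expFamily a θ φ ℓ ζ)) q volume)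
      (𝓝[T] ζ) (𝓝 0) := by
  rw [ENNReal.tendsto_nhds_zero]
  intro ε hε
  obtain ⟨R, hR⟩ := htail (ε / 4) (ENNReal.div_pos hε.ne' (by simp)).ne'
  obtain ⟨L, hL⟩ := hloc R
  have hdist : Tendsto (fun ω : ℂ => a * |L| * ‖ω - ζ‖) (𝓝[T] ζ) (𝓝 0) := by
    have : Continuous fun ω : ℂ => a * |L| * ‖ω - ζ‖ := by fun_prop
    have h1 := (this.tendsto ζ).mono_left (nhdsWithin_le_nhds (s := T))
    simpa using h1
  have h1 : ∀ᶠ ω in 𝓝[T] ζ, a * |L| * ‖ω - ζ‖ ≤ 1 := hdist.eventually_le_const one_pos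
  have h2 : ∀ᶠ ω in 𝓝[T] ζ,
      ENNReal.ofReal (2 * (a * |L| * ‖ω - ζ‖)) * eLpNorm h q volume ≤ ε / 2 := by
    have h3 : Tendsto (fun ω : ℂ => ENNReal.ofReal (2 * (a * |L| * ‖ω - ζ‖)) *
        eLpNorm h q volume) (𝓝[T] ζ) (𝓝 (0 * eLpNorm h q volume)) := by
      refine ENNReal.Tendsto.mul_const ?_ (Or.inr hh.2.ne)
      have := ENNReal.tendsto_ofReal (hdist.const_mul 2)
      simpa using this
    rw [zero_mul] at h3
    exact (ENNReal.tendsto_nhds_zero.1 h3) _ (ENNReal.div_pos hε.ne' (by simp))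
  filter_upwards [h1, h2, self_mem_nhdsWithin] with ω hω1 hω2 hωT
  set c : ℝ := 2 * (a * |L| * ‖ω - ζ‖) with hc
  have hc0 : 0 ≤ c := by positivity
  set t : ℂ → ℝ := {w : ℂ | R ≤ ‖w‖}.indicator h
  have hpt : ∀ w, ‖S.indicator (expFamily a θ φ ℓ ω - expFamily a θ φ ℓ ζ) w‖ ≤
      (c • h + (2 : ℝ) • t) w := by
    intro w
    have ht0 : 0 ≤ t w := Set.indicator_nonneg (fun w _ => hh0 w) w
    have hch : 0 ≤ c * h w := mul_nonneg hc0 (hh0 w)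
    simp only [Pi.add_apply, Pi.smul_apply, smul_eq_mul]
    by_cases hw : w ∈ S
    · rw [Set.indicator_of_mem hw, Pi.sub_apply]
      by_cases hwR : R ≤ ‖w‖
      · have htw : t w = h w := Set.indicator_of_mem (show w ∈ {w : ℂ | R ≤ ‖w‖} from hwR) _
        rw [htw]
        have h3 := norm_sub_le (expFamily a θ φ ℓ ω w) (expFamily a θ φ ℓ ζ w)
        linarith [hb ω hωT w hw, hb ζ hζ w hw]
      · have e : expFamily a θ φ ℓ ω w - expFamily a θ φ ℓ ζ w =
            expFamily a θ φ ℓ ζ w * (cexp (-(a * (ω - ζ)) * ℓ w) - 1) := by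
          simp only [expFamily]
          rw [mul_assoc (φ w), mul_sub (cexp _), ← Complex.exp_add, mul_one, ← mul_sub]
          congr 4; ring
        have hu : ‖-(a * (ω - ζ)) * (ℓ w : ℂ)‖ ≤ a * |L| * ‖ω - ζ‖ := by
          rw [norm_mul, norm_neg, norm_mul, Complex.norm_real, Complex.norm_real,
            Real.norm_of_nonneg ha, Real.norm_eq_abs]
          have := (hL w (not_le.1 hwR).le).trans (le_abs_self L)
          calc a * ‖ω - ζ‖ * |ℓ w| ≤ a * ‖ω - ζ‖ * |L| := by gcongr
            _ = _ := by ring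
        have hv := Complex.norm_exp_sub_one_le (hu.trans hω1)
        rw [e, norm_mul]
        calc ‖expFamily a θ φ ℓ ζ w‖ * ‖cexp (-(a * (ω - ζ)) * ℓ w) - 1‖
            ≤ h w * (2 * (a * |L| * ‖ω - ζ‖)) := by
              gcongr
              · exact hh0 w
              · exact hb ζ hζ w hw
              · exact hv.trans (by gcongr)
          _ = c * h w := by rw [hc]; ring
          _ ≤ _ := by linarith
    · rw [Set.indicator_of_notMem hw, norm_zero]; linarith
  have htm : AEStronglyMeasurable t volume := hh.1.indicator (measurableSet_le_norm R)
  calc eLpNorm (S.indicator (expFamily a θ φ ℓ ω - expFamily a θ φ ℓ ζ)) q volume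
      ≤ eLpNorm (c • h + (2 : ℝ) • t) q volume := eLpNorm_mono_real hpt
    _ ≤ eLpNorm (c • h) q volume + eLpNorm ((2 : ℝ) • t) q volume :=
        eLpNorm_add_le (hh.1.const_smul c) (htm.const_smul 2) hq
    _ = ENNReal.ofReal c * eLpNorm h q volume + 2 * eLpNorm t q volume := by
        rw [eLpNorm_const_smul, eLpNorm_const_smul, ← ofReal_norm c, Real.norm_of_nonneg hc0,
          ← ofReal_norm (2 : ℝ)]
        norm_num
    _ ≤ ε / 2 + 2 * (ε / 4) := by gcongr
    _ = ε := by
        rw [show (4 : ℝ≥0∞) = 2 * 2 by norm_num, ← mul_div_assoc,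
          ENNReal.mul_div_mul_left _ _ (by simp) (by simp), ENNReal.add_halves]

/-- The hypotheses on the family `expFamily a θ φ ℓ` under which its projection is a Calderón
function: its moduli on the lines `Re ζ = 0` and `Re ζ = 1` are in `L^p₀` and `L^p₁`. -/
structure IsExpFamilyData (p₀ p₁ : ℝ≥0∞) (a θ : ℝ) (φ : ℂ → ℂ) (ℓ : ℂ → ℝ) : Prop where
  nonneg : 0 ≤ a
  measurable_fun : Measurable φ
  measurable_log : Measurable ℓ
  locallyBounded : ∀ R : ℝ, ∃ L : ℝ, ∀ w : ℂ, ‖w‖ ≤ R → |ℓ w| ≤ L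
  memLp_left : MemLp (fun w => ‖φ w‖ * Real.exp (a * θ * ℓ w)) p₀ volume
  memLp_right : MemLp (fun w => ‖φ w‖ * Real.exp (-(a * (1 - θ)) * ℓ w)) p₁ volume
  tail_left : TailVanishes (fun w => ‖φ w‖ * Real.exp (a * θ * ℓ w)) p₀
  tail_right : TailVanishes (fun w => ‖φ w‖ * Real.exp (-(a * (1 - θ)) * ℓ w)) p₁

/-- Where `ℓ ≥ 0` the modulus decreases in `Re ζ`, so the line `Re ζ = 0` dominates. A distance `2δ`
from it leaves a factor `exp(2aδ|ℓ|)` to absorb the powers of `ℓ` produced by differentiation. The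
case `ℓ ≤ 0` is symmetric, with the line `Re ζ = 1`. -/
theorem norm_expFamily_le_left (ha : 0 ≤ a) {ζ : ℂ} {δ : ℝ} (hδ : 2 * δ ≤ ζ.re) {w : ℂ}
    (hw : 0 ≤ ℓ w) :
    Real.exp (2 * (a * δ * |ℓ w|)) * ‖expFamily a θ φ ℓ ζ w‖ ≤
      ‖φ w‖ * Real.exp (a * θ * ℓ w) := by
  rw [norm_expFamily, mul_left_comm, ← Real.exp_add, abs_of_nonneg hw]
  gcongr
  have := mul_nonneg (mul_nonneg ha (sub_nonneg.2 hδ)) hw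
  linarith

theorem norm_expFamily_le_right (ha : 0 ≤ a) {ζ : ℂ} {δ : ℝ} (hδ : ζ.re + 2 * δ ≤ 1) {w : ℂ}
    (hw : ℓ w ≤ 0) :
    Real.exp (2 * (a * δ * |ℓ w|)) * ‖expFamily a θ φ ℓ ζ w‖ ≤
      ‖φ w‖ * Real.exp (-(a * (1 - θ)) * ℓ w) := by
  rw [norm_expFamily, mul_left_comm, ← Real.exp_add, abs_of_nonpos hw]
  gcongr
  have := mul_nonneg (mul_nonneg ha (sub_nonneg.2 hδ)) (neg_nonneg.2 hw)
  linarith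

end

section

variable {p₀ p₁ : ℝ≥0∞} {a θ : ℝ} {φ : ℂ → ℂ} {ℓ : ℂ → ℝ}

theorem IsExpFamilyData.memLp_indicator_left (hd : IsExpFamilyData p₀ p₁ a θ φ ℓ) {Ψ : ℂ → ℂ}
    (hΨ : Measurable Ψ) {c : ℝ} (hc : 0 ≤ c)
    (h : ∀ w, 0 ≤ ℓ w → ‖Ψ w‖ ≤ c * (‖φ w‖ * Real.exp (a * θ * ℓ w))) :
    MemLp ({w | 0 ≤ ℓ w}.indicator Ψ) p₀ volume ∧
      eLpNorm ({w | 0 ≤ ℓ w}.indicator Ψ) p₀ volume ≤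
        ENNReal.ofReal c * eLpNorm (fun w => ‖φ w‖ * Real.exp (a * θ * ℓ w)) p₀ volume := by
  have hS : MeasurableSet {w | 0 ≤ ℓ w} := measurableSet_le measurable_const hd.measurable_log
  have hb : ∀ w, ‖{w | 0 ≤ ℓ w}.indicator Ψ w‖ ≤ c * ‖‖φ w‖ * Real.exp (a * θ * ℓ w)‖ := by
    intro w
    rw [Real.norm_of_nonneg (by positivity)]
    by_cases hw : w ∈ {w | 0 ≤ ℓ w}
    · rw [Set.indicator_of_mem hw]; exact h w hw
    · rw [Set.indicator_of_notMem hw, norm_zero]; positivity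
  exact ⟨hd.memLp_left.of_le_mul (hΨ.indicator hS).aestronglyMeasurable (Eventually.of_forall hb),
    eLpNorm_le_mul_eLpNorm_of_ae_le_mul (Eventually.of_forall hb) _⟩

theorem IsExpFamilyData.memLp_indicator_right (hd : IsExpFamilyData p₀ p₁ a θ φ ℓ) {Ψ : ℂ → ℂ}
    (hΨ : Measurable Ψ) {c : ℝ} (hc : 0 ≤ c)
    (h : ∀ w, ℓ w ≤ 0 → ‖Ψ w‖ ≤ c * (‖φ w‖ * Real.exp (-(a * (1 - θ)) * ℓ w))) :
    MemLp ({w | 0 ≤ ℓ w}ᶜ.indicator Ψ) p₁ volume ∧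
      eLpNorm ({w | 0 ≤ ℓ w}ᶜ.indicator Ψ) p₁ volume ≤
        ENNReal.ofReal c *
          eLpNorm (fun w => ‖φ w‖ * Real.exp (-(a * (1 - θ)) * ℓ w)) p₁ volume := by
  have hS : MeasurableSet {w | 0 ≤ ℓ w} := measurableSet_le measurable_const hd.measurable_log
  have hb : ∀ w, ‖{w | 0 ≤ ℓ w}ᶜ.indicator Ψ w‖ ≤
      c * ‖‖φ w‖ * Real.exp (-(a * (1 - θ)) * ℓ w)‖ := by
    intro w
    rw [Real.norm_of_nonneg (by positivity)]
    by_cases hw : w ∈ {w | 0 ≤ ℓ w}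
    · rw [Set.indicator_of_notMem (Set.notMem_compl_iff.2 hw), norm_zero]; positivity
    · rw [Set.indicator_of_mem (Set.mem_compl hw)]; exact h w (not_le.1 hw).le
  exact ⟨hd.memLp_right.of_le_mul (hΨ.indicator hS.compl).aestronglyMeasurable
    (Eventually.of_forall hb), eLpNorm_le_mul_eLpNorm_of_ae_le_mul (Eventually.of_forall hb) _⟩

theorem IsExpFamilyData.fockProjIntegrable (hd : IsExpFamilyData p₀ p₁ a θ φ ℓ) (hp₀ : 1 ≤ p₀)
    (hp₁ : 1 ≤ p₁) (m : ℕ) {Ψ : ℂ → ℂ} (hΨ : Measurable Ψ) {c : ℝ} (hc : 0 ≤ c)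
    (h₀ : ∀ w, 0 ≤ ℓ w → ‖Ψ w‖ ≤ c * (‖φ w‖ * Real.exp (a * θ * ℓ w)))
    (h₁ : ∀ w, ℓ w ≤ 0 → ‖Ψ w‖ ≤ c * (‖φ w‖ * Real.exp (-(a * (1 - θ)) * ℓ w))) :
    FockProjIntegrable m Ψ := by
  rw [← Set.indicator_self_add_compl {w | 0 ≤ ℓ w} Ψ]
  exact ((hd.memLp_indicator_left hΨ hc h₀).1.fockProjIntegrable hp₀ m).add
    ((hd.memLp_indicator_right hΨ hc h₁).1.fockProjIntegrable hp₁ m)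

theorem IsExpFamilyData.norm_le_left (hd : IsExpFamilyData p₀ p₁ a θ φ ℓ) {ζ : ℂ}
    (hζ : ζ ∈ verticalClosedStrip 0 1) (w : ℂ) (hw : 0 ≤ ℓ w) :
    ‖expFamily a θ φ ℓ ζ w‖ ≤ ‖φ w‖ * Real.exp (a * θ * ℓ w) := by
  have := norm_expFamily_le_left (θ := θ) (φ := φ) (δ := 0) hd.nonneg
    (by simpa using hζ.1) hw
  simpa using this

theorem IsExpFamilyData.norm_le_right (hd : IsExpFamilyData p₀ p₁ a θ φ ℓ) {ζ : ℂ}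
    (hζ : ζ ∈ verticalClosedStrip 0 1) (w : ℂ) (hw : ℓ w ≤ 0) :
    ‖expFamily a θ φ ℓ ζ w‖ ≤ ‖φ w‖ * Real.exp (-(a * (1 - θ)) * ℓ w) := by
  have := norm_expFamily_le_right (θ := θ) (φ := φ) (δ := 0) hd.nonneg
    (by simpa using hζ.2) hw
  simpa using this

theorem IsExpFamilyData.memLp_line_left (hd : IsExpFamilyData p₀ p₁ a θ φ ℓ) {ζ : ℂ}
    (hζ : ζ.re = 0) : MemLp (expFamily a θ φ ℓ ζ) p₀ volume ∧
      eLpNorm (expFamily a θ φ ℓ ζ) p₀ volume ≤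
        eLpNorm (fun w => ‖φ w‖ * Real.exp (a * θ * ℓ w)) p₀ volume := by
  have hb : ∀ w, ‖expFamily a θ φ ℓ ζ w‖ ≤ ‖‖φ w‖ * Real.exp (a * θ * ℓ w)‖ := by
    intro w
    rw [Real.norm_of_nonneg (by positivity), norm_expFamily, hζ]
    simp
  exact ⟨hd.memLp_left.mono
    (measurable_expFamily hd.measurable_fun hd.measurable_log ζ).aestronglyMeasurable
    (Eventually.of_forall hb), eLpNorm_mono hb⟩

theorem IsExpFamilyData.memLp_line_right (hd : IsExpFamilyData p₀ p₁ a θ φ ℓ) {ζ : ℂ}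
    (hζ : ζ.re = 1) : MemLp (expFamily a θ φ ℓ ζ) p₁ volume ∧
      eLpNorm (expFamily a θ φ ℓ ζ) p₁ volume ≤
        eLpNorm (fun w => ‖φ w‖ * Real.exp (-(a * (1 - θ)) * ℓ w)) p₁ volume := by
  have hb : ∀ w, ‖expFamily a θ φ ℓ ζ w‖ ≤ ‖‖φ w‖ * Real.exp (-(a * (1 - θ)) * ℓ w)‖ := by
    intro w
    rw [Real.norm_of_nonneg (by positivity), norm_expFamily, hζ]
  exact ⟨hd.memLp_right.mono
    (measurable_expFamily hd.measurable_fun hd.measurable_log ζ).aestronglyMeasurable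
    (Eventually.of_forall hb), eLpNorm_mono hb⟩

/-- The remainder bound `|e^u - 1 - u| ≤ |u|² e^{|u|}` together with `y² ≤ 2 e^y` for `y = aδ|ℓ|`.
The growth in `ℓ` is exactly the spare factor available at distance `2δ` from the edges. -/
theorem norm_inv_mul_exp_sub_one_sub_le {a δ ℓ : ℝ} (ha : 0 ≤ a) (hδ : 0 < δ) {η : ℂ} (hη : η ≠ 0)
    (hηδ : ‖η‖ ≤ δ) :
    ‖η⁻¹ * (cexp (-(a * η) * ℓ) - 1 + a * η * ℓ)‖ ≤
      ‖η‖ * (2 / δ ^ 2) * Real.exp (2 * (a * δ * |ℓ|)) := by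
  set u : ℂ := -(a * η) * ℓ
  have hu : ‖u‖ = a * ‖η‖ * |ℓ| := by
    rw [norm_mul, norm_neg, norm_mul, Complex.norm_real, Complex.norm_real, Real.norm_of_nonneg ha,
      Real.norm_eq_abs]
  have h1 := Complex.norm_exp_sub_sum_le_norm_mul_exp u 2
  rw [Finset.sum_range_succ, Finset.sum_range_one] at h1
  simp only [pow_zero, pow_one, Nat.factorial, Nat.cast_one, div_one, mul_one] at h1
  have e : cexp u - 1 + a * η * ℓ = cexp u - (1 + u) := by simp only [u]; ring
  have hy0 : 0 ≤ a * δ * |ℓ| := by positivity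
  have huy : ‖u‖ ≤ a * δ * |ℓ| := by rw [hu]; gcongr
  have hη0 : 0 < ‖η‖ := norm_pos_iff.2 hη
  have h2 : (a * δ * |ℓ|) ^ 2 ≤ 2 * Real.exp (a * δ * |ℓ|) := by
    have := Real.quadratic_le_exp_of_nonneg hy0
    linarith
  rw [e, norm_mul, norm_inv]
  calc ‖η‖⁻¹ * ‖cexp u - (1 + u)‖ ≤ ‖η‖⁻¹ * (‖u‖ ^ 2 * Real.exp (a * δ * |ℓ|)) := by
        gcongr
        exact h1.trans (by gcongr)
    _ = ‖η‖ * (1 / δ ^ 2) * ((a * δ * |ℓ|) ^ 2 * Real.exp (a * δ * |ℓ|)) := by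
        rw [hu]; field_simp
    _ ≤ ‖η‖ * (1 / δ ^ 2) * (2 * Real.exp (a * δ * |ℓ|) * Real.exp (a * δ * |ℓ|)) := by gcongr
    _ = _ := by
        rw [mul_assoc 2, ← Real.exp_add, ← two_mul]; ring

/-- The plane is split by the sign of `ℓ`: the part `ℓ ≥ 0` is controlled in `L^p₀` by the left
edge, the part `ℓ < 0` in `L^p₁` by the right edge. Their projections give a decomposition in the
sum space, with bounds uniform over the strip. -/
theorem IsExpFamilyData.isCalderonFunction (hd : IsExpFamilyData p₀ p₁ a θ φ ℓ) (hp₀ : 1 ≤ p₀)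
    (hp₁ : 1 ≤ p₁) (m : ℕ) :
    IsCalderonFunction (fockSobolevENorm p₀ m) (fockSobolevENorm p₁ m)
      fun ζ => fockProj m (expFamily a θ φ ℓ ζ) := by
  obtain ⟨C₀, hC₀⟩ := exists_fockSobolevENorm_fockProj_le hp₀ m
  obtain ⟨C₁, hC₁⟩ := exists_fockSobolevENorm_fockProj_le hp₁ m
  obtain ⟨C, hC⟩ := exists_sumENorm_fockProj_le hp₀ hp₁ m
  have hm : ∀ ζ, Measurable (expFamily a θ φ ℓ ζ) :=
    measurable_expFamily hd.measurable_fun hd.measurable_log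
  have hS : MeasurableSet {w | 0 ≤ ℓ w} := measurableSet_le measurable_const hd.measurable_log
  set A₀ := eLpNorm (fun w => ‖φ w‖ * Real.exp (a * θ * ℓ w)) p₀ volume
  set A₁ := eLpNorm (fun w => ‖φ w‖ * Real.exp (-(a * (1 - θ)) * ℓ w)) p₁ volume
  have hA₀ : A₀ ≠ ∞ := hd.memLp_left.2.ne
  have hA₁ : A₁ ≠ ∞ := hd.memLp_right.2.ne
  have hle₀ : ∀ ζ ∈ verticalClosedStrip 0 1, ∀ w, 0 ≤ ℓ w →
      ‖expFamily a θ φ ℓ ζ w‖ ≤ 1 * (‖φ w‖ * Real.exp (a * θ * ℓ w)) := fun ζ hζ w hw => by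
    rw [one_mul]; exact hd.norm_le_left hζ w hw
  have hle₁ : ∀ ζ ∈ verticalClosedStrip 0 1, ∀ w, ℓ w ≤ 0 →
      ‖expFamily a θ φ ℓ ζ w‖ ≤ 1 * (‖φ w‖ * Real.exp (-(a * (1 - θ)) * ℓ w)) :=
    fun ζ hζ w hw => by rw [one_mul]; exact hd.norm_le_right hζ w hw
  have hint : ∀ ζ ∈ verticalClosedStrip 0 1, FockProjIntegrable m (expFamily a θ φ ℓ ζ) :=
    fun ζ hζ => hd.fockProjIntegrable hp₀ hp₁ m (hm ζ) zero_le_one (hle₀ ζ hζ) (hle₁ ζ hζ)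
  have hsum : ∀ (Ψ : ℂ → ℂ), Measurable Ψ → ∀ c : ℝ, 0 ≤ c →
      (∀ w, 0 ≤ ℓ w → ‖Ψ w‖ ≤ c * (‖φ w‖ * Real.exp (a * θ * ℓ w))) →
      (∀ w, ℓ w ≤ 0 → ‖Ψ w‖ ≤ c * (‖φ w‖ * Real.exp (-(a * (1 - θ)) * ℓ w))) →
      sumENorm (fockSobolevENorm p₀ m) (fockSobolevENorm p₁ m) (fockProj m Ψ) ≤
        C * (ENNReal.ofReal c * (A₀ + A₁)) := by
    intro Ψ hΨ c hc h₀ h₁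
    obtain ⟨k1, k2⟩ := hd.memLp_indicator_left hΨ hc h₀
    obtain ⟨k3, k4⟩ := hd.memLp_indicator_right hΨ hc h₁
    rw [← Set.indicator_self_add_compl {w | 0 ≤ ℓ w} Ψ, mul_add (ENNReal.ofReal c)]
    exact (hC _ _ k1 k3).trans (by gcongr)
  refine ⟨⟨(C * (A₀ + A₁)).toNNReal, fun ζ hζ => ?_⟩, fun ζ hζ => ?_, fun ζ hζ => ?_,
    ⟨(C₀ * A₀).toNNReal, fun t => ?_⟩, fun t => ?_, ⟨(C₁ * A₁).toNNReal, fun t => ?_⟩, fun t => ?_⟩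
  · rw [ENNReal.coe_toNNReal (ENNReal.mul_ne_top (by simp) (ENNReal.add_ne_top.2 ⟨hA₀, hA₁⟩))]
    simpa using hsum _ (hm ζ) 1 zero_le_one (hle₀ ζ hζ) (hle₁ ζ hζ)
  · have l0 := tendsto_eLpNorm_indicator_expFamily_sub (θ := θ) (φ := φ) hd.nonneg
      hd.locallyBounded hp₀ (S := {w | 0 ≤ ℓ w}) (T := verticalClosedStrip 0 1)
      (fun w => by positivity) hd.memLp_left hd.tail_left
      (fun ζ hζ w hw => hd.norm_le_left hζ w hw) hζ
    have l1 := tendsto_eLpNorm_indicator_expFamily_sub (θ := θ) (φ := φ) hd.nonneg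
      hd.locallyBounded hp₁ (S := {w | 0 ≤ ℓ w}ᶜ) (T := verticalClosedStrip 0 1)
      (fun w => by positivity) hd.memLp_right hd.tail_right
      (fun ζ hζ w hw => hd.norm_le_right hζ w (not_le.1 (show ¬0 ≤ ℓ w from hw)).le) hζ
    have l2 := ENNReal.Tendsto.const_mul (a := (C : ℝ≥0∞)) (l0.add l1) (by simp)
    rw [add_zero, mul_zero] at l2
    refine tendsto_of_tendsto_of_tendsto_of_le_of_le' tendsto_const_nhds l2
      (Eventually.of_forall fun _ => zero_le) ?_
    filter_upwards [self_mem_nhdsWithin] with ω hω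
    rw [← fockProj_sub (hint ω hω) (hint ζ hζ),
      ← Set.indicator_self_add_compl {w | 0 ≤ ℓ w}
        (expFamily a θ φ ℓ ω - expFamily a θ φ ℓ ζ)]
    have i0 := fun ω hω => (hd.memLp_indicator_left (hm ω) zero_le_one (hle₀ ω hω)).1
    have i1 := fun ω hω => (hd.memLp_indicator_right (hm ω) zero_le_one (hle₁ ω hω)).1
    refine (hC _ _ ?_ ?_).trans_eq (by simp only [Set.indicator_self_add_compl])
    · rw [Set.indicator_sub']; exact (i0 ω hω).sub (i0 ζ hζ)
    · rw [Set.indicator_sub']; exact (i1 ω hω).sub (i1 ζ hζ)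
  · have hζ' : 0 < ζ.re ∧ ζ.re < 1 := hζ
    have hζc := verticalStrip_subset_verticalClosedStrip 0 1 hζ
    obtain ⟨δ, hδ, hδ0, hδ1⟩ : ∃ δ : ℝ, 0 < δ ∧ 2 * δ ≤ ζ.re ∧ ζ.re + 2 * δ ≤ 1 :=
      ⟨min ζ.re (1 - ζ.re) / 2, by
        have : 0 < min ζ.re (1 - ζ.re) := lt_min hζ'.1 (by linarith [hζ'.2])
        linarith, by linarith [min_le_left ζ.re (1 - ζ.re)],
        by linarith [min_le_right ζ.re (1 - ζ.re)]⟩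
    -- The pointwise derivative of the family in `ζ`; its projection is the derivative in the sum
    -- space.
    let D : ℂ → ℂ := fun w => -(a * ℓ w) * expFamily a θ φ ℓ ζ w
    have hDm : Measurable D := by
      have := hm ζ
      have := hd.measurable_log
      fun_prop
    have hDb : ∀ w, ‖D w‖ ≤ δ⁻¹ *
        (Real.exp (2 * (a * δ * |ℓ w|)) * ‖expFamily a θ φ ℓ ζ w‖) := by
      intro w
      have h1 : ‖(-(a * ℓ w) : ℂ)‖ = δ⁻¹ * (a * δ * |ℓ w|) := by
        rw [norm_neg, norm_mul, Complex.norm_real, Complex.norm_real, Real.norm_of_nonneg hd.nonneg,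
          Real.norm_eq_abs]
        field_simp
      have hy0 : 0 ≤ a * δ * |ℓ w| := by have := hd.nonneg; positivity
      have h2 : a * δ * |ℓ w| ≤ Real.exp (2 * (a * δ * |ℓ w|)) := by
        linarith [Real.add_one_le_exp (2 * (a * δ * |ℓ w|))]
      rw [norm_mul, h1, mul_assoc]
      gcongr
    have hD0 : ∀ w, 0 ≤ ℓ w → ‖D w‖ ≤ δ⁻¹ * (‖φ w‖ * Real.exp (a * θ * ℓ w)) := fun w hw =>
      (hDb w).trans (mul_le_mul_of_nonneg_left
        (norm_expFamily_le_left hd.nonneg hδ0 hw) (by positivity))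
    have hD1 : ∀ w, ℓ w ≤ 0 → ‖D w‖ ≤ δ⁻¹ * (‖φ w‖ * Real.exp (-(a * (1 - θ)) * ℓ w)) :=
      fun w hw => (hDb w).trans (mul_le_mul_of_nonneg_left
        (norm_expFamily_le_right hd.nonneg hδ1 hw) (by positivity))
    have hDi := hd.fockProjIntegrable hp₀ hp₁ m hDm (inv_nonneg.2 hδ.le) hD0 hD1
    refine ⟨fockProj m D, ?_, ?_⟩
    · refine (hsum D hDm _ (inv_nonneg.2 hδ.le) hD0 hD1).trans_lt ?_
      exact ENNReal.mul_lt_top (by simp) (ENNReal.mul_lt_top (by simp)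
        (ENNReal.add_lt_top.2 ⟨hA₀.lt_top, hA₁.lt_top⟩))
    · have lim : Tendsto (fun ω : ℂ => (C : ℝ≥0∞) * (ENNReal.ofReal (‖ω - ζ‖ * (2 / δ ^ 2)) *
          (A₀ + A₁))) (𝓝[≠] ζ) (𝓝 0) := by
        have c1 : Continuous fun ω : ℂ => ‖ω - ζ‖ * (2 / δ ^ 2) := by fun_prop
        have c2 := ENNReal.tendsto_ofReal ((c1.tendsto ζ).mono_left
          (nhdsWithin_le_nhds (s := {ζ}ᶜ)))
        have c3 := ENNReal.Tendsto.const_mul (a := (C : ℝ≥0∞)) (ENNReal.Tendsto.mul_const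
          (b := A₀ + A₁) c2 (Or.inr (ENNReal.add_ne_top.2 ⟨hA₀, hA₁⟩))) (Or.inr (by simp))
        simpa using c3
      refine tendsto_of_tendsto_of_tendsto_of_le_of_le' tendsto_const_nhds lim
        (Eventually.of_forall fun _ => zero_le) ?_
      have ev1 : ∀ᶠ ω in 𝓝[≠] ζ, ω ∈ verticalStrip 0 1 :=
        nhdsWithin_le_nhds ((isOpen_verticalStrip 0 1).mem_nhds hζ)
      have ev2 : ∀ᶠ ω in 𝓝[≠] ζ, ω ∈ Metric.ball ζ δ :=
        nhdsWithin_le_nhds (Metric.ball_mem_nhds ζ hδ)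
      filter_upwards [ev1, ev2, self_mem_nhdsWithin] with ω hω1 hω2 hω3
      have hωc := verticalStrip_subset_verticalClosedStrip 0 1 hω1
      have hη : ω - ζ ≠ 0 := sub_ne_zero.2 hω3
      have hηδ : ‖ω - ζ‖ ≤ δ := (mem_ball_iff_norm.1 hω2).le
      have hq : (ω - ζ)⁻¹ • (fockProj m (expFamily a θ φ ℓ ω) - fockProj m (expFamily a θ φ ℓ ζ)) -
          fockProj m D = fockProj m ((ω - ζ)⁻¹ • (expFamily a θ φ ℓ ω - expFamily a θ φ ℓ ζ) - D) := by
        rw [fockProj_sub (((hint ω hωc).sub (hint ζ hζc)).const_smul _) hDi, fockProj_const_smul,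
          fockProj_sub (hint ω hωc) (hint ζ hζc)]
      rw [hq]
      have hpt : ∀ w, ‖((ω - ζ)⁻¹ • (expFamily a θ φ ℓ ω - expFamily a θ φ ℓ ζ) - D) w‖ ≤
          ‖ω - ζ‖ * (2 / δ ^ 2) *
            (Real.exp (2 * (a * δ * |ℓ w|)) * ‖expFamily a θ φ ℓ ζ w‖) := by
        intro w
        have e : ((ω - ζ)⁻¹ • (expFamily a θ φ ℓ ω - expFamily a θ φ ℓ ζ) - D) w =
            (ω - ζ)⁻¹ * (cexp (-(a * (ω - ζ)) * ℓ w) - 1 + a * (ω - ζ) * ℓ w) *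
              expFamily a θ φ ℓ ζ w := by
          have e1 : expFamily a θ φ ℓ ω w =
              cexp (-(a * (ω - ζ)) * ℓ w) * expFamily a θ φ ℓ ζ w := by
            simp only [expFamily]
            rw [mul_left_comm, ← Complex.exp_add]
            congr 2; ring
          simp only [Pi.sub_apply, Pi.smul_apply, smul_eq_mul, D, e1]
          field_simp
          ring
        rw [e, norm_mul, ← mul_assoc]
        gcongr
        exact norm_inv_mul_exp_sub_one_sub_le hd.nonneg hδ hη hηδ
      refine hsum _ ?_ _ (by positivity) (fun w hw => (hpt w).trans ?_)
        (fun w hw => (hpt w).trans ?_)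
      · exact (((hm ω).sub (hm ζ)).const_smul _).sub hDm
      · exact mul_le_mul_of_nonneg_left (norm_expFamily_le_left hd.nonneg hδ0 hw) (by positivity)
      · exact mul_le_mul_of_nonneg_left (norm_expFamily_le_right hd.nonneg hδ1 hw) (by positivity)
  · rw [ENNReal.coe_toNNReal (ENNReal.mul_ne_top (by simp) hA₀)]
    obtain ⟨k1, k2⟩ := hd.memLp_line_left (ζ := t * I) (by simp)
    exact (hC₀ _ k1).trans (by gcongr)
  -- On the line `Re ζ = 0` the modulus equals the left majorant on the whole plane, so no splitting
  -- by the sign of `ℓ` is needed.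
  · have l0 := tendsto_eLpNorm_indicator_expFamily_sub (θ := θ) (φ := φ) hd.nonneg
      hd.locallyBounded hp₀ (S := Set.univ) (T := {ζ : ℂ | ζ.re = 0})
      (fun w => by positivity) hd.memLp_left hd.tail_left
      (fun ζ hζ w _ => by rw [norm_expFamily, show ζ.re = 0 from hζ]; simp)
      (ζ := t * I) (by simp)
    have l1 : Tendsto (fun s : ℝ => (s : ℂ) * I) (𝓝 t) (𝓝[{ζ : ℂ | ζ.re = 0}] (t * I)) := by
      refine tendsto_nhdsWithin_iff.2 ⟨?_, Eventually.of_forall fun s => by simp⟩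
      exact (Continuous.tendsto (by fun_prop) t)
    have l2 := ENNReal.Tendsto.const_mul (a := (C₀ : ℝ≥0∞)) (l0.comp l1) (by simp)
    rw [mul_zero] at l2
    refine tendsto_of_tendsto_of_tendsto_of_le_of_le tendsto_const_nhds l2 (fun _ => zero_le)
      fun s => ?_
    have k1 := (hd.memLp_line_left (ζ := s * I) (by simp)).1
    have k2 := (hd.memLp_line_left (ζ := t * I) (by simp)).1
    simp only [Function.comp, Set.indicator_univ]
    rw [← fockProj_sub (k1.fockProjIntegrable hp₀ m) (k2.fockProjIntegrable hp₀ m)]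
    exact hC₀ _ (k1.sub k2)
  · rw [ENNReal.coe_toNNReal (ENNReal.mul_ne_top (by simp) hA₁)]
    obtain ⟨k1, k2⟩ := hd.memLp_line_right (ζ := 1 + t * I) (by simp)
    exact (hC₁ _ k1).trans (by gcongr)
  · have l0 := tendsto_eLpNorm_indicator_expFamily_sub (θ := θ) (φ := φ) hd.nonneg
      hd.locallyBounded hp₁ (S := Set.univ) (T := {ζ : ℂ | ζ.re = 1})
      (fun w => by positivity) hd.memLp_right hd.tail_right
      (fun ζ hζ w _ => by rw [norm_expFamily, show ζ.re = 1 from hζ])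
      (ζ := 1 + t * I) (by simp)
    have l1 : Tendsto (fun s : ℝ => 1 + (s : ℂ) * I) (𝓝 t)
        (𝓝[{ζ : ℂ | ζ.re = 1}] (1 + t * I)) := by
      refine tendsto_nhdsWithin_iff.2 ⟨?_, Eventually.of_forall fun s => by simp⟩
      exact (Continuous.tendsto (by fun_prop) t)
    have l2 := ENNReal.Tendsto.const_mul (a := (C₁ : ℝ≥0∞)) (l0.comp l1) (by simp)
    rw [mul_zero] at l2
    refine tendsto_of_tendsto_of_tendsto_of_le_of_le tendsto_const_nhds l2 (fun _ => zero_le)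
      fun s => ?_
    have k1 := (hd.memLp_line_right (ζ := 1 + s * I) (by simp)).1
    have k2 := (hd.memLp_line_right (ζ := 1 + t * I) (by simp)).1
    simp only [Function.comp, Set.indicator_univ]
    rw [← fockProj_sub (k1.fockProjIntegrable hp₁ m) (k2.fockProjIntegrable hp₁ m)]
    exact hC₁ _ (k1.sub k2)

theorem exists_calderonENorm_fockProj_le (hp₀ : 1 ≤ p₀) (hp₁ : 1 ≤ p₁) (m : ℕ) :
    ∃ C : ℝ≥0, ∀ {a θ : ℝ} {φ : ℂ → ℂ} {ℓ : ℂ → ℝ} {K : ℝ≥0∞}, IsExpFamilyData p₀ p₁ a θ φ ℓ →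
      eLpNorm (fun w => ‖φ w‖ * Real.exp (a * θ * ℓ w)) p₀ volume ≤ K →
      eLpNorm (fun w => ‖φ w‖ * Real.exp (-(a * (1 - θ)) * ℓ w)) p₁ volume ≤ K →
      calderonENorm (fockSobolevENorm p₀ m) (fockSobolevENorm p₁ m)
        (fun ζ => fockProj m (expFamily a θ φ ℓ ζ)) ≤ C * K := by
  obtain ⟨C₀, hC₀⟩ := exists_fockSobolevENorm_fockProj_le hp₀ m
  obtain ⟨C₁, hC₁⟩ := exists_fockSobolevENorm_fockProj_le hp₁ m
  refine ⟨max C₀ C₁, fun {a θ φ ℓ K} hd h₀ h₁ => max_le (iSup_le fun t => ?_) (iSup_le fun t => ?_)⟩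
  · obtain ⟨k1, k2⟩ := hd.memLp_line_left (ζ := t * I) (by simp)
    refine (hC₀ _ k1).trans (mul_le_mul' ?_ (k2.trans h₀))
    exact_mod_cast le_max_left _ _
  · obtain ⟨k1, k2⟩ := hd.memLp_line_right (ζ := 1 + t * I) (by simp)
    refine (hC₁ _ k1).trans (mul_le_mul' ?_ (k2.trans h₁))
    exact_mod_cast le_max_right _ _

end

/-! ### From the Fock–Sobolev space to the interpolation space -/

/-- For finite `q` the `q`-th power of the integrand is `exp(P ℓ)`, and `7^{1/q} ≤ 7`. For `q = ∞`
the function is identically `1`. -/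
theorem eLpNorm_exp_mul_le {P : ℝ} {ℓ : ℂ → ℝ} {q : ℝ≥0∞} (hq : 1 ≤ q)
    (hfin : ∫⁻ w, ENNReal.ofReal (Real.exp (P * ℓ w)) ≤ 7) :
    eLpNorm (fun w => Real.exp (P * (1 / q).toReal * ℓ w)) q volume ≤ 7 := by
  rcases eq_or_ne q ∞ with rfl | ht
  · rw [eLpNorm_exponent_top]
    refine eLpNormEssSup_le_of_ae_enorm_bound (Eventually.of_forall fun w => ?_)
    simp
  · have hq0 : q ≠ 0 := (zero_lt_one.trans_le hq).ne'
    have hQ1 : 1 ≤ q.toReal := by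
      rw [← ENNReal.toReal_one]; exact (ENNReal.toReal_le_toReal (by simp) ht).2 hq
    have hQ : 0 < q.toReal := by linarith
    rw [eLpNorm_eq_lintegral_rpow_enorm_toReal hq0 ht]
    have e : ∀ w, ‖Real.exp (P * (1 / q).toReal * ℓ w)‖ₑ ^ q.toReal =
        ENNReal.ofReal (Real.exp (P * ℓ w)) := by
      intro w
      rw [← ofReal_norm, Real.norm_of_nonneg (Real.exp_nonneg _),
        ENNReal.ofReal_rpow_of_nonneg (Real.exp_nonneg _) hQ.le, ← Real.exp_mul, one_div,
        ENNReal.toReal_inv]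
      congr 2; field_simp
    simp only [e]
    calc _ ≤ (7 : ℝ≥0∞) ^ (1 / q.toReal) := by gcongr
      _ ≤ 7 ^ (1 : ℝ) := by
        refine ENNReal.rpow_le_rpow_of_exponent_le (by norm_num) ?_
        rw [div_le_one hQ]; exact hQ1
      _ = 7 := by simp

/-- With `φ = Φ / M`, the edge moduli are at most `M exp(P ℓ / p₀)` and `M exp(P ℓ / p₁)`, since
`|φ| ≤ exp ℓ`. Both norms are then controlled by the integral of `exp(P ℓ)`. -/
theorem exists_isExpFamilyData {p₀ p₁ p : ℝ≥0∞} (hp₀ : 1 ≤ p₀) (hp₀₁ : p₀ < p₁) (hp0 : p ≠ 0)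
    (hpt : p ≠ ∞) {θ : ℝ}
    (hp : (1 / p).toReal = (1 - θ) * (1 / p₀).toReal + θ * (1 / p₁).toReal)
    {Φ : ℂ → ℂ} (hΦ : Continuous Φ) {M : ℝ≥0} (hM : 0 < M) (hΦM : eLpNorm Φ p volume ≤ M) :
    ∃ (a : ℝ) (ℓ : ℂ → ℝ), IsExpFamilyData p₀ p₁ a θ Φ ℓ ∧
      eLpNorm (fun w => ‖Φ w‖ * Real.exp (a * θ * ℓ w)) p₀ volume ≤ (M * 7 : ℝ≥0) ∧
      eLpNorm (fun w => ‖Φ w‖ * Real.exp (-(a * (1 - θ)) * ℓ w)) p₁ volume ≤ (M * 7 : ℝ≥0) := by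
  have hp₁ : 1 ≤ p₁ := hp₀.trans hp₀₁.le
  have hp₀0 : p₀ ≠ 0 := (zero_lt_one.trans_le hp₀).ne'
  have hp₁0 : p₁ ≠ 0 := (zero_lt_one.trans_le hp₁).ne'
  set P := p.toReal with hPdef
  have hP : 0 < P := ENNReal.toReal_pos hp0 hpt
  set r₀ := (1 / p₀).toReal
  set r₁ := (1 / p₁).toReal
  have hr : r₁ ≤ r₀ := by
    refine ENNReal.toReal_mono ?_ ?_
    · simp [hp₀0]
    · rw [one_div, one_div]; exact ENNReal.inv_le_inv.2 hp₀₁.le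
  have hp' : P * ((1 - θ) * r₀ + θ * r₁) = 1 := by
    rw [← hp, one_div, ENNReal.toReal_inv, mul_inv_cancel₀ hP.ne']
  have hMr : (0 : ℝ) < M := hM
  let φ : ℂ → ℂ := ((M : ℝ)⁻¹ : ℝ) • Φ
  have hφ : ∫⁻ w, ‖φ w‖ₑ ^ P ≤ 1 := by
    have h1 : eLpNorm φ p volume ≤ 1 := by
      rw [eLpNorm_const_smul, ← ofReal_norm, Real.norm_of_nonneg (by positivity),
        ENNReal.ofReal_inv_of_pos hMr, ENNReal.ofReal_coe_nnreal]
      calc _ ≤ (M : ℝ≥0∞)⁻¹ * M := by gcongr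
        _ = 1 := ENNReal.inv_mul_cancel (by exact_mod_cast hM.ne') (by simp)
    rw [eLpNorm_eq_lintegral_rpow_enorm_toReal hp0 hpt, ← ENNReal.rpow_le_rpow_iff hP,
      ← ENNReal.rpow_mul, one_div, inv_mul_cancel₀ hP.ne', ENNReal.rpow_one,
      ENNReal.one_rpow] at h1
    exact h1
  obtain ⟨ℓ, hℓm, hℓφ, hℓi, hℓloc, hℓt⟩ := exists_majorant hP (hΦ.const_smul _) hφ
  have hnorm : ∀ w, ‖Φ w‖ = M * ‖φ w‖ := by
    intro w
    simp only [φ, Pi.smul_apply]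
    rw [norm_smul, Real.norm_of_nonneg (by positivity), ← mul_assoc, mul_inv_cancel₀ hMr.ne',
      one_mul]
  -- The slope for which `1 + aθ = P/p₀` and `1 - a(1 - θ) = P/p₁`; the two equations are compatible
  -- by the relation between `p`, `p₀` and `p₁`.
  let a := P * (r₀ - r₁)
  have ha : 0 ≤ a := mul_nonneg hP.le (sub_nonneg.2 hr)
  have eleft : 1 + a * θ = P * r₀ := by simp only [a]; linarith
  have eright : 1 - a * (1 - θ) = P * r₁ := by simp only [a]; linarith
  have hb0 : ∀ w, ‖‖Φ w‖ * Real.exp (a * θ * ℓ w)‖ ≤ M * ‖Real.exp (P * r₀ * ℓ w)‖ := by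
    intro w
    rw [Real.norm_of_nonneg (by positivity), Real.norm_of_nonneg (Real.exp_nonneg _), hnorm,
      ← eleft, mul_assoc, add_mul, one_mul, Real.exp_add]
    gcongr
    exact hℓφ w
  have hb1 : ∀ w, ‖‖Φ w‖ * Real.exp (-(a * (1 - θ)) * ℓ w)‖ ≤
      M * ‖Real.exp (P * r₁ * ℓ w)‖ := by
    intro w
    rw [Real.norm_of_nonneg (by positivity), Real.norm_of_nonneg (Real.exp_nonneg _), hnorm,
      show P * r₁ * ℓ w = ℓ w + -(a * (1 - θ)) * ℓ w by rw [← eright]; ring, mul_assoc,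
      Real.exp_add]
    gcongr
    exact hℓφ w
  have hn0 : eLpNorm (fun w => ‖Φ w‖ * Real.exp (a * θ * ℓ w)) p₀ volume ≤ (M * 7 : ℝ≥0) := by
    refine (eLpNorm_le_mul_eLpNorm_of_ae_le_mul (Eventually.of_forall hb0) _).trans ?_
    rw [ENNReal.ofReal_coe_nnreal, ENNReal.coe_mul]
    gcongr
    exact eLpNorm_exp_mul_le hp₀ hℓi
  have hn1 : eLpNorm (fun w => ‖Φ w‖ * Real.exp (-(a * (1 - θ)) * ℓ w)) p₁ volume ≤
      (M * 7 : ℝ≥0) := by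
    refine (eLpNorm_le_mul_eLpNorm_of_ae_le_mul (Eventually.of_forall hb1) _).trans ?_
    rw [ENNReal.ofReal_coe_nnreal, ENNReal.coe_mul]
    gcongr
    exact eLpNorm_exp_mul_le hp₁ hℓi
  have hm0 : Measurable fun w => ‖Φ w‖ * Real.exp (a * θ * ℓ w) := by
    have := hΦ.measurable
    fun_prop
  have hm1 : Measurable fun w => ‖Φ w‖ * Real.exp (-(a * (1 - θ)) * ℓ w) := by
    have := hΦ.measurable
    fun_prop
  have hmem0 : MemLp (fun w => ‖Φ w‖ * Real.exp (a * θ * ℓ w)) p₀ volume :=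
    ⟨hm0.aestronglyMeasurable, hn0.trans_lt ENNReal.coe_lt_top⟩
  have hmem1 : MemLp (fun w => ‖Φ w‖ * Real.exp (-(a * (1 - θ)) * ℓ w)) p₁ volume :=
    ⟨hm1.aestronglyMeasurable, hn1.trans_lt ENNReal.coe_lt_top⟩
  refine ⟨a, ℓ, ⟨ha, hΦ.measurable, hℓm, hℓloc, hmem0, hmem1,
    tailVanishes_of_memLp hm0 hp₀0 (hp₀₁.trans_le le_top).ne hmem0, ?_⟩, hn0, hn1⟩
  -- For `p₁ = ∞` membership does not make tails small. Here `a(1 - θ) = 1`, so the edge modulus is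
  -- `M |φ| exp(-ℓ)`, which tends to `0` at infinity by the choice of the majorant.
  rcases eq_or_ne p₁ ∞ with ht | ht
  · have hr₁ : r₁ = 0 := by simp [r₁, ht]
    rw [hr₁, mul_zero] at eright
    intro ε hε
    rcases eq_or_ne ε ∞ with rfl | hεt
    · exact ⟨0, le_top⟩
    have hε0 : 0 < ε.toReal := ENNReal.toReal_pos hε hεt
    obtain ⟨R, hR⟩ := hℓt (ε.toReal / M) (by positivity)
    refine ⟨R, ?_⟩
    rw [ht, eLpNorm_exponent_top]
    refine eLpNormEssSup_le_of_ae_enorm_bound (Eventually.of_forall fun w => ?_)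
    by_cases hw : w ∈ {w : ℂ | R ≤ ‖w‖}
    · rw [Set.indicator_of_mem hw, ← ofReal_norm, Real.norm_of_nonneg (by positivity)]
      refine ENNReal.ofReal_le_of_le_toReal ?_
      rw [show -(a * (1 - θ)) = -1 by linarith, hnorm]
      have h1 : Real.exp (ℓ w) * Real.exp (-1 * ℓ w) = 1 := by
        rw [← Real.exp_add, show ℓ w + -1 * ℓ w = 0 by ring, Real.exp_zero]
      calc M * ‖φ w‖ * Real.exp (-1 * ℓ w)
          ≤ M * (ε.toReal / M * Real.exp (ℓ w)) * Real.exp (-1 * ℓ w) := by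
            gcongr; exact hR w hw
        _ = ε.toReal * (Real.exp (ℓ w) * Real.exp (-1 * ℓ w)) := by field_simp
        _ = ε.toReal := by rw [h1, mul_one]
    · rw [Set.indicator_of_notMem hw]; simp
  · exact tailVanishes_of_memLp hm1 hp₁0 ht hmem1

/-- The weighted function `Φ` is put into an analytic family and projected; at `θ` the projection
reproduces `f`. -/
theorem exists_complexInterpolation_of_mem {p₀ p₁ p : ℝ≥0∞} (hp₀ : 1 ≤ p₀) (hp₀₁ : p₀ < p₁)
    (hp1 : 1 ≤ p) (hpt : p ≠ ∞) {θ : ℝ}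
    (hp : (1 / p).toReal = (1 - θ) * (1 / p₀).toReal + θ * (1 / p₁).toReal) (m : ℕ) :
    ∃ C : ℝ≥0, ∀ f ∈ FockSobolevSpace p m,
      f ∈ complexInterpolationSpace (fockSobolevENorm p₀ m) (fockSobolevENorm p₁ m) θ ∧
      complexInterpolationENorm (fockSobolevENorm p₀ m) (fockSobolevENorm p₁ m) θ f ≤
        C * fockSobolevENorm p m f := by
  have hp₁ : 1 ≤ p₁ := hp₀.trans hp₀₁.le
  have hp0 : p ≠ 0 := (zero_lt_one.trans_le hp1).ne'
  obtain ⟨c, hc0, hc⟩ := exists_fockSobolevENorm_eq hp1 m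
  obtain ⟨A, hA⟩ := exists_eLpNorm_one_add_pow_le hp1 m
  obtain ⟨D, hD⟩ := exists_calderonENorm_fockProj_le hp₀ hp₁ m
  refine ⟨(D * 7 + 1) * (A * c⁻¹), fun f hf => ?_⟩
  obtain ⟨hfd, hfp⟩ := (mem_fockSobolevSpace_iff hp1).1 hf
  set Φ : ℂ → ℂ := fun z : ℂ => (((1 + ‖z‖) ^ m : ℝ) : ℂ) * f z * (Real.exp (-‖z‖ ^ 2 / 2) : ℂ)
    with hΦ
  have hΦc : Continuous Φ := continuous_one_add_pow_mul hfd m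
  have hΦf : eLpNorm Φ p volume ≤ A * powENorm p m f := hA f hfd
  have hΦp : MemLp Φ p volume := ⟨hΦc.aestronglyMeasurable,
    hΦf.trans_lt (ENNReal.mul_lt_top ENNReal.coe_lt_top hfp.2)⟩
  have key : ∀ M : ℝ≥0, 0 < M → eLpNorm Φ p volume ≤ M → ∃ F : ℂ → ℂ → ℂ,
      IsCalderonFunction (fockSobolevENorm p₀ m) (fockSobolevENorm p₁ m) F ∧ F θ = f ∧
      calderonENorm (fockSobolevENorm p₀ m) (fockSobolevENorm p₁ m) F ≤ D * (M * 7 : ℝ≥0) := by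
    intro M hM hΦM
    obtain ⟨a, ℓ, hd, h0, h1⟩ := exists_isExpFamilyData hp₀ hp₀₁ hp0 hpt hp hΦc hM hΦM
    refine ⟨_, hd.isCalderonFunction hp₀ hp₁ m, ?_, hD hd h0 h1⟩
    have e : expFamily a θ Φ ℓ θ = Φ := by
      ext w; simp [expFamily]
    simp only [e]
    exact fockProj_eq_self hfd hp1 hΦp
  refine ⟨?_, ?_⟩
  · obtain ⟨F, hF, hFθ, -⟩ := key ((eLpNorm Φ p volume).toNNReal + 1) (by positivity) (by
      rw [ENNReal.coe_add, ENNReal.coe_toNNReal hΦp.2.ne]; exact le_self_add)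
    exact ⟨F, hF, hFθ⟩
  · have hB0 : ((D * 7 + 1 : ℝ≥0) : ℝ≥0∞) ≠ 0 := by
      rw [ENNReal.coe_ne_zero]; positivity
    have h1 : complexInterpolationENorm (fockSobolevENorm p₀ m) (fockSobolevENorm p₁ m) θ f /
        (D * 7 + 1 : ℝ≥0) ≤ eLpNorm Φ p volume := by
      -- The construction needs a positive bound `M`, so it runs over all `M` above the norm of `Φ`;
      -- this covers `Φ = 0` as well.
      refine le_of_forall_gt_imp_ge_of_dense fun M hM => ?_
      rcases eq_or_ne M ∞ with rfl | hMt
      · exact le_top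
      lift M to ℝ≥0 using hMt
      obtain ⟨F, hF, hFθ, hFn⟩ := key M (by exact_mod_cast (zero_le (a := eLpNorm Φ p volume)).trans_lt hM) hM.le
      refine ENNReal.div_le_of_le_mul ?_
      have h2 : complexInterpolationENorm (fockSobolevENorm p₀ m) (fockSobolevENorm p₁ m) θ f ≤
          calderonENorm (fockSobolevENorm p₀ m) (fockSobolevENorm p₁ m) F :=
        iInf₂_le F ⟨hF, hFθ⟩
      refine (h2.trans hFn).trans ?_
      rw [← ENNReal.coe_mul, ← ENNReal.coe_mul, ENNReal.coe_le_coe, mul_left_comm]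
      gcongr
      exact le_self_add
    rw [ENNReal.div_le_iff hB0 ENNReal.coe_ne_top] at h1
    refine h1.trans ?_
    rw [hc f hfd]
    have hcc : ((A * c⁻¹ : ℝ≥0) : ℝ≥0∞) * (c * powENorm p m f) = A * powENorm p m f := by
      rw [← mul_assoc, ← ENNReal.coe_mul, mul_assoc, inv_mul_cancel₀ hc0, mul_one]
    rw [ENNReal.coe_mul, mul_assoc, hcc, mul_comm]
    gcongr

/-- As `p₀` is finite and `θ < 1`, the reciprocal of `p` is positive, so `p` is finite even for `p₁
= ∞`. -/
theorem toReal_one_div_eq {p₀ p₁ p : ℝ≥0∞} (hp₀ : 1 ≤ p₀) (hp₀₁ : p₀ < p₁)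
    {θ : ℝ} (hθ₀ : 0 < θ) (hθ₁ : θ < 1)
    (hp : 1 / p = ENNReal.ofReal (1 - θ) / p₀ + ENNReal.ofReal θ / p₁) :
    1 ≤ p ∧ p ≠ ∞ ∧
      (1 / p).toReal = (1 - θ) * (1 / p₀).toReal + θ * (1 / p₁).toReal := by
  have hp₁ : 1 ≤ p₁ := hp₀.trans hp₀₁.le
  have hp₀t : p₀ ≠ ∞ := (hp₀₁.trans_le le_top).ne
  have h0 : ENNReal.ofReal (1 - θ) / p₀ ≤ ENNReal.ofReal (1 - θ) := by
    rw [div_eq_mul_inv]; exact mul_le_of_le_one_right' (ENNReal.inv_le_one.2 hp₀)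
  have h1 : ENNReal.ofReal θ / p₁ ≤ ENNReal.ofReal θ := by
    rw [div_eq_mul_inv]; exact mul_le_of_le_one_right' (ENNReal.inv_le_one.2 hp₁)
  refine ⟨?_, ?_, ?_⟩
  · have h2 : 1 / p ≤ 1 := by
      rw [hp]
      refine (add_le_add h0 h1).trans ?_
      rw [← ENNReal.ofReal_add (by linarith) hθ₀.le]; simp
    rwa [one_div, ENNReal.inv_le_one] at h2
  · rintro rfl
    rw [one_div, ENNReal.inv_top, eq_comm, add_eq_zero, ENNReal.div_eq_zero_iff] at hp
    rcases hp.1 with h | h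
    · rw [ENNReal.ofReal_eq_zero] at h; linarith
    · exact hp₀t h
  · rw [hp, ENNReal.toReal_add (h0.trans_lt (by simp)).ne (h1.trans_lt (by simp)).ne,
      ENNReal.toReal_div, ENNReal.toReal_div, ENNReal.toReal_ofReal (by linarith),
      ENNReal.toReal_ofReal hθ₀.le, one_div, one_div, ENNReal.toReal_inv, ENNReal.toReal_inv]
    ring

theorem theorem15 (m : ℕ) (hm : 0 < m) (p₀ p₁ p : ℝ≥0∞) (hp₀ : 1 ≤ p₀) (hp₀₁ : p₀ < p₁)
    (θ : ℝ) (hθ₀ : 0 < θ) (hθ₁ : θ < 1)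
    (hp : 1 / p = ENNReal.ofReal (1 - θ) / p₀ + ENNReal.ofReal θ / p₁) :
    complexInterpolationSpace (fockSobolevENorm p₀ m) (fockSobolevENorm p₁ m) θ
        = FockSobolevSpace p m ∧
      ∃ C : ℝ≥0, ∀ f ∈ FockSobolevSpace p m,
        complexInterpolationENorm (fockSobolevENorm p₀ m) (fockSobolevENorm p₁ m) θ f
            ≤ C * fockSobolevENorm p m f ∧
          fockSobolevENorm p m f
            ≤ C * complexInterpolationENorm (fockSobolevENorm p₀ m) (fockSobolevENorm p₁ m) θ f := by
  obtain ⟨hp1, hpt, hp'⟩ := toReal_one_div_eq hp₀ hp₀₁ hθ₀ hθ₁ hp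
  have hp₁ : 1 ≤ p₁ := hp₀.trans hp₀₁.le
  have hp0 : p ≠ 0 := (zero_lt_one.trans_le hp1).ne'
  obtain ⟨C, hC⟩ := exists_complexInterpolation_of_mem hp₀ hp₀₁ hp1 hpt hp' m
  obtain ⟨D, hD⟩ := exists_powENorm_le_calderonENorm (m := m) hp₀ hp₁ hpt hp0 hθ₀ hθ₁ hp'
  obtain ⟨c, -, hc⟩ := exists_fockSobolevENorm_eq hp1 m
  refine ⟨Set.Subset.antisymm ?_ fun f hf => (hC f hf).1, max C (c * D + 1), fun f hf => ⟨?_, ?_⟩⟩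
  · rintro _ ⟨F, hF, rfl⟩
    obtain ⟨h1, h2, h3⟩ := hD F hF
    refine (mem_fockSobolevSpace_iff hp1).2 ⟨h1, (continuous_pow_mul h1 m).aestronglyMeasurable, ?_⟩
    exact h3.trans_lt (ENNReal.mul_lt_top ENNReal.coe_lt_top h2)
  · refine (hC f hf).2.trans ?_
    gcongr
    exact le_max_left _ _
  -- The summand `1` again makes the constant non-zero, so that it passes through the infimum
  -- defining the interpolation norm.
  · have h1 : fockSobolevENorm p m f ≤ ((c * D + 1 : ℝ≥0) : ℝ≥0∞) *
        complexInterpolationENorm (fockSobolevENorm p₀ m) (fockSobolevENorm p₁ m) θ f := by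
      have hne : ((c * D + 1 : ℝ≥0) : ℝ≥0∞) ≠ 0 := by
        rw [ENNReal.coe_ne_zero]; positivity
      rw [complexInterpolationENorm, ENNReal.mul_iInf_of_ne hne ENNReal.coe_ne_top]
      refine le_iInf fun F => ?_
      rw [ENNReal.mul_iInf_of_ne hne ENNReal.coe_ne_top]
      refine le_iInf fun hF => ?_
      obtain ⟨hF, rfl⟩ := hF
      obtain ⟨k1, -, k3⟩ := hD F hF
      rw [hc _ k1]
      calc (c : ℝ≥0∞) * powENorm p m (F θ)
          ≤ c * (D * calderonENorm (fockSobolevENorm p₀ m) (fockSobolevENorm p₁ m) F) := by gcongr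
        _ = ((c * D : ℝ≥0) : ℝ≥0∞) *
            calderonENorm (fockSobolevENorm p₀ m) (fockSobolevENorm p₁ m) F := by
          rw [ENNReal.coe_mul, mul_assoc]
        _ ≤ _ := by gcongr; exact le_self_add
    refine h1.trans ?_
    gcongr
    exact le_max_right _ _
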